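/- Let $W$ be a binary memoryless symmetric (BMS) channel with arbitrary output space $\mathcal Y$ and Shannon capacity $I(W)$ (in bits). Let $N=2^n$, $G_N=\left[\begin{smallmatrix}1&0\\1&1\end{smallmatrix}\right]^{\otimes n}$ over $\mathbb F_2$; a polar code of length $N$ with information set $\mathcal I\subseteq\{0,\dots,N-1\}$ sends $x=uG_N$ over $W$, where $u$ is arbitrary on $\mathcal I$ and $0$ on the frozen indices $\mathcal I^c$. Let $Q:[-\infty,\infty]\to[-\infty,\infty]$ be measurable and anti-symmetric ($Q(-x)=-Q(x)$) with finite range $\mathcal Q$. The decoder $\mathrm{SCD}_Q$ is the successive cancellation decoder in which $Q$ is applied to the output of every computation: the channel output $y$ gives the message $Q\big(\log\frac{W(y\mid 0)}{W(y\mid 1)}\big)$, a variable node maps messages $a,b$ to $Q(a+b)$ (with $\infty+(-\infty)=0$), a check node maps them to $Q\big(2\tanh^{-1}(\tanh\frac a2\tanh\frac b2)\big)$, and an information bit is decoded to $0$ if its final message is positive, to $1$ if it is negative, and by a fair coin if it is $0$. Let $C(W,Q)$ be the supremum of all $R$ for which there are information sets $\mathcal I_n\subseteq\{0,\dots,2^n-1\}$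 with $|\mathcal I_n|\ge 2^nR$ such that the block error probability of $\mathrm{SCD}_Q$ (averaged over uniform data) tends to $0$ as $n\to\infty$. (i) Suppose that $|\mathcal Q|=3$ and $Q(x)>0$ for all $x>0$ (for example $Q(x)=\infty,0,-\infty$ for $x>0$, $x=0$, $x<0$: the decoder with erasures). For a triple $D=(p,e,m)$ put $$D^+=(p^2+2pe,\;e^2+2pm,\;m^2+2em),\qquad D^-=(p^2+m^2,\;1-(1-e)^2,\;2pm),$$ $$I(D)=(m+p)\Big(1-h_2\big(\tfrac{p}{p+m}\big)\Big),\qquad F(D)=p-4\sqrt{pm},$$ where $h_2$ is the binary entropy function in bits (and $I(0,1,0)=0$). Let $L(Y)=\log\frac{W(Y\mid 0)}{W(Y\mid 1)}$ with $Y\sim W(\cdot\mid 0)$, let $D_0=(\Pr(L(Y)>0),\Pr(L(Y)=0),\Pr(L(Y)<0))$, and let $D_{n+1}$ be $D_n^+$ or $D_n^-$ with probability $\tfrac12$ each, independently of the past. Then the explicitly computable sequences $L_n=\mathbb E[F(D_n)]$ and $U_n=\mathbb E[I(D_n)]$ are respectively non-decreasing and non-increasing, $L_n\le C(W,Q)\le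 U_n$ for all $n\ge 0$, and $$\lim_{n\to\infty}L_n=\lim_{n\to\infty}U_n=C(W,Q).$$ (ii) There is a universal constant $c>0$ such that for every $0<\delta\le\tfrac12$ there is a quantizer $Q$ as above with $\log_2|\mathcal Q|\le c\,\log_2(1/\delta)$ such that $C(W,Q)\ge I(W)-\delta$ for every BMS channel $W$. -/

import Mathlib

open MeasureTheory Filter Topology
open scoped ENNReal Kronecker

noncomputable section

namespace PolarSCD

/-! ### Binary memoryless symmetric channels -/

/-- A binary-input memoryless symmetric (BMS) channel with an arbitrary measurable output space `Y`.
`law x` is the distribution of the output of one channel use when the input bit is `x`; symmetry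
means that some measurable involution of the outputs carries `law 0` to `law 1`.
Memorylessness enters through the product measure in `blockErr`. -/
structure BMSChannel (Y : Type*) [MeasurableSpace Y] where
  law : ZMod 2 → Measure Y
  isProb : ∀ x, IsProbabilityMeasure (law x)
  symm : ∃ π : Y → Y, Measurable π ∧ Function.Involutive π ∧ (law 0).map π = law 1

variable {Y : Type*} [MeasurableSpace Y]

/-- Mutual information (in nats) between the input and the output of one use of the channel, when
the input is `0` with probability `t` and `1` with probability `1 - t`:
`∑ₓ P(x) D(W(·|x) ‖ PW)`. -/
def BMSChannel.mutualInfo (W : BMSChannel Y) (t : unitInterval) : ℝ≥0∞ :=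
  let out : Measure Y :=
    ENNReal.ofReal t • W.law 0 + ENNReal.ofReal (1 - t) • W.law 1
  ENNReal.ofReal t * InformationTheory.klDiv (W.law 0) out
    + ENNReal.ofReal (1 - t) * InformationTheory.klDiv (W.law 1) out

/-- The Shannon capacity `I(W)` in bits per channel use: the supremum of the mutual information over
all input distributions. (The supremum is at most `log 2` nats, hence finite.) -/
def BMSChannel.capacity (W : BMSChannel Y) : ℝ :=
  (⨆ t : unitInterval, W.mutualInfo t).toReal / Real.log 2

/-- The log-likelihood ratio `log (W(y|0) / W(y|1)) ∈ [-∞, ∞]`, where the likelihoods are the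
densities with respect to `law 0 + law 1`. -/
def BMSChannel.llr (W : BMSChannel Y) (y : Y) : EReal :=
  ENNReal.log ((W.law 0).rnDeriv (W.law 0 + W.law 1) y
    / (W.law 1).rnDeriv (W.law 0 + W.law 1) y)

/-! ### Quantizers and the quantized message-passing rules -/

/-- A quantizer: a (measurable) anti-symmetric function `[-∞, ∞] → [-∞, ∞]` with finite range. -/
structure Quantizer where
  toFun : EReal → EReal
  odd : ∀ x, toFun (-x) = -toFun x
  finite_range : (Set.range toFun).Finite
  measurable : Measurable toFun

instance : CoeFun Quantizer (fun _ => EReal → EReal) := ⟨Quantizer.toFun⟩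

/-- The number of messages, i.e. the cardinality of the range of the quantizer. -/
def Quantizer.card (Q : Quantizer) : ℕ := (Set.range Q).ncard

/-- Addition of log-likelihood ratios, with `∞ + (-∞) = (-∞) + ∞ = 0`. -/
def llrAdd (a b : EReal) : EReal :=
  if (a = ⊤ ∧ b = ⊥) ∨ (a = ⊥ ∧ b = ⊤) then 0 else a + b

/-- `tanh (a / 2)` for `a ∈ [-∞, ∞]`, with `tanh (±∞) = ±1`. -/
def tanhHalf (a : EReal) : ℝ :=
  if a = ⊤ then 1 else if a = ⊥ then -1 else Real.tanh (a.toReal / 2)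

/-- `2 tanh⁻¹ t` for `t ∈ [-1, 1]`, with `tanh⁻¹ (±1) = ±∞`. -/
def twoArtanh (t : ℝ) : EReal :=
  if 1 ≤ t then ⊤ else if t ≤ -1 then ⊥ else ((2 * Real.artanh t : ℝ) : EReal)

/-- Quantized variable-node rule. -/
def varOp (Q : Quantizer) (a b : EReal) : EReal := Q (llrAdd a b)

/-- Quantized check-node rule. -/
def checkOp (Q : Quantizer) (a b : EReal) : EReal := Q (twoArtanh (tanhHalf a * tanhHalf b))

/-! ### Polar codes and the quantized successive cancellation decoder -/

/-- Positions of a block of length `2 ^ (n + 1)` as (half, position in that half):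
`(a, k)` corresponds to `2 ^ n * a + k`. -/
def halves (n : ℕ) : Fin 2 × Fin (2 ^ n) ≃ Fin (2 ^ (n + 1)) :=
  finProdFinEquiv.trans (finCongr (pow_succ' 2 n).symm)

/-- The `n`-th Kronecker power of `[[1, 0], [1, 1]]` over the field with two elements. -/
def polarMatrix : (n : ℕ) → Matrix (Fin (2 ^ n)) (Fin (2 ^ n)) (ZMod 2)
  | 0 => 1
  | n + 1 => Matrix.reindex (halves n) (halves n) (!![1, 0; 1, 1] ⊗ₖ polarMatrix n)

/-- The codeword `x = u G_N`. -/
def encode (n : ℕ) (u : Fin (2 ^ n) → ZMod 2) : Fin (2 ^ n) → ZMod 2 :=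
  Matrix.vecMul u (polarMatrix n)

/-- A message about a bit, converted to a message about that bit plus the known bit `x`. -/
def signFlip (x : ZMod 2) (a : EReal) : EReal := if x = 0 then a else -a

/-- The successive cancellation decoder in which the quantizer is applied to the output of every
computation. `info` is the set of information indices (the other bits are frozen to `0`), `coin`
contains the bits used to break ties and `m` the quantized log-likelihood ratios of the channel
outputs; the value is the decoded word `û`.

Bits are decoded in their natural order. As `x = u G_N` with `u = (u', u'')` reads
`x = (u' G_{N/2} + u'' G_{N/2}, u'' G_{N/2})`, the decoder combines the two halves of the received
messages by check nodes and decodes `u'`, then uses the estimate of `u'` to combine them by variable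
nodes and decodes `u''`. A single information bit is decoded to `0` if its message is positive, to
`1` if it is negative, and to the coin if it vanishes. -/
def decode (Q : Quantizer) : (n : ℕ) → (info : Finset (Fin (2 ^ n))) →
    (coin : Fin (2 ^ n) → ZMod 2) → (m : Fin (2 ^ n) → EReal) → Fin (2 ^ n) → ZMod 2
  | 0, info, coin, m => fun i =>
      if i ∈ info then (if 0 < m i then 0 else if m i < 0 then 1 else coin i) else 0
  | n + 1, info, coin, m =>
      let infoHalf (a : Fin 2) : Finset (Fin (2 ^ n)) := {k | halves n (a, k) ∈ info}
      let coinHalf (a : Fin 2) (k : Fin (2 ^ n)) : ZMod 2 := coin (halves n (a, k))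
      let first : Fin (2 ^ n) → ZMod 2 :=
        decode Q n (infoHalf 0) (coinHalf 0)
          (fun k => checkOp Q (m (halves n (0, k))) (m (halves n (1, k))))
      let second : Fin (2 ^ n) → ZMod 2 :=
        decode Q n (infoHalf 1) (coinHalf 1)
          (fun k => varOp Q (signFlip (encode n first k) (m (halves n (0, k))))
            (m (halves n (1, k))))
      fun i => if ((halves n).symm i).1 = 0 then first ((halves n).symm i).2
        else second ((halves n).symm i).2

/-- The input words of a polar code: arbitrary on the information indices, `0` on frozen indices. -/
def codeInputs (n : ℕ) (info : Finset (Fin (2 ^ n))) : Finset (Fin (2 ^ n) → ZMod 2) :=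
  {u | ∀ i, i ∉ info → u i = 0}

/-- The block error probability of the quantized successive cancellation decoder for the polar code
of length `2 ^ n` with information set `info`: the average, over uniformly distributed data and
uniformly distributed tie-breaking coins, of the probability under the memoryless channel that the
decoded word differs from the input word. -/
def blockErr (W : BMSChannel Y) (Q : Quantizer) (n : ℕ) (info : Finset (Fin (2 ^ n))) : ℝ :=
  (∑ u ∈ codeInputs n info, ∑ coin : Fin (2 ^ n) → ZMod 2,
    (Measure.pi fun k => W.law (encode n u k)).real
      {y | decode Q n info coin (fun k => Q (W.llr (y k))) ≠ u})
    / ((codeInputs n info).card * (2 : ℝ) ^ (2 ^ n))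

/-- `R` is an achievable rate: there are polar codes of length `2 ^ n`, `n = 0, 1, 2, …`, of rate at
least `R`, whose block error probability under the quantized decoder tends to `0`. -/
def IsAchievable (W : BMSChannel Y) (Q : Quantizer) (R : ℝ) : Prop :=
  ∃ info : (n : ℕ) → Finset (Fin (2 ^ n)),
    (∀ n, R * 2 ^ n ≤ ((info n).card : ℝ)) ∧
      Tendsto (fun n => blockErr W Q n (info n)) atTop (𝓝 0)

/-- `C(W, Q)`: the maximum rate at which reliable transmission is possible. (The set of achievable
rates contains `0` and is bounded above by `1`.) -/
def maxRate (W : BMSChannel Y) (Q : Quantizer) : ℝ := sSup {R | IsAchievable W Q R}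

/-! ### Density evolution for the three-message decoder -/

/-- The distribution of a three-valued message: positive, zero and negative with probabilities
`p`, `e` and `m`. -/
structure Density where
  p : ℝ
  e : ℝ
  m : ℝ

/-- Distribution of the output of a variable node. -/
def Density.plus (D : Density) : Density :=
  ⟨D.p ^ 2 + 2 * D.p * D.e, D.e ^ 2 + 2 * D.p * D.m, D.m ^ 2 + 2 * D.e * D.m⟩

/-- Distribution of the output of a check node. -/
def Density.minus (D : Density) : Density :=
  ⟨D.p ^ 2 + D.m ^ 2, 1 - (1 - D.e) ^ 2, 2 * D.p * D.m⟩

/-- One step of the evolution, through a variable node (`true`) or a check node (`false`). -/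
def Density.step (D : Density) (b : Bool) : Density := if b then D.plus else D.minus

/-- The capacity `(m + p) (1 - h₂ (p / (p + m)))` of the channel represented by a density. -/
def Density.I (D : Density) : ℝ :=
  (D.m + D.p) * (1 - Real.binEntropy (D.p / (D.p + D.m)) / Real.log 2)

/-- The function `F = p - 4 √(p m)`. -/
def Density.F (D : Density) : ℝ := D.p - 4 * Real.sqrt (D.p * D.m)

/-- `𝔼 [g (D_n)]` for the process started at `D₀ = D` in which each step is, independently and with
probability `1 / 2` each, a variable-node or a check-node step. -/
def Density.expect (g : Density → ℝ) (n : ℕ) (D : Density) : ℝ :=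
  (∑ s : Fin n → Bool, g ((List.ofFn s).foldl Density.step D)) / 2 ^ n

/-- The initial density `D₀`: the law of the sign of the log-likelihood ratio under input `0`. -/
def BMSChannel.signDensity (W : BMSChannel Y) : Density :=
  ⟨(W.law 0).real {y | 0 < W.llr y}, (W.law 0).real {y | W.llr y = 0},
    (W.law 0).real {y | W.llr y < 0}⟩

/-- The upper bounds `U_n = 𝔼 [I (D_n)]`. -/
def upperBound (W : BMSChannel Y) (n : ℕ) : ℝ := W.signDensity.expect Density.I n

/-- The lower bounds `L_n = 𝔼 [F (D_n)]`. -/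
def lowerBound (W : BMSChannel Y) (n : ℕ) : ℝ := W.signDensity.expect Density.F n

end PolarSCD

end

/-!
The quantized decoder commutes with sign changes, so by the symmetry of the channel the block error
probability is that of the zero word, for independent messages with the law of the quantized channel
output under input `0` (`blockErr_eq`). This law evolves by the binary process `lawStep`: a check
node or a variable node combines two independent copies. The probability that the decision on an
information bit, after correct decisions on the bits before it, is wrong is at most the block error
probability, and the sum of these probabilities bounds it from above.

Achievability (`maxRate_ge`) is reduced to any functional `Z` of laws that dominates the bit error
probability, grows at most by a constant factor at check nodes and shrinks by a small factor at
variable nodes once it is small: then `Z ^ (1 / 8)` is a supermartingale with geometric decay as long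
as `Z` is small, and the fraction of paths on which `Z` is small after a fixed number of steps is
achievable up to a small loss. Conversely (`maxRate_le`) the rate is bounded by the mean, after
arbitrarily many steps, of any nonnegative functional that is close to `1` on all reliable laws.

For three messages the law is a triple `D`, which evolves by `D⁺` and `D⁻`. The information `I(D)` is
a supermartingale by the chain rule and data processing (`Density.Valid.I_step_le`), and `F(D)` is a
submartingale (`Density.Valid.F_step_ge`), whose mean increment bounds `m²`. A second potential
shows that `p (1 - p)` tends to `0` as well (`Density.Valid.potential_step_ge`). Hence `p` polarizes
to `{0, 1}`, the difference `I - F` vanishes in the mean, and both sequences converge to the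
probability that `p` tends to `1`, which is the maximum rate.

For many messages the quantizer is uniform with step `1 / N` and saturates at `±M`. Three facts about
the law of a message carry the proof.
* Every label `x` is treated as a log-likelihood ratio. The *gap* between the mutual information of a
  message and the score of its labels is a Kullback-Leibler divergence. Without quantization both
  information and score are preserved by the polar transform, so each step increases the gap at most
  by a constant factor and the quantization error (`msgGap_step_le`).
* The Bhattacharyya weight `e^{-x/2}`, set to zero for saturated messages, satisfies the hypotheses
  of `maxRate_ge`, because two messages `M` combine to `M` at both kinds of nodes
  (`Msg.weight_check_le`, `Msg.weight_var_le`).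
* The minimum of the root of the information and a power of the weight contracts on average, as long
  as the gap is small (`msgPotential_step_le`): if hard decisions are unreliable a check node loses a
  fixed fraction of the information, and otherwise the weight is small.
After a number of steps proportional to `log (1 / δ)` almost all paths therefore have little
information or a small weight, while the mean information is still close to the capacity, and this
only requires `log N` and `M` of the order of `log (1 / δ)`.
-/

open MeasureTheory Filter Topology
open scoped ENNReal Kronecker

noncomputable section

namespace PolarSCD

/-! ### Averages over the branches of a binary process -/

/-- `pathAvg st n f D` is the mean of `f` over the `2 ^ n` states reached from `D` by `n` steps, where
`st false` and `st true` are the two possible steps. -/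
def pathAvg {α : Type*} (st : Bool → α → α) : ℕ → (α → ℝ) → α → ℝ
  | 0, f, D => f D
  | n + 1, f, D => (pathAvg st n f (st false D) + pathAvg st n f (st true D)) / 2

section PathAvg

variable {α : Type*} {st : Bool → α → α}

lemma pathAvg_mono {f g : α → ℝ} (h : ∀ D, f D ≤ g D) (n : ℕ) (D : α) :
    pathAvg st n f D ≤ pathAvg st n g D := by
  induction n generalizing D with
  | zero => exact h D
  | succ n ih => simp only [pathAvg]; linarith [ih (st false D), ih (st true D)]

lemma pathAvg_const (c : ℝ) (n : ℕ) (D : α) : pathAvg st n (fun _ => c) D = c := by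
  induction n generalizing D with
  | zero => rfl
  | succ n ih => simp [pathAvg, ih]

lemma pathAvg_add (f g : α → ℝ) (n : ℕ) (D : α) :
    pathAvg st n (fun D => f D + g D) D = pathAvg st n f D + pathAvg st n g D := by
  induction n generalizing D with
  | zero => rfl
  | succ n ih => simp only [pathAvg, ih]; ring

lemma pathAvg_mul (c : ℝ) (f : α → ℝ) (n : ℕ) (D : α) :
    pathAvg st n (fun D => c * f D) D = c * pathAvg st n f D := by
  induction n generalizing D with
  | zero => rfl
  | succ n ih => simp only [pathAvg, ih]; ring

lemma pathAvg_sub (f g : α → ℝ) (n : ℕ) (D : α) :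
    pathAvg st n (fun D => f D - g D) D = pathAvg st n f D - pathAvg st n g D := by
  induction n generalizing D with
  | zero => rfl
  | succ n ih => simp only [pathAvg, ih]; ring

lemma pathAvg_nonneg {f : α → ℝ} (h : ∀ D, 0 ≤ f D) (n : ℕ) (D : α) : 0 ≤ pathAvg st n f D := by
  simpa [pathAvg_const] using pathAvg_mono (st := st) h n D

lemma pathAvg_comp_add (f : α → ℝ) (n k : ℕ) (D : α) :
    pathAvg st (n + k) f D = pathAvg st n (pathAvg st k f) D := by
  induction n generalizing D with
  | zero => simp [pathAvg]
  | succ n ih => rw [Nat.succ_add]; simp only [pathAvg, ih]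

lemma pathAvg_succ (f : α → ℝ) (n : ℕ) (D : α) :
    pathAvg st (n + 1) f D = pathAvg st n (fun D => (f (st false D) + f (st true D)) / 2) D :=
  pathAvg_comp_add f n 1 D

/-- A semiconjugacy of processes transports the averages. -/
lemma pathAvg_comp {β : Type*} {st' : Bool → β → β} {φ : α → β}
    (h : ∀ b D, φ (st b D) = st' b (φ D)) (f : β → ℝ) (n : ℕ) (D : α) :
    pathAvg st n (fun D => f (φ D)) D = pathAvg st' n f (φ D) := by
  induction n generalizing D with
  | zero => rfl
  | succ n ih => simp only [pathAvg, ih, h]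

/-- Iterating a one-step bound on a nonnegative function with an additive error. -/
lemma pathAvg_le_geometric {f e : α → ℝ} {r : ℝ} (hr : 0 ≤ r)
    (h : ∀ D, (f (st false D) + f (st true D)) / 2 ≤ r * f D + e D) {B : ℝ}
    (D : α) (N : ℕ) (hB : ∀ n < N, pathAvg st n e D ≤ B) :
    ∀ n ≤ N, pathAvg st n f D ≤ r ^ n * f D + B * ∑ j ∈ Finset.range n, r ^ j := by
  intro n
  induction n with
  | zero => intro _; simp [pathAvg]
  | succ n ih =>
    intro hn
    have h1 := ih (by omega)
    rw [pathAvg_succ]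
    have h2 := (pathAvg_mono (st := st) h n D)
    rw [pathAvg_add, pathAvg_mul] at h2
    have h3 := hB n (by omega)
    have h4 := mul_le_mul_of_nonneg_left h1 hr
    have h5 : ∑ j ∈ Finset.range (n + 1), r ^ j = r * ∑ j ∈ Finset.range n, r ^ j + 1 := by
      rw [Finset.sum_range_succ', Finset.mul_sum]; simp [pow_succ, mul_comm]
    rw [h5]
    calc _ ≤ _ := h2
      _ ≤ r * (r ^ n * f D + B * ∑ j ∈ Finset.range n, r ^ j) + B := by linarith
      _ = _ := by ring

lemma five_rpow_le : (5 : ℝ) ^ (1 / 8 : ℝ) ≤ 5 / 4 := by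
  rw [show (5 / 4 : ℝ) = ((5 / 4 : ℝ) ^ (8 : ℕ)) ^ (1 / 8 : ℝ) by
    rw [← Real.rpow_natCast, ← Real.rpow_mul (by norm_num)]; norm_num]
  exact Real.rpow_le_rpow (by norm_num) (by norm_num) (by norm_num)

lemma four_rpow_le : (4 : ℝ) ^ (1 / 8 : ℝ) ≤ 6 / 5 := by
  rw [show (6 / 5 : ℝ) = ((6 / 5 : ℝ) ^ (8 : ℕ)) ^ (1 / 8 : ℝ) by
    rw [← Real.rpow_natCast, ← Real.rpow_mul (by norm_num)]; norm_num]
  exact Real.rpow_le_rpow (by norm_num) (by norm_num) (by norm_num)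

lemma inv_four_pow_rpow : ((4 : ℝ)⁻¹ ^ 8) ^ (1 / 8 : ℝ) = 1 / 4 := by
  rw [← Real.rpow_natCast, ← Real.rpow_mul (by norm_num)]; norm_num

/-- One step multiplies `z` by at most `5` or by at most `4⁻⁸`; the eighth root is then contracted on
average. The exponent `1 / 8` is small enough for the rate `3 / 4` to beat the growth `4 ^ (n / 8)`
that the tail bound below pays for reaching the level `4⁻ⁿ`. -/
lemma rpow_average_le {z z₀ z₁ : ℝ} (hz : 0 ≤ z) (h₀ : 0 ≤ z₀) (h₁ : 0 ≤ z₁)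
    (h0 : z₀ ≤ 5 * z) (h1 : z₁ ≤ 4⁻¹ ^ 8 * z) :
    (z₀ ^ (1 / 8 : ℝ) + z₁ ^ (1 / 8 : ℝ)) / 2 ≤ 3 / 4 * z ^ (1 / 8 : ℝ) := by
  have a := Real.rpow_le_rpow h₀ h0 (by norm_num : (0 : ℝ) ≤ 1 / 8)
  have b := Real.rpow_le_rpow h₁ h1 (by norm_num : (0 : ℝ) ≤ 1 / 8)
  rw [Real.mul_rpow (by norm_num) hz] at a
  rw [Real.mul_rpow (by positivity) hz, inv_four_pow_rpow] at b
  have c := mul_le_mul_of_nonneg_right five_rpow_le (Real.rpow_nonneg hz (1 / 8))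
  linarith

/-- If one step multiplies `Z` by at most `5`, and the other one by at most `4⁻⁸` as long as
`Z ≤ ζ`, then a small `Z` stays small with high probability, and decays exponentially. -/
lemma pathAvg_tail {Z : α → ℝ} (hZ : ∀ D, 0 ≤ Z D) {ζ : ℝ} (hζ : 0 < ζ)
    (hm : ∀ D, Z (st false D) ≤ 5 * Z D) (hp : ∀ D, Z D ≤ ζ → Z (st true D) ≤ 4⁻¹ ^ 8 * Z D)
    {t : ℝ} (ht : 0 < t) (n : ℕ) (D : α) :
    pathAvg st n (fun D => if t < Z D then 1 else 0) D ≤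
      (3 / 4) ^ n * (Z D / t) ^ (1 / 8 : ℝ) + (Z D / ζ) ^ (1 / 8 : ℝ) := by
  have one_le : ∀ x : ℝ, 1 ≤ x → (1 : ℝ) ≤ x ^ (1 / 8 : ℝ) :=
    fun x hx => Real.one_le_rpow hx (by norm_num)
  have nn : ∀ (D : α) (s : ℝ), 0 < s → 0 ≤ (Z D / s) ^ (1 / 8 : ℝ) :=
    fun D s hs => Real.rpow_nonneg (div_nonneg (hZ D) hs.le) _
  induction n generalizing D with
  | zero =>
    simp only [pathAvg, pow_zero, one_mul]
    split_ifs with h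
    · have := one_le (Z D / t) ((one_le_div ht).2 h.le)
      linarith [nn D ζ hζ]
    · linarith [nn D ζ hζ, nn D t ht]
  | succ n ih =>
    by_cases h : Z D ≤ ζ
    · have key := rpow_average_le (hZ D) (hZ _) (hZ _) (hm D) (hp D h)
      simp only [Real.div_rpow (hZ _) hζ.le, Real.div_rpow (hZ _) ht.le] at ih ⊢
      set T := t ^ (1 / 8 : ℝ)
      set S := ζ ^ (1 / 8 : ℝ)
      have hT : 0 < T := Real.rpow_pos_of_pos ht _
      have hS : 0 < S := Real.rpow_pos_of_pos hζ _
      have a := ih (st false D)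
      have b := ih (st true D)
      simp only [pathAvg]
      have e : ∀ c : ℝ, 0 ≤ c →
          c * (Z (st false D) ^ (1 / 8 : ℝ)) / 2 + c * (Z (st true D) ^ (1 / 8 : ℝ)) / 2 ≤
            c * (3 / 4 * Z D ^ (1 / 8 : ℝ)) := fun c hc => by
        have := mul_le_mul_of_nonneg_left key hc
        linarith
      have e1 := e ((3 / 4) ^ n * T⁻¹) (by positivity)
      have e2 := e S⁻¹ (by positivity)
      have hz := Real.rpow_nonneg (hZ D) (1 / 8)
      have e3 : S⁻¹ * (3 / 4 * Z D ^ (1 / 8 : ℝ)) ≤ S⁻¹ * Z D ^ (1 / 8 : ℝ) := by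
        apply mul_le_mul_of_nonneg_left _ (by positivity); linarith
      have e4 : (3 / 4 : ℝ) ^ n * T⁻¹ * (3 / 4 * Z D ^ (1 / 8 : ℝ)) =
          (3 / 4) ^ (n + 1) * T⁻¹ * Z D ^ (1 / 8 : ℝ) := by ring
      simp only [div_eq_mul_inv] at a b ⊢
      linarith
    · have h1 : pathAvg st (n + 1) (fun D => if t < Z D then (1 : ℝ) else 0) D ≤ 1 := by
        have := pathAvg_mono (st := st) (f := fun D => if t < Z D then (1 : ℝ) else 0)
          (g := fun _ => 1) (fun D => by split_ifs <;> norm_num) (n + 1) D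
        rwa [pathAvg_const] at this
      have := one_le (Z D / ζ) ((one_le_div hζ).2 (not_le.1 h).le)
      have := nn D t ht
      have : 0 ≤ (3 / 4 : ℝ) ^ (n + 1) * (Z D / t) ^ (1 / 8 : ℝ) := by positivity
      linarith

/-- The proportion of states with `Z ≤ 4⁻ⁿ` after `n₀ + n` steps is asymptotically at least the
proportion of states with `Z ≤ ε` after `n₀` steps, up to the probability of leaving `Z ≤ ζ`. -/
lemma pathAvg_small_ge {Z : α → ℝ} (hZ : ∀ D, 0 ≤ Z D) {ζ : ℝ} (hζ : 0 < ζ)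
    (hm : ∀ D, Z (st false D) ≤ 5 * Z D) (hp : ∀ D, Z D ≤ ζ → Z (st true D) ≤ 4⁻¹ ^ 8 * Z D)
    {ε : ℝ} (hε : 0 ≤ ε) (n₀ n : ℕ) (D : α) :
    pathAvg st n₀ (fun D => if Z D ≤ ε then 1 else 0) D
        - (ε / ζ) ^ (1 / 8 : ℝ) - (9 / 10) ^ n * ε ^ (1 / 8 : ℝ) ≤
      pathAvg st (n₀ + n) (fun D => if Z D ≤ 4⁻¹ ^ n then 1 else 0) D := by
  rw [pathAvg_comp_add]
  set c := (ε / ζ) ^ (1 / 8 : ℝ) + (9 / 10) ^ n * ε ^ (1 / 8 : ℝ) with hc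
  have hc0 : 0 ≤ c := by positivity
  have key : ∀ D, (if Z D ≤ ε then (1 : ℝ) else 0) - c ≤
      pathAvg st n (fun D => if Z D ≤ 4⁻¹ ^ n then 1 else 0) D := by
    intro D
    split_ifs with h
    · have ht : (0 : ℝ) < 4⁻¹ ^ n := by positivity
      have h1 := pathAvg_tail hZ hζ hm hp ht n D
      have h2 : pathAvg st n (fun D => if Z D ≤ 4⁻¹ ^ n then (1 : ℝ) else 0) D =
          1 - pathAvg st n (fun D => if 4⁻¹ ^ n < Z D then (1 : ℝ) else 0) D := by
        have h0 := pathAvg_sub (st := st) (fun _ => 1)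
          (fun D => if 4⁻¹ ^ n < Z D then (1 : ℝ) else 0) n D
        rw [pathAvg_const] at h0
        rw [← h0]
        congr 1
        ext D
        by_cases hh : Z D ≤ 4⁻¹ ^ n
        · rw [if_pos hh, if_neg (not_lt.2 hh), sub_zero]
        · rw [if_neg hh, if_pos (not_le.1 hh), sub_self]
      rw [h2]
      have h3 : (Z D / ζ) ^ (1 / 8 : ℝ) ≤ (ε / ζ) ^ (1 / 8 : ℝ) :=
        Real.rpow_le_rpow (div_nonneg (hZ D) hζ.le) (by gcongr) (by norm_num)
      have h4 : (3 / 4 : ℝ) ^ n * (Z D / 4⁻¹ ^ n) ^ (1 / 8 : ℝ) ≤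
          (9 / 10) ^ n * ε ^ (1 / 8 : ℝ) := by
        have e1 : Z D / 4⁻¹ ^ n = 4 ^ n * Z D := by
          rw [inv_pow, div_inv_eq_mul, mul_comm]
        have e2 : ((4 : ℝ) ^ n) ^ (1 / 8 : ℝ) = ((4 : ℝ) ^ (1 / 8 : ℝ)) ^ n := by
          rw [← Real.rpow_natCast, ← Real.rpow_natCast, ← Real.rpow_mul (by norm_num),
            ← Real.rpow_mul (by norm_num), mul_comm]
        rw [e1, Real.mul_rpow (by positivity) (hZ D), e2, ← mul_assoc, ← mul_pow]
        have := four_rpow_le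
        have := Real.rpow_le_rpow (hZ D) h (by norm_num : (0 : ℝ) ≤ 1 / 8)
        have := Real.rpow_nonneg (hZ D) (1 / 8)
        gcongr
        linarith
      linarith
    · have := pathAvg_nonneg (st := st) (f := fun D => if Z D ≤ 4⁻¹ ^ n then (1 : ℝ) else 0)
        (fun D => by split_ifs <;> norm_num) n D
      linarith
  have := pathAvg_mono (st := st) key n₀ D
  rw [pathAvg_sub, pathAvg_const] at this
  linarith

end PathAvg

/-! ### Messages and their laws -/

/-- The messages exchanged by the decoder: the values of the quantizer. -/
abbrev Msg (Q : Quantizer) : Type := ↥(Set.range Q.toFun)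

instance (Q : Quantizer) : Fintype (Msg Q) := Q.finite_range.fintype

instance (Q : Quantizer) : InvolutiveNeg (Msg Q) where
  neg x := ⟨-x.1, by obtain ⟨y, hy⟩ := x.2; exact ⟨-y, by rw [Q.odd, hy]⟩⟩
  neg_neg x := Subtype.ext (neg_neg x.1)

/-- The node operations on messages: check nodes (`false`) and variable nodes (`true`). -/
def Msg.op {Q : Quantizer} (b : Bool) (x y : Msg Q) : Msg Q :=
  if b then ⟨varOp Q x.1 y.1, Set.mem_range_self _⟩ else ⟨checkOp Q x.1 y.1, Set.mem_range_self _⟩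

/-- A probability vector on a finite type. -/
structure FinLaw (ι : Type*) [Fintype ι] where
  w : ι → ℝ
  nonneg : ∀ x, 0 ≤ w x
  sum_one : ∑ x, w x = 1

section FinLaw

variable {ι : Type*} [Fintype ι]

/-- Average of a function of fair coins and of independent messages of law `a`. -/
def blockAvg (a : FinLaw ι) (n : ℕ) (F : (Fin (2 ^ n) → ZMod 2) → (Fin (2 ^ n) → ι) → ℝ) : ℝ :=
  (∑ coin, ∑ m, (∏ k, a.w (m k)) * F coin m) / 2 ^ (2 ^ n)

lemma blockAvg_mono (a : FinLaw ι) (n : ℕ)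
    {F G : (Fin (2 ^ n) → ZMod 2) → (Fin (2 ^ n) → ι) → ℝ} (h : ∀ c m, F c m ≤ G c m) :
    blockAvg a n F ≤ blockAvg a n G := by
  unfold blockAvg
  gcongr with c _ m _
  · exact Finset.prod_nonneg fun k _ => a.nonneg _
  · exact h c m

lemma blockAvg_add (a : FinLaw ι) (n : ℕ)
    (F G : (Fin (2 ^ n) → ZMod 2) → (Fin (2 ^ n) → ι) → ℝ) :
    blockAvg a n (fun c m => F c m + G c m) = blockAvg a n F + blockAvg a n G := by
  simp only [blockAvg, mul_add, Finset.sum_add_distrib, add_div]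

variable [DecidableEq ι]

/-- The law of `o x y` for independent `x` and `y` of law `a`. -/
def FinLaw.comb (o : ι → ι → ι) (a : FinLaw ι) : FinLaw ι where
  w x := ∑ y, ∑ z, if o y z = x then a.w y * a.w z else 0
  nonneg x := Finset.sum_nonneg fun y _ => Finset.sum_nonneg fun z _ => by
    split_ifs
    · exact mul_nonneg (a.nonneg y) (a.nonneg z)
    · exact le_rfl
  sum_one := by
    rw [Finset.sum_comm]
    have h : ∀ y, ∑ x, ∑ z, (if o y z = x then a.w y * a.w z else 0) = a.w y := by
      intro y
      rw [Finset.sum_comm]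
      simp [← Finset.mul_sum, a.sum_one]
    simp only [h, a.sum_one]

lemma FinLaw.sum_comb (o : ι → ι → ι) (a : FinLaw ι) (f : ι → ℝ) :
    ∑ x, (a.comb o).w x * f x = ∑ y, ∑ z, a.w y * a.w z * f (o y z) := by
  simp only [FinLaw.comb, Finset.sum_mul]
  rw [Finset.sum_comm]
  refine Finset.sum_congr rfl fun y _ => ?_
  rw [Finset.sum_comm]
  refine Finset.sum_congr rfl fun z _ => ?_
  simp

/-- A word of length `2 ^ (n + 1)` as the pair of its halves. -/
def splitEquiv (X : Type*) (n : ℕ) :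
    (Fin (2 ^ (n + 1)) → X) ≃ (Fin (2 ^ n) → X) × (Fin (2 ^ n) → X) :=
  ((halves n).arrowCongr (Equiv.refl X)).symm.trans
    ((Equiv.curry (Fin 2) (Fin (2 ^ n)) X).trans (finTwoArrowEquiv _))

lemma splitEquiv_apply {X : Type*} {n : ℕ} (f : Fin (2 ^ (n + 1)) → X) :
    splitEquiv X n f = (fun k => f (halves n (0, k)), fun k => f (halves n (1, k))) := rfl

lemma sum_split {X : Type*} [Fintype X] [DecidableEq X] (n : ℕ)
    (f : (Fin (2 ^ n) → X) → (Fin (2 ^ n) → X) → ℝ) :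
    ∑ m : Fin (2 ^ (n + 1)) → X, f (fun k => m (halves n (0, k))) (fun k => m (halves n (1, k))) =
      ∑ m₀, ∑ m₁, f m₀ m₁ := by
  rw [← Fintype.sum_prod_type', ← Equiv.sum_comp (splitEquiv X n)]
  simp only [splitEquiv_apply]

lemma prod_halves {M : Type*} [CommMonoid M] (n : ℕ) (g : Fin (2 ^ (n + 1)) → M) :
    ∏ i, g i = (∏ k, g (halves n (0, k))) * ∏ k, g (halves n (1, k)) := by
  rw [← Equiv.prod_comp (halves n), Fintype.prod_prod_type, Fin.prod_univ_two]

lemma sum_halves {M : Type*} [AddCommMonoid M] (n : ℕ) (g : Fin (2 ^ (n + 1)) → M) :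
    ∑ i, g i = (∑ k, g (halves n (0, k))) + ∑ k, g (halves n (1, k)) := by
  rw [← Equiv.sum_comp (halves n), Fintype.sum_prod_type, Fin.sum_univ_two]

lemma sum_prod_comb (o : ι → ι → ι) (a : FinLaw ι) (n : ℕ) (F : (Fin n → ι) → ℝ) :
    ∑ m₀ : Fin n → ι, ∑ m₁ : Fin n → ι,
        (∏ k, a.w (m₀ k)) * (∏ k, a.w (m₁ k)) * F (fun k => o (m₀ k) (m₁ k)) =
      ∑ m, (∏ k, (a.comb o).w (m k)) * F m := by
  have h1 : ∀ m : Fin n → ι, ∏ k, (a.comb o).w (m k) =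
      ∑ p : Fin n → ι × ι, if (fun k => o (p k).1 (p k).2) = m then
        ∏ k, (a.w (p k).1 * a.w (p k).2) else 0 := by
    intro m
    simp only [FinLaw.comb, ← Fintype.sum_prod_type']
    rw [Finset.prod_univ_sum, Fintype.piFinset_univ]
    refine Finset.sum_congr rfl fun p _ => ?_
    split_ifs with h
    · refine Finset.prod_congr rfl fun k _ => if_pos (congrFun h k)
    · obtain ⟨k, hk⟩ := Function.ne_iff.1 h
      exact Finset.prod_eq_zero (Finset.mem_univ k) (if_neg hk)
  simp only [h1, Finset.sum_mul]
  conv_rhs => rw [Finset.sum_comm]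
  simp only [ite_mul, zero_mul, Finset.sum_ite_eq, Finset.mem_univ, if_true]
  rw [← Fintype.sum_prod_type', ← Equiv.sum_comp (Equiv.arrowProdEquivProdArrow (Fin n) _ _)]
  simp [Equiv.arrowProdEquivProdArrow, Finset.prod_mul_distrib]

/-- Combining the two halves of independent messages of law `a` gives independent messages of law
`a.comb o`. -/
lemma blockAvg_half (o : ι → ι → ι) (a : FinLaw ι) (n : ℕ) (b : Fin 2)
    (F : (Fin (2 ^ n) → ZMod 2) → (Fin (2 ^ n) → ι) → ℝ) :
    blockAvg a (n + 1) (fun coin m => F (fun k => coin (halves n (b, k)))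
        (fun k => o (m (halves n (0, k))) (m (halves n (1, k))))) =
      blockAvg (a.comb o) n F := by
  unfold blockAvg
  have h1 : ∀ c : Fin (2 ^ n) → ZMod 2,
      ∑ m : Fin (2 ^ (n + 1)) → ι, (∏ k, a.w (m k)) *
          F c (fun k => o (m (halves n (0, k))) (m (halves n (1, k)))) =
        ∑ m, (∏ k, (a.comb o).w (m k)) * F c m := by
    intro c
    rw [← sum_prod_comb, ← sum_split n (fun m₀ m₁ =>
      (∏ k, a.w (m₀ k)) * (∏ k, a.w (m₁ k)) * F c (fun k => o (m₀ k) (m₁ k)))]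
    simp only [prod_halves]
  simp only [h1]
  have hcard : (Finset.univ : Finset (Fin (2 ^ n) → ZMod 2)).card = 2 ^ 2 ^ n := by
    simp [ZMod.card]
  set g : (Fin (2 ^ n) → ZMod 2) → ℝ := fun c => ∑ m, (∏ k, (a.comb o).w (m k)) * F c m
  have h2 : ∑ coin : Fin (2 ^ (n + 1)) → ZMod 2, g (fun k => coin (halves n (b, k))) =
      2 ^ 2 ^ n * ∑ c, g c := by
    fin_cases b
    · have := sum_split n (fun m₀ (_ : Fin (2 ^ n) → ZMod 2) => g m₀)
      simp only [Finset.sum_const, hcard, nsmul_eq_mul] at this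
      rw [Finset.mul_sum]
      simpa using this
    · have := sum_split n (fun (_ : Fin (2 ^ n) → ZMod 2) m₁ => g m₁)
      simp only [Finset.sum_const, hcard, nsmul_eq_mul] at this
      simpa using this
  change (∑ coin : Fin (2 ^ (n + 1)) → ZMod 2, g (fun k => coin (halves n (b, k)))) / _ = _
  rw [h2, pow_succ 2 n, pow_mul, sq, mul_div_mul_left _ _ (by positivity)]

end FinLaw

/-! ### Density evolution for the genie-aided decoder -/

/-- One step of density evolution: through a check node (`false`) or a variable node (`true`). -/
def lawStep (Q : Quantizer) (b : Bool) (a : FinLaw (Msg Q)) : FinLaw (Msg Q) := a.comb (Msg.op b)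

/-- Law of the final message about the bit `i` if all bits vanish and the previous ones are known:
its binary digits, most significant first, choose the steps. -/
def bitLaw {Q : Quantizer} : (n : ℕ) → FinLaw (Msg Q) → Fin (2 ^ n) → FinLaw (Msg Q)
  | 0, a, _ => a
  | n + 1, a, i => bitLaw n (lawStep Q (((halves n).symm i).1 = 1) a) ((halves n).symm i).2

/-- Probability that a message of law `a` leads to the decision `1`. -/
def bitErr {Q : Quantizer} (a : FinLaw (Msg Q)) : ℝ :=
  ∑ x, a.w x * (if x.1 < 0 then 1 else if x.1 = 0 then 1 / 2 else 0)

/-- The block error probability when the zero word is sent and the messages of the channel are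
independent of law `a`. -/
def zeroErr (Q : Quantizer) (n : ℕ) (info : Finset (Fin (2 ^ n))) (a : FinLaw (Msg Q)) : ℝ :=
  blockAvg a n fun coin m => if decode Q n info coin (fun k => (m k).1) ≠ 0 then 1 else 0

section Evolution

variable {Q : Quantizer}

lemma sum_bitLaw (f : FinLaw (Msg Q) → ℝ) (n : ℕ) (a : FinLaw (Msg Q)) :
    ∑ i, f (bitLaw n a i) = 2 ^ n * pathAvg (lawStep Q) n f a := by
  induction n generalizing a with
  | zero => simp [bitLaw, pathAvg]
  | succ n ih =>
    rw [sum_halves]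
    simp only [bitLaw, Equiv.symm_apply_apply, ih, pathAvg]
    simp only [zero_ne_one, decide_false, decide_true]
    ring

lemma halves_symm_ext {n : ℕ} {X : Type*} [Zero X] {f g : Fin (2 ^ n) → X} :
    (fun i => if ((halves n).symm i).1 = 0 then f ((halves n).symm i).2
        else g ((halves n).symm i).2) = 0 ↔ f = 0 ∧ g = 0 := by
  constructor
  · intro h
    constructor
    · ext k
      simpa using congrFun h (halves n (0, k))
    · ext k
      simpa using congrFun h (halves n (1, k))
  · rintro ⟨rfl, rfl⟩
    ext i
    simp

lemma encode_zero_word (n : ℕ) : encode n 0 = 0 := by simp [encode]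

/-- If the zero word is sent, the decoder fails if and only if its first half fails, or its second
half fails when it is given the correct first half. -/
lemma decode_succ_ne_zero_iff (n : ℕ) (info : Finset (Fin (2 ^ (n + 1))))
    (coin : Fin (2 ^ (n + 1)) → ZMod 2) (m : Fin (2 ^ (n + 1)) → Msg Q) :
    decode Q (n + 1) info coin (fun k => (m k).1) ≠ 0 ↔
      decode Q n {k | halves n (0, k) ∈ info} (fun k => coin (halves n (0, k)))
        (fun k => (Msg.op false (m (halves n (0, k))) (m (halves n (1, k)))).1) ≠ 0 ∨
      decode Q n {k | halves n (1, k) ∈ info} (fun k => coin (halves n (1, k)))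
        (fun k => (Msg.op true (m (halves n (0, k))) (m (halves n (1, k)))).1) ≠ 0 := by
  rw [decode, Ne, halves_symm_ext, not_and_or]
  by_cases h : decode Q n {k | halves n (0, k) ∈ info} (fun k => coin (halves n (0, k)))
        (fun k => checkOp Q (m (halves n (0, k))).1 (m (halves n (1, k))).1) = 0
  · simp [h, Msg.op, encode_zero_word, signFlip]
  · simp [h, Msg.op]

lemma zeroErr_base (info : Finset (Fin (2 ^ 0))) (a : FinLaw (Msg Q)) :
    zeroErr Q 0 info a = if (0 : Fin 1) ∈ info then bitErr a else 0 := by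
  unfold zeroErr blockAvg
  have h0 := Equiv.sum_comp (Equiv.funUnique (Fin 1) (ZMod 2)).symm
    (fun coin => ∑ m : Fin (2 ^ 0) → Msg Q, (∏ k, a.w (m k)) *
      if decode Q 0 info coin (fun k => (m k).1) ≠ 0 then 1 else 0)
  refine (congrArg (· / (2 : ℝ) ^ 2 ^ 0) h0.symm).trans ?_
  have h1 : ∀ c : ZMod 2, (∑ m : Fin (2 ^ 0) → Msg Q, (∏ k, a.w (m k)) *
      if decode Q 0 info ((Equiv.funUnique (Fin 1) (ZMod 2)).symm c) (fun k => (m k).1) ≠ 0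
        then (1 : ℝ) else 0) = ∑ x : Msg Q, a.w x *
      if (0 : Fin 1) ∈ info ∧ (x.1 < 0 ∨ (x.1 = 0 ∧ c ≠ 0)) then 1 else 0 := by
    intro c
    refine (Equiv.sum_comp (Equiv.funUnique (Fin 1) (Msg Q)).symm
      (fun m : Fin (2 ^ 0) → Msg Q => (∏ k, a.w (m k)) *
        if decode Q 0 info ((Equiv.funUnique (Fin 1) (ZMod 2)).symm c) (fun k => (m k).1) ≠ 0
          then (1 : ℝ) else 0)).symm.trans ?_
    refine Finset.sum_congr rfl fun x _ => ?_
    congr 1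
    · change ∏ k : Fin 1, _ = _
      simp
    · congr 1
      rw [Ne, funext_iff]
      refine propext ((not_congr (Fin.forall_fin_one (p := fun i : Fin 1 =>
        decode Q 0 info ((Equiv.funUnique (Fin 1) (ZMod 2)).symm c)
          (fun k => ((Equiv.funUnique (Fin 1) (Msg Q)).symm x k).1) i = 0))).trans ?_)
      simp only [decode, Equiv.funUnique_symm_apply, uniqueElim_const]
      by_cases hi : (0 : Fin 1) ∈ info
      · rcases lt_trichotomy x.1 0 with h | h | h
        · simp [hi, h, h.not_gt]
        · simp [hi, h]
        · simp [hi, h, h.not_gt, h.ne']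
      · simp [hi]
  simp only [h1]
  have h2 : ∀ f : ZMod 2 → ℝ, ∑ c, f c = f 0 + f 1 := fun f => Fin.sum_univ_two f
  rw [h2, ← Finset.sum_add_distrib]
  split_ifs with hi
  · unfold bitErr
    rw [Finset.sum_div]
    refine Finset.sum_congr rfl fun x _ => ?_
    rcases lt_trichotomy x.1 0 with h | h | h
    · simp [hi, h]
    · simp [hi, h]; ring
    · simp [hi, h.not_gt, h.ne']
  · simp [hi]

lemma zeroErr_succ_le (n : ℕ) (info : Finset (Fin (2 ^ (n + 1)))) (a : FinLaw (Msg Q)) :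
    zeroErr Q (n + 1) info a ≤
      zeroErr Q n {k | halves n (0, k) ∈ info} (lawStep Q false a) +
        zeroErr Q n {k | halves n (1, k) ∈ info} (lawStep Q true a) := by
  unfold zeroErr lawStep
  rw [← blockAvg_half _ a n 0, ← blockAvg_half _ a n 1, ← blockAvg_add]
  refine blockAvg_mono a (n + 1) fun c m => ?_
  simp only [decode_succ_ne_zero_iff]
  split_ifs <;> simp_all

lemma le_zeroErr_succ (n : ℕ) (info : Finset (Fin (2 ^ (n + 1)))) (a : FinLaw (Msg Q))
    (b : Fin 2) :
    zeroErr Q n {k | halves n (b, k) ∈ info} (lawStep Q (b = 1) a) ≤ zeroErr Q (n + 1) info a := by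
  unfold zeroErr lawStep
  rw [← blockAvg_half _ a n b]
  refine blockAvg_mono a (n + 1) fun c m => ?_
  simp only [decode_succ_ne_zero_iff]
  fin_cases b
  · simp only [Fin.zero_eta, zero_ne_one, decide_false]
    split_ifs <;> simp_all
  · simp only [Fin.mk_one, decide_true]
    split_ifs <;> simp_all

lemma zeroErr_le_sum (n : ℕ) (info : Finset (Fin (2 ^ n))) (a : FinLaw (Msg Q)) :
    zeroErr Q n info a ≤ ∑ i ∈ info, bitErr (bitLaw n a i) := by
  induction n generalizing a with
  | zero =>
    have h : ∑ i ∈ info, bitErr (bitLaw 0 a i) = ∑ i : Fin 1, if i ∈ info then bitErr a else 0 := by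
      rw [← Finset.sum_filter]
      refine Finset.sum_congr ?_ fun i _ => rfl
      exact (Finset.filter_univ_mem info).symm
    rw [zeroErr_base, h, Fin.sum_univ_one]
  | succ n ih =>
    refine (zeroErr_succ_le n info a).trans ?_
    have h := sum_halves n (fun i => if i ∈ info then bitErr (bitLaw (n + 1) a i) else 0)
    have h' : ∑ i ∈ info, bitErr (bitLaw (n + 1) a i) =
      ∑ i, if i ∈ info then bitErr (bitLaw (n + 1) a i) else 0 := by simp
    rw [h', h]
    refine (add_le_add (ih _ _) (ih _ _)).trans (le_of_eq ?_)
    simp [Finset.sum_filter, bitLaw]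

lemma bitErr_le_zeroErr (n : ℕ) (info : Finset (Fin (2 ^ n))) (a : FinLaw (Msg Q))
    {i : Fin (2 ^ n)} (hi : i ∈ info) : bitErr (bitLaw n a i) ≤ zeroErr Q n info a := by
  induction n generalizing a with
  | zero =>
    rw [zeroErr_base, if_pos]
    · rfl
    · rwa [← Subsingleton.elim (α := Fin 1) i 0]
  | succ n ih =>
    refine le_trans ?_ (le_zeroErr_succ n info a ((halves n).symm i).1)
    rw [bitLaw]
    apply ih
    simpa using hi

end Evolution

/-! ### Reduction to the zero word -/

lemma encode_succ (n : ℕ) (u : Fin (2 ^ (n + 1)) → ZMod 2) (b : Fin 2) (k : Fin (2 ^ n)) :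
    encode (n + 1) u (halves n (b, k)) =
      (if b = 0 then encode n (fun j => u (halves n (0, j))) k else 0) +
        encode n (fun j => u (halves n (1, j))) k := by
  simp only [encode, polarMatrix, Matrix.vecMul, dotProduct]
  rw [sum_halves]
  fin_cases b <;> simp

lemma encode_add (n : ℕ) (u v : Fin (2 ^ n) → ZMod 2) :
    encode n (u + v) = encode n u + encode n v := Matrix.add_vecMul _ _ _

lemma zmod_two_cases (x : ZMod 2) : x = 0 ∨ x = 1 := by revert x; decide

lemma signFlip_signFlip (x y : ZMod 2) (a : EReal) :
    signFlip x (signFlip y a) = signFlip (x + y) a := by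
  rcases zmod_two_cases x with rfl | rfl <;> rcases zmod_two_cases y with rfl | rfl <;>
    simp [signFlip, CharTwo.add_self_eq_zero]

lemma llrAdd_neg (a b : EReal) : llrAdd (-a) (-b) = -llrAdd a b := by
  induction a <;> induction b <;>
    simp [llrAdd, ← EReal.coe_neg, ← EReal.coe_add,
      add_comm]

lemma tanhHalf_neg (a : EReal) : tanhHalf (-a) = -tanhHalf a := by
  induction a <;> simp [tanhHalf, ← EReal.coe_neg, neg_div, Real.tanh_neg]

lemma twoArtanh_neg (t : ℝ) : twoArtanh (-t) = -twoArtanh t := by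
  unfold twoArtanh
  by_cases h1 : 1 ≤ t
  · rw [if_neg (by linarith), if_pos (by linarith), if_pos h1]; rfl
  · by_cases h2 : t ≤ -1
    · rw [if_pos (by linarith), if_neg h1, if_pos h2]; rfl
    · have h : Real.artanh (-t) = -Real.artanh t := by
        rw [Real.artanh_eq_half_log ⟨by linarith, by linarith⟩,
          Real.artanh_eq_half_log ⟨by linarith, by linarith⟩, ← mul_neg, ← Real.log_inv, inv_div]
        ring_nf
      rw [if_neg (by linarith), if_neg (by linarith), if_neg h1, if_neg h2, ← EReal.coe_neg, h]
      ring_nf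

lemma varOp_signFlip (Q : Quantizer) (x : ZMod 2) (a b : EReal) :
    varOp Q (signFlip x a) (signFlip x b) = signFlip x (varOp Q a b) := by
  unfold signFlip varOp
  split_ifs
  · rfl
  · rw [llrAdd_neg, Q.odd]

lemma checkOp_signFlip (Q : Quantizer) (x y : ZMod 2) (a b : EReal) :
    checkOp Q (signFlip x a) (signFlip y b) = signFlip (x + y) (checkOp Q a b) := by
  rcases zmod_two_cases x with rfl | rfl <;> rcases zmod_two_cases y with rfl | rfl <;>
    simp [signFlip, checkOp, tanhHalf_neg, twoArtanh_neg, Q.odd, CharTwo.add_self_eq_zero]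

/-- The decoder commutes with the translation by a codeword. -/
lemma decode_signFlip (Q : Quantizer) (n : ℕ) (info : Finset (Fin (2 ^ n)))
    (coin u : Fin (2 ^ n) → ZMod 2) (hu : ∀ i, i ∉ info → u i = 0) (m : Fin (2 ^ n) → EReal) :
    decode Q n info coin (fun k => signFlip (encode n u k) (m k)) =
      decode Q n info (coin + u) m + u := by
  have two : ∀ a : ZMod 2, a + a = 0 := CharTwo.add_self_eq_zero
  induction n with
  | zero =>
    ext i
    have he : encode 0 u = u := by simp [encode, polarMatrix]
    rw [he]
    simp only [decode, Pi.add_apply]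
    by_cases hi : i ∈ info
    · rw [if_pos hi, if_pos hi]
      have key : ∀ (c v : ZMod 2) (a : EReal), (if 0 < signFlip v a then (0 : ZMod 2) else
          if signFlip v a < 0 then 1 else c) =
          (if 0 < a then 0 else if a < 0 then 1 else c + v) + v := by
        intro c v a
        rcases zmod_two_cases v with rfl | rfl
        · simp [signFlip]
        · rcases lt_trichotomy a 0 with h | h | h
          · have : 0 < -a := EReal.neg_lt_neg_iff.1 (by simpa using h)
            simp [signFlip, h, h.not_gt, this, two]
          · simp [signFlip, h, add_assoc, two]
          · have : -a < 0 := EReal.neg_lt_neg_iff.1 (by simpa using h)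
            simp [signFlip, h, this, this.not_gt]
      exact key _ _ _
    · simp [hi, hu i hi]
  | succ n ih =>
    set u₀ : Fin (2 ^ n) → ZMod 2 := fun k => u (halves n (0, k)) with hu₀
    set u₁ : Fin (2 ^ n) → ZMod 2 := fun k => u (halves n (1, k)) with hu₁
    have h0 := fun m => ih {k | halves n (0, k) ∈ info} (fun k => coin (halves n (0, k))) u₀
      (fun i hi => hu _ (by simpa using hi)) m
    have h1 := fun m => ih {k | halves n (1, k) ∈ info} (fun k => coin (halves n (1, k))) u₁
      (fun i hi => hu _ (by simpa using hi)) m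
    have e0 : ∀ k, encode (n + 1) u (halves n (0, k)) = encode n u₀ k + encode n u₁ k := by
      intro k; rw [encode_succ]; simp [hu₀, hu₁]
    have e1 : ∀ k, encode (n + 1) u (halves n (1, k)) = encode n u₁ k := by
      intro k; rw [encode_succ]; simp [hu₁]
    have f0 : ∀ k, checkOp Q
        (signFlip (encode (n + 1) u (halves n (0, k))) (m (halves n (0, k))))
        (signFlip (encode (n + 1) u (halves n (1, k))) (m (halves n (1, k)))) =
        signFlip (encode n u₀ k) (checkOp Q (m (halves n (0, k))) (m (halves n (1, k)))) := by
      intro k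
      rw [checkOp_signFlip, e0, e1, add_assoc, two, add_zero]
    set d₀ := decode Q n {k | halves n (0, k) ∈ info}
      ((fun k => coin (halves n (0, k))) + u₀)
      (fun k => checkOp Q (m (halves n (0, k))) (m (halves n (1, k)))) with hd₀
    have f1 : ∀ k, varOp Q
        (signFlip (encode n (d₀ + u₀) k)
          (signFlip (encode (n + 1) u (halves n (0, k))) (m (halves n (0, k)))))
        (signFlip (encode (n + 1) u (halves n (1, k))) (m (halves n (1, k)))) =
        signFlip (encode n u₁ k) (varOp Q (signFlip (encode n d₀ k) (m (halves n (0, k))))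
          (m (halves n (1, k)))) := by
      intro k
      rw [signFlip_signFlip, e0, e1, ← varOp_signFlip, signFlip_signFlip, encode_add, Pi.add_apply]
      congr 2
      rw [show encode n d₀ k + encode n u₀ k + (encode n u₀ k + encode n u₁ k) =
        encode n u₁ k + encode n d₀ k + (encode n u₀ k + encode n u₀ k) by ring, two, add_zero]
    ext i
    obtain ⟨⟨b, k⟩, rfl⟩ := (halves n).surjective i
    simp only [decode, f0, h0, Equiv.symm_apply_apply, Pi.add_apply]
    fin_cases b
    · simp [hu₀, Pi.add_def]
    · simp only [Fin.mk_one, one_ne_zero, if_false]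
      have := fun k => f1 k
      rw [hd₀] at this
      simp only [this, h1]
      rfl

/-! ### The law of the quantized channel output -/

variable {Y : Type*} [MeasurableSpace Y]

instance (W : BMSChannel Y) (x : ZMod 2) : IsProbabilityMeasure (W.law x) := W.isProb x

lemma BMSChannel.measurable_llr (W : BMSChannel Y) : Measurable W.llr :=
  ENNReal.measurable_log.comp ((Measure.measurable_rnDeriv _ _).div (Measure.measurable_rnDeriv _ _))

lemma BMSChannel.density_sum (W : BMSChannel Y) :
    ∀ᵐ y ∂(W.law 0 + W.law 1), (W.law 0).rnDeriv (W.law 0 + W.law 1) y +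
      (W.law 1).rnDeriv (W.law 0 + W.law 1) y = 1 := by
  filter_upwards [Measure.rnDeriv_add (W.law 0) (W.law 1) (W.law 0 + W.law 1),
    Measure.rnDeriv_self (W.law 0 + W.law 1)] with y h1 h2
  rw [← h2, h1]; rfl

/-- The symmetry of the channel reverses the sign of the log-likelihood ratio. -/
lemma BMSChannel.exists_symm (W : BMSChannel Y) : ∃ π : Y → Y, Measurable π ∧
    (W.law 0).map π = W.law 1 ∧ ∀ᵐ y ∂(W.law 0 + W.law 1), W.llr (π y) = -W.llr y := by
  obtain ⟨π, hm, hi, h01⟩ := W.symm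
  refine ⟨π, hm, h01, ?_⟩
  have h10 : (W.law 1).map π = W.law 0 := by
    rw [← h01, Measure.map_map hm hm, hi.comp_self, Measure.map_id]
  let e : Y ≃ᵐ Y := ⟨hi.toPerm, hm, hm⟩
  have hs : (W.law 0 + W.law 1).map π = W.law 0 + W.law 1 := by
    rw [Measure.map_add _ _ hm, h01, h10, add_comm]
  have r0 := e.measurableEmbedding.rnDeriv_map (W.law 0) (W.law 0 + W.law 1)
  have r1 := e.measurableEmbedding.rnDeriv_map (W.law 1) (W.law 0 + W.law 1)
  change (fun x => ((W.law 0).map π).rnDeriv ((W.law 0 + W.law 1).map π) (π x)) =ᵐ[_] _ at r0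
  change (fun x => ((W.law 1).map π).rnDeriv ((W.law 0 + W.law 1).map π) (π x)) =ᵐ[_] _ at r1
  rw [h01, hs] at r0
  rw [h10, hs] at r1
  filter_upwards [r0, r1, W.density_sum] with y a b c
  unfold llr
  rw [a, b, ← ENNReal.log_inv, ENNReal.inv_div]
  · left
    intro h
    simp [h] at c
  · by_contra! h
    simp [h] at c

/-- The law of the quantized log-likelihood ratio of the channel output, under input `0`. -/
def BMSChannel.msgLaw (W : BMSChannel Y) (Q : Quantizer) : FinLaw (Msg Q) where
  w x := (W.law 0).real {y | Q (W.llr y) = x.1}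
  nonneg _ := measureReal_nonneg
  sum_one := by
    have hm : Measurable fun y => Q (W.llr y) := Q.measurable.comp W.measurable_llr
    have h := sum_measureReal_preimage_singleton (μ := W.law 0)
      (f := fun y => (⟨Q (W.llr y), Set.mem_range_self _⟩ : Msg Q)) Finset.univ
      (fun x _ => by
        have : (fun y => (⟨Q (W.llr y), Set.mem_range_self _⟩ : Msg Q)) ⁻¹' {x} =
          (fun y => Q (W.llr y)) ⁻¹' {x.1} := by ext y; simp [Subtype.ext_iff]
        rw [this]
        exact hm (measurableSet_singleton _))
    simp only [Finset.coe_univ, Set.preimage_univ, probReal_univ] at h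
    rw [← h]
    refine Finset.sum_congr rfl fun x _ => ?_
    congr 1
    ext y; simp [Subtype.ext_iff]

lemma BMSChannel.measurableSet_msg (W : BMSChannel Y) (Q : Quantizer) (x : EReal) :
    MeasurableSet {y | Q (W.llr y) = x} :=
  (Q.measurable.comp W.measurable_llr) (measurableSet_singleton _)

/-- Under input `1` the messages have the reflected law. -/
lemma BMSChannel.msgLaw_one (W : BMSChannel Y) (Q : Quantizer) (x : Msg Q) :
    (W.law 1).real {y | Q (W.llr y) = x.1} = (W.msgLaw Q).w (-x) := by
  obtain ⟨π, hm, h01, h⟩ := W.exists_symm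
  have h' : ∀ᵐ y ∂(W.law 0), W.llr (π y) = -W.llr y := (ae_add_measure_iff.1 h).1
  rw [← h01, map_measureReal_apply hm (W.measurableSet_msg Q _)]
  refine measureReal_congr ?_
  filter_upwards [h'] with y hy
  refine propext ?_
  change Q (W.llr (π y)) = x.1 ↔ Q (W.llr y) = -x.1
  rw [hy, Q.odd, neg_eq_iff_eq_neg]

lemma pi_real_preimage {ι : Type*} [Fintype ι] [DecidableEq ι] {N : ℕ} (μ : Fin N → Measure Y)
    [∀ k, IsProbabilityMeasure (μ k)] (ψ : Y → ι) (hψ : ∀ x, MeasurableSet (ψ ⁻¹' {x}))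
    (p : (Fin N → ι) → Prop) [DecidablePred p] :
    (Measure.pi μ).real {y | p fun k => ψ (y k)} =
      ∑ m, (∏ k, (μ k).real (ψ ⁻¹' {m k})) * if p m then 1 else 0 := by
  have hpre : ∀ m : Fin N → ι, (fun (y : Fin N → Y) k => ψ (y k)) ⁻¹' {m} =
      Set.pi Set.univ fun k => ψ ⁻¹' {m k} := by
    intro m; ext y; simp [funext_iff]
  have h := sum_measureReal_preimage_singleton (μ := Measure.pi μ)
    (f := fun (y : Fin N → Y) k => ψ (y k)) (Finset.univ.filter p)
    (fun m _ => by rw [hpre]; exact MeasurableSet.univ_pi fun k => hψ _)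
  have hset : {y : Fin N → Y | p fun k => ψ (y k)} =
      (fun (y : Fin N → Y) k => ψ (y k)) ⁻¹' ↑(Finset.univ.filter p) := by
    ext y; simp
  rw [hset, ← h, Finset.sum_filter]
  refine Finset.sum_congr rfl fun m _ => ?_
  split_ifs
  · rw [hpre, Measure.real, Measure.pi_pi, ENNReal.toReal_prod, mul_one]; rfl
  · simp

/-- A message about a bit, converted to a message about that bit plus `x`. -/
def Msg.flip {Q : Quantizer} (x : ZMod 2) (m : Msg Q) : Msg Q := if x = 0 then m else -m

lemma Msg.flip_flip {Q : Quantizer} (x : ZMod 2) (m : Msg Q) : Msg.flip x (Msg.flip x m) = m := by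
  unfold Msg.flip; split_ifs <;> simp

lemma Msg.flip_val {Q : Quantizer} (x : ZMod 2) (m : Msg Q) :
    (Msg.flip x m).1 = signFlip x m.1 := by
  unfold Msg.flip signFlip; split_ifs <;> rfl

/-- All codewords are equally likely to be decoded correctly. -/
lemma blockErr_eq (W : BMSChannel Y) (Q : Quantizer) (n : ℕ) (info : Finset (Fin (2 ^ n))) :
    blockErr W Q n info = zeroErr Q n info (W.msgLaw Q) := by
  set a := W.msgLaw Q
  have hlaw : ∀ (x : ZMod 2) (m : Msg Q),
      (W.law x).real ((fun y => (⟨Q (W.llr y), Set.mem_range_self _⟩ : Msg Q)) ⁻¹' {m}) =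
        a.w (Msg.flip x m) := by
    intro x m
    have hpre : (fun y => (⟨Q (W.llr y), Set.mem_range_self _⟩ : Msg Q)) ⁻¹' {m} =
        {y | Q (W.llr y) = m.1} := by ext y; simp [Subtype.ext_iff]
    rw [hpre]
    rcases zmod_two_cases x with rfl | rfl
    · rfl
    · rw [W.msgLaw_one]; simp [Msg.flip, a]
  have key : ∀ u ∈ codeInputs n info, ∀ coin : Fin (2 ^ n) → ZMod 2,
      (Measure.pi fun k => W.law (encode n u k)).real
        {y | decode Q n info coin (fun k => Q (W.llr (y k))) ≠ u} =
      ∑ m : Fin (2 ^ n) → Msg Q, (∏ k, a.w (m k)) *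
        if decode Q n info (coin + u) (fun k => (m k).1) ≠ 0 then 1 else 0 := by
    intro u hu coin
    have hu' : ∀ i, i ∉ info → u i = 0 := by simpa [codeInputs] using hu
    have h := pi_real_preimage (fun k => W.law (encode n u k))
      (fun y => (⟨Q (W.llr y), Set.mem_range_self _⟩ : Msg Q))
      (fun m => by
        have hpre : (fun y => (⟨Q (W.llr y), Set.mem_range_self _⟩ : Msg Q)) ⁻¹' {m} =
          {y | Q (W.llr y) = m.1} := by ext y; simp [Subtype.ext_iff]
        rw [hpre]
        exact W.measurableSet_msg Q _)
      (fun m => decode Q n info coin (fun k => (m k).1) ≠ u)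
    refine h.trans ?_
    simp only [hlaw]
    let e : (Fin (2 ^ n) → Msg Q) ≃ (Fin (2 ^ n) → Msg Q) :=
      Function.Involutive.toPerm (fun m k => Msg.flip (encode n u k) (m k))
        (fun m => by ext k; simp [Msg.flip_flip])
    rw [← Equiv.sum_comp e]
    refine Finset.sum_congr rfl fun m _ => ?_
    have he : ∀ k, e m k = Msg.flip (encode n u k) (m k) := fun k => rfl
    simp only [he, Msg.flip_flip, Msg.flip_val, decode_signFlip Q n info coin u hu', Ne,
      add_eq_right]
  have hcoin : ∀ u ∈ codeInputs n info, ∑ coin : Fin (2 ^ n) → ZMod 2,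
      (Measure.pi fun k => W.law (encode n u k)).real
        {y | decode Q n info coin (fun k => Q (W.llr (y k))) ≠ u} =
      ∑ coin : Fin (2 ^ n) → ZMod 2, ∑ m : Fin (2 ^ n) → Msg Q, (∏ k, a.w (m k)) *
        if decode Q n info coin (fun k => (m k).1) ≠ 0 then 1 else 0 := by
    intro u hu
    rw [Finset.sum_congr rfl fun coin _ => key u hu coin]
    exact Equiv.sum_comp (Equiv.addRight u) (fun coin => ∑ m : Fin (2 ^ n) → Msg Q, (∏ k, a.w (m k)) *
        if decode Q n info coin (fun k => (m k).1) ≠ 0 then (1 : ℝ) else 0)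
  have hne : ((codeInputs n info).card : ℝ) ≠ 0 := by
    have : (0 : Fin (2 ^ n) → ZMod 2) ∈ codeInputs n info := by simp [codeInputs]
    exact_mod_cast (Finset.card_pos.2 ⟨_, this⟩).ne'
  unfold blockErr zeroErr blockAvg
  rw [Finset.sum_congr rfl hcoin, Finset.sum_const, nsmul_eq_mul, mul_div_mul_left _ _ hne]

/-! ### Achievable rates and density evolution -/

lemma IsAchievable.le_one {W : BMSChannel Y} {Q : Quantizer} {R : ℝ} (h : IsAchievable W Q R) :
    R ≤ 1 := by
  obtain ⟨info, h1, -⟩ := h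
  have h2 := h1 0
  have h3 : (info 0).card ≤ 1 := (Finset.card_le_univ _).trans (by simp)
  have h4 : ((info 0).card : ℝ) ≤ 1 := by exact_mod_cast h3
  linarith

lemma bddAbove_isAchievable (W : BMSChannel Y) (Q : Quantizer) :
    BddAbove {R | IsAchievable W Q R} := ⟨1, fun _ h => h.le_one⟩

lemma zeroErr_nonneg (Q : Quantizer) (n : ℕ) (info : Finset (Fin (2 ^ n))) (a : FinLaw (Msg Q)) :
    0 ≤ zeroErr Q n info a :=
  div_nonneg (Finset.sum_nonneg fun c _ => Finset.sum_nonneg fun m _ =>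
    mul_nonneg (Finset.prod_nonneg fun k _ => a.nonneg _) (by dsimp only; split_ifs <;> norm_num))
    (by positivity)

lemma isAchievable_zero (W : BMSChannel Y) (Q : Quantizer) : IsAchievable W Q 0 := by
  refine ⟨fun _ => ∅, fun n => by simp, ?_⟩
  have : ∀ n, blockErr W Q n ∅ = 0 := fun n => by
    rw [blockErr_eq]
    refine le_antisymm ((zeroErr_le_sum n ∅ _).trans (by simp)) (zeroErr_nonneg _ _ _ _)
  simp [this]

lemma card_filter_bitLaw {Q : Quantizer} (p : FinLaw (Msg Q) → Prop) [DecidablePred p] (n : ℕ)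
    (a : FinLaw (Msg Q)) :
    ((Finset.univ.filter fun i => p (bitLaw n a i)).card : ℝ) =
      2 ^ n * pathAvg (lawStep Q) n (fun a => if p a then 1 else 0) a := by
  rw [← sum_bitLaw, Finset.sum_boole]

/-- Achievability: if `Z` bounds the bit error probability, at most grows by a constant factor in
each step and strongly decreases in a variable-node step when `Z ≤ ζ`, then the bits for which `Z`
is small after finitely many steps can almost all be used for reliable transmission. -/
theorem maxRate_ge (W : BMSChannel Y) (Q : Quantizer) {Z : FinLaw (Msg Q) → ℝ}
    (hZ : ∀ a, 0 ≤ Z a) (hbit : ∀ a, bitErr a ≤ Z a) {ζ : ℝ} (hζ : 0 < ζ)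
    (hm : ∀ a, Z (lawStep Q false a) ≤ 5 * Z a)
    (hp : ∀ a, Z a ≤ ζ → Z (lawStep Q true a) ≤ 4⁻¹ ^ 8 * Z a) {ε : ℝ} (hε : 0 ≤ ε) (n₀ : ℕ) :
    pathAvg (lawStep Q) n₀ (fun a => if Z a ≤ ε then 1 else 0) (W.msgLaw Q)
      - (ε / ζ) ^ (1 / 8 : ℝ) ≤ maxRate W Q := by
  set a := W.msgLaw Q
  set ρ := pathAvg (lawStep Q) n₀ (fun a => if Z a ≤ ε then (1 : ℝ) else 0) a
    - (ε / ζ) ^ (1 / 8 : ℝ)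
  have hρ1 : ρ ≤ 1 := by
    have h := pathAvg_mono (st := lawStep Q) (f := fun a => if Z a ≤ ε then (1 : ℝ) else 0)
      (g := fun _ => 1) (fun D => by split_ifs <;> norm_num) n₀ a
    rw [pathAvg_const] at h
    have : 0 ≤ (ε / ζ) ^ (1 / 8 : ℝ) := by positivity
    simp only [ρ]; linarith
  refine le_of_forall_lt fun R hR => ?_
  obtain ⟨R', hR, hR'⟩ := exists_between hR
  refine hR.trans_le (le_csSup (bddAbove_isAchievable W Q) ?_)
  have hlim : Tendsto (fun n : ℕ => ρ - (9 / 10 : ℝ) ^ n * ε ^ (1 / 8 : ℝ)) atTop (𝓝 ρ) := by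
    have := (tendsto_pow_atTop_nhds_zero_of_lt_one (by norm_num : (0 : ℝ) ≤ 9 / 10)
      (by norm_num)).mul_const (ε ^ (1 / 8 : ℝ))
    simpa using this.const_sub ρ
  obtain ⟨n₁, hn₁⟩ := eventually_atTop.1 (hlim.eventually (lt_mem_nhds hR'))
  classical
  -- All bits are used for the finitely many lengths below `n₀ + n₁`.
  refine ⟨fun N => if n₀ + n₁ ≤ N then
    Finset.univ.filter fun i => Z (bitLaw N a i) ≤ 4⁻¹ ^ (N - n₀) else Finset.univ, ?_, ?_⟩
  · intro N
    simp only
    split_ifs with hN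
    · have hcard := card_filter_bitLaw (fun a => Z a ≤ 4⁻¹ ^ (N - n₀)) N a
      rw [hcard, mul_comm]
      have h := pathAvg_small_ge (st := lawStep Q) hZ hζ hm hp hε n₀ (N - n₀) a
      rw [show n₀ + (N - n₀) = N by omega] at h
      have h' := hn₁ (N - n₀) (by omega)
      gcongr
      refine le_trans ?_ h
      simp only [ρ] at h'
      linarith
    · have : (Finset.univ : Finset (Fin (2 ^ N))).card = 2 ^ N := by simp
      rw [this]
      have : R' ≤ 1 := by linarith
      have h2 : (0 : ℝ) < 2 ^ N := by positivity
      push_cast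
      nlinarith
  · have hbound : ∀ N ≥ n₀ + n₁, blockErr W Q N (if n₀ + n₁ ≤ N then
        Finset.univ.filter fun i => Z (bitLaw N a i) ≤ 4⁻¹ ^ (N - n₀) else Finset.univ) ≤
        4 ^ n₀ * (1 / 2) ^ N := by
      intro N hN
      rw [if_pos hN, blockErr_eq]
      refine (zeroErr_le_sum _ _ _).trans ?_
      have h1 : ∀ i ∈ Finset.univ.filter fun i => Z (bitLaw N a i) ≤ 4⁻¹ ^ (N - n₀),
          bitErr (bitLaw N a i) ≤ 4⁻¹ ^ (N - n₀) := fun i hi =>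
        (hbit _).trans (by simpa using hi)
      refine (Finset.sum_le_card_nsmul _ _ _ h1).trans ?_
      rw [nsmul_eq_mul]
      have h2 : ((Finset.univ.filter fun i => Z (bitLaw N a i) ≤ 4⁻¹ ^ (N - n₀)).card : ℝ) ≤
          2 ^ N := by
        exact_mod_cast (Finset.card_le_univ _).trans (by simp)
      refine (mul_le_mul_of_nonneg_right h2 (by positivity)).trans (le_of_eq ?_)
      obtain ⟨j, rfl⟩ := Nat.exists_eq_add_of_le (show n₀ ≤ N by omega)
      rw [Nat.add_sub_cancel_left, one_div, inv_pow, inv_pow, pow_add,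
        show (4 : ℝ) = 2 * 2 by norm_num, mul_pow, mul_pow]
      field_simp
    refine squeeze_zero' (Eventually.of_forall fun N => ?_)
      (eventually_atTop.2 ⟨n₀ + n₁, hbound⟩) ?_
    · rw [blockErr_eq]; exact zeroErr_nonneg _ _ _ _
    · simpa using (tendsto_pow_atTop_nhds_zero_of_lt_one (by norm_num : (0 : ℝ) ≤ 1 / 2)
        (by norm_num)).const_mul ((4 : ℝ) ^ n₀)

/-- Converse: a function which is close to `1` whenever the bit error probability is small bounds
the maximal rate by its averages. -/
theorem maxRate_le (W : BMSChannel Y) (Q : Quantizer) {g : FinLaw (Msg Q) → ℝ} (hg : ∀ a, 0 ≤ g a)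
    (hbit : ∀ η > 0, ∃ ε > 0, ∀ a, bitErr a ≤ ε → 1 - η ≤ g a) {B : ℝ}
    (hB : ∃ᶠ n in atTop, pathAvg (lawStep Q) n g (W.msgLaw Q) ≤ B) :
    maxRate W Q ≤ B := by
  refine csSup_le ⟨0, isAchievable_zero W Q⟩ ?_
  rintro R ⟨info, h1, h2⟩
  set a := W.msgLaw Q
  refine le_of_forall_pos_le_add fun η hη => ?_
  obtain ⟨ε, hε, h⟩ := hbit η hη
  obtain ⟨n, hn, hn'⟩ := (hB.and_eventually (h2.eventually (gt_mem_nhds hε))).exists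
  have h3 : ∀ i ∈ info n, 1 - η ≤ g (bitLaw n a i) := fun i hi => by
    refine h _ ((bitErr_le_zeroErr n (info n) a hi).trans ?_)
    rw [← blockErr_eq]; exact hn'.le
  have h4 : ((info n).card : ℝ) * (1 - η) ≤ 2 ^ n * B := by
    calc ((info n).card : ℝ) * (1 - η) ≤ ∑ i ∈ info n, g (bitLaw n a i) := by
          rw [← nsmul_eq_mul]; exact Finset.card_nsmul_le_sum _ _ _ h3
      _ ≤ ∑ i, g (bitLaw n a i) := Finset.sum_le_univ_sum_of_nonneg fun i => hg _
      _ = 2 ^ n * pathAvg (lawStep Q) n g a := sum_bitLaw g n a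
      _ ≤ _ := by gcongr
  have h5 : ((info n).card : ℝ) ≤ 2 ^ n := by
    exact_mod_cast (Finset.card_le_univ _).trans (by simp)
  have h6 : (0 : ℝ) < 2 ^ n := by positivity
  have h7 := h1 n
  have h8 : 2 ^ n * R ≤ 2 ^ n * (B + η) := by nlinarith
  exact le_of_mul_le_mul_left h8 h6

/-! ### The information carried by a pair of opposite messages -/

/-- If a message and its opposite have probabilities `p` and `m` under input `0` (hence `m` and `p`
under input `1`), then this pair contributes `pairInfo p m` nats to the mutual information with a
uniform input bit. This is the capacity of the symmetric channel with crossover probability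
`p / (p + m)` times the mass `p + m`. -/
def pairInfo (p m : ℝ) : ℝ :=
  (p + m) * Real.log 2 - Real.negMulLog p - Real.negMulLog m + Real.negMulLog (p + m)

lemma pairInfo_comm (p m : ℝ) : pairInfo p m = pairInfo m p := by
  unfold pairInfo; rw [add_comm p m]; ring

lemma pairInfo_zero_left (m : ℝ) : pairInfo 0 m = m * Real.log 2 := by simp [pairInfo]

lemma pairInfo_zero_right (p : ℝ) : pairInfo p 0 = p * Real.log 2 := by simp [pairInfo]

lemma pairInfo_self (p : ℝ) : pairInfo p p = 0 := by
  unfold pairInfo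
  rw [← two_mul, Real.negMulLog_mul]
  simp [Real.negMulLog]
  ring

lemma pairInfo_mul (c p m : ℝ) : pairInfo (c * p) (c * m) = c * pairInfo p m := by
  unfold pairInfo
  rw [← mul_add, Real.negMulLog_mul, Real.negMulLog_mul, Real.negMulLog_mul]
  ring

lemma pairInfo_eq {p m : ℝ} (hp : 0 < p) (hm : 0 < m) :
    pairInfo p m = p * Real.log (2 * p / (p + m)) + m * Real.log (2 * m / (p + m)) := by
  have hs : 0 < p + m := by linarith
  rw [Real.log_div (by positivity) hs.ne', Real.log_div (by positivity) hs.ne',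
    Real.log_mul (by norm_num) hp.ne', Real.log_mul (by norm_num) hm.ne']
  simp only [pairInfo, Real.negMulLog]
  ring

/-- Gibbs' inequality: scoring the pair with any other posterior probabilities `α / 2` and `β / 2`
gives less information. -/
lemma le_pairInfo {p m α β : ℝ} (hp : 0 ≤ p) (hm : 0 ≤ m) (hα : 0 < α) (hβ : 0 < β)
    (h : α + β ≤ 2) : p * Real.log α + m * Real.log β ≤ pairInfo p m := by
  rcases hp.eq_or_lt with rfl | hp
  · rw [pairInfo_zero_left, zero_mul, zero_add]
    exact mul_le_mul_of_nonneg_left (Real.log_le_log hβ (by linarith)) hm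
  rcases hm.eq_or_lt with rfl | hm
  · rw [pairInfo_zero_right, zero_mul, add_zero]
    exact mul_le_mul_of_nonneg_left (Real.log_le_log hα (by linarith)) hp.le
  have hs : 0 < p + m := by linarith
  rw [pairInfo_eq hp hm]
  have key : ∀ x γ : ℝ, 0 < x → 0 < γ →
      x * Real.log γ - x * Real.log (2 * x / (p + m)) ≤ γ * (p + m) / 2 - x := by
    intro x γ hx hγ
    rw [← mul_sub, ← Real.log_div hγ.ne' (by positivity)]
    have := Real.log_le_sub_one_of_pos (show 0 < γ / (2 * x / (p + m)) by positivity)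
    calc x * Real.log (γ / (2 * x / (p + m))) ≤ x * (γ / (2 * x / (p + m)) - 1) := by gcongr
      _ = _ := by field_simp
  have h1 := key p α hp hα
  have h2 := key m β hm hβ
  nlinarith

lemma pairInfo_nonneg {p m : ℝ} (hp : 0 ≤ p) (hm : 0 ≤ m) : 0 ≤ pairInfo p m := by
  simpa using le_pairInfo hp hm one_pos one_pos (by norm_num)

lemma pairInfo_le {p m : ℝ} (hp : 0 ≤ p) (hm : 0 ≤ m) : pairInfo p m ≤ (p + m) * Real.log 2 := by
  rcases hp.eq_or_lt with rfl | hp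
  · simp [pairInfo_zero_left]
  rcases hm.eq_or_lt with rfl | hm
  · simp [pairInfo_zero_right]
  have hs : 0 < p + m := by linarith
  rw [pairInfo_eq hp hm, add_mul]
  gcongr
  · rw [div_le_iff₀ hs]; linarith
  · rw [div_le_iff₀ hs]; linarith

/-- Merging two pairs of messages loses information. -/
lemma pairInfo_add_le {p m p' m' : ℝ} (hp : 0 ≤ p) (hm : 0 ≤ m) (hp' : 0 ≤ p') (hm' : 0 ≤ m') :
    pairInfo (p + p') (m + m') ≤ pairInfo p m + pairInfo p' m' := by
  rcases (add_nonneg hp hp').eq_or_lt with h | h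
  · obtain rfl : p = 0 := by linarith
    obtain rfl : p' = 0 := by linarith
    simp only [add_zero, pairInfo_zero_left]; linarith
  rcases (add_nonneg hm hm').eq_or_lt with h' | h'
  · obtain rfl : m = 0 := by linarith
    obtain rfl : m' = 0 := by linarith
    simp only [add_zero, pairInfo_zero_right]; linarith
  have hs : 0 < p + p' + (m + m') := by linarith
  rw [pairInfo_eq h h']
  have hab : 2 * (p + p') / (p + p' + (m + m')) + 2 * (m + m') / (p + p' + (m + m')) ≤ 2 := by
    rw [← add_div, div_le_iff₀ hs]; linarith
  have h1 := le_pairInfo hp hm (by positivity) (by positivity) hab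
  have h2 := le_pairInfo hp' hm' (by positivity) (by positivity) hab
  linarith

lemma pairInfo_sum_le {κ : Type*} (s : Finset κ) {p m : κ → ℝ} (hp : ∀ k, 0 ≤ p k)
    (hm : ∀ k, 0 ≤ m k) : pairInfo (∑ k ∈ s, p k) (∑ k ∈ s, m k) ≤ ∑ k ∈ s, pairInfo (p k) (m k) := by
  classical
  induction s using Finset.induction_on with
  | empty => simp [pairInfo]
  | insert k s hk ih =>
    rw [Finset.sum_insert hk, Finset.sum_insert hk, Finset.sum_insert hk]
    exact (pairInfo_add_le (hp k) (hm k) (Finset.sum_nonneg fun k _ => hp k)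
      (Finset.sum_nonneg fun k _ => hm k)).trans (by linarith)

/-- The chain rule for the polar transform of two pairs of messages: the check node sees the first
pair, the variable node the two others. -/
lemma pairInfo_chain (p m p' m' : ℝ) :
    pairInfo (p * p' + m * m') (m * p' + p * m') + pairInfo (p * p') (m * m') +
      pairInfo (m * p') (p * m') = (p' + m') * pairInfo p m + (p + m) * pairInfo p' m' := by
  have h : Real.negMulLog (p * p' + m * m' + (m * p' + p * m')) =
      (p' + m') * Real.negMulLog (p + m) + (p + m) * Real.negMulLog (p' + m') := by
    rw [← Real.negMulLog_mul]; ring_nf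
  unfold pairInfo
  rw [h]
  simp only [Real.negMulLog_mul]
  ring

/-- A check node degrades the information by the factor `|p' - m'|`, the mean of the soft bit of the
second message. -/
lemma pairInfo_check_le {p m p' m' : ℝ} (hp : 0 ≤ p) (hm : 0 ≤ m) (hp' : 0 ≤ p') (hm' : 0 ≤ m') :
    pairInfo (p * p' + m * m') (m * p' + p * m') ≤ |p' - m'| * pairInfo p m := by
  rcases le_total m' p' with h | h
  · have := pairInfo_add_le (p := (p' - m') * p) (m := (p' - m') * m) (p' := m' * (p + m))
      (m' := m' * (p + m)) (mul_nonneg (by linarith) hp) (mul_nonneg (by linarith) hm)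
      (by positivity) (by positivity)
    rw [pairInfo_self, pairInfo_mul] at this
    rw [abs_of_nonneg (by linarith)]
    convert this using 2 <;> ring
  · have := pairInfo_add_le (p := (m' - p') * m) (m := (m' - p') * p) (p' := p' * (p + m))
      (m' := p' * (p + m)) (mul_nonneg (by linarith) hm) (mul_nonneg (by linarith) hp)
      (by positivity) (by positivity)
    rw [pairInfo_self, pairInfo_mul, pairInfo_comm m p] at this
    rw [abs_of_nonpos (by linarith), neg_sub]
    convert this using 2 <;> ring

lemma abs_pairInfo_sub_le {p m : ℝ} (hp : 0 ≤ p) (hm : 0 ≤ m) (h : p + m ≤ 1) :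
    |pairInfo p m - p * Real.log 2| ≤ 2 * √m := by
  have hl : Real.log 2 ≤ 1 := by linarith [Real.log_two_lt_d9]
  have hl0 : 0 ≤ Real.log 2 := Real.log_nonneg (by norm_num)
  have hm1 : m ≤ √m := by
    have := Real.sq_sqrt hm
    have : √m ≤ 1 := Real.sqrt_le_one.2 (by linarith)
    nlinarith [Real.sqrt_nonneg m]
  rw [abs_le]
  constructor
  · rcases hm.eq_or_lt with rfl | hm
    · simp [pairInfo_zero_right]
    rcases hp.eq_or_lt with rfl | hp
    · rw [pairInfo_zero_left]
      have := Real.sqrt_nonneg m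
      nlinarith [mul_nonneg hm.le hl0]
    have hs : 0 < p + m := by linarith
    have h1 : -m ≤ p * Real.log (p / (p + m)) := by
      have := Real.one_sub_inv_le_log_of_pos (show 0 < p / (p + m) by positivity)
      calc -m = p * (1 - (p / (p + m))⁻¹) := by field_simp; ring
        _ ≤ _ := by gcongr
    have h2 : 2 * m - 2 * √m ≤ m * Real.log (m / (p + m)) := by
      have a : Real.log m ≤ Real.log (m / (p + m)) :=
        Real.log_le_log hm ((le_div_iff₀ hs).2 (by nlinarith))
      have b : 2 * (1 - (√m)⁻¹) ≤ Real.log m := by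
        have := Real.one_sub_inv_le_log_of_pos (Real.sqrt_pos.2 hm)
        rw [Real.log_sqrt hm.le] at this
        linarith
      have hsm := Real.sqrt_pos.2 hm
      calc 2 * m - 2 * √m = m * (2 * (1 - (√m)⁻¹)) := by
            have : m * (√m)⁻¹ = √m := by
              rw [← div_eq_mul_inv, Real.div_sqrt]
            linear_combination 2 * this
        _ ≤ m * Real.log (m / (p + m)) := by gcongr; linarith
    rw [pairInfo_eq hp hm, mul_div_assoc, mul_div_assoc, Real.log_mul (by norm_num) (by positivity),
      Real.log_mul (by norm_num) (by positivity)]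
    nlinarith [mul_nonneg hm.le hl0]
  · have := pairInfo_le hp hm
    nlinarith

/-! ### Density evolution of the three-message decoder -/

/-- A density of total mass one. -/
structure Density.Valid (D : Density) : Prop where
  p_nonneg : 0 ≤ D.p
  e_nonneg : 0 ≤ D.e
  m_nonneg : 0 ≤ D.m
  sum_eq : D.p + D.e + D.m = 1

section Three

variable {D : Density}

lemma Density.I_eq (h : D.Valid) : D.I = pairInfo D.p D.m / Real.log 2 := by
  have hl : Real.log 2 ≠ 0 := (Real.log_pos (by norm_num)).ne'
  obtain ⟨hp, -, hm, -⟩ := h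
  unfold Density.I
  rcases hp.eq_or_lt with hp | hp
  · simp [← hp, pairInfo_zero_left, hl]
  rcases hm.eq_or_lt with hm | hm
  · simp [← hm, pairInfo_zero_right, hl, hp.ne']
  have hs : 0 < D.p + D.m := by linarith
  rw [pairInfo_eq hp hm, Real.binEntropy_eq_negMulLog_add_negMulLog_one_sub,
    show 1 - D.p / (D.p + D.m) = D.m / (D.p + D.m) by field_simp; ring, mul_div_assoc,
    mul_div_assoc, Real.log_mul (by norm_num) (by positivity),
    Real.log_mul (by norm_num) (by positivity)]
  unfold Real.negMulLog
  field_simp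
  ring

lemma Density.Valid.I_nonneg (h : D.Valid) : 0 ≤ D.I := by
  rw [D.I_eq h]
  exact div_nonneg (pairInfo_nonneg h.p_nonneg h.m_nonneg) (Real.log_nonneg (by norm_num))

lemma Density.Valid.plus (h : D.Valid) : D.plus.Valid := by
  obtain ⟨hp, he, hm, hs⟩ := h
  refine ⟨?_, ?_, ?_, ?_⟩ <;> simp only [Density.plus] <;> try positivity
  linear_combination (D.p + D.e + D.m + 1) * hs

lemma Density.Valid.minus (h : D.Valid) : D.minus.Valid := by
  obtain ⟨hp, he, hm, hs⟩ := h
  refine ⟨?_, ?_, ?_, ?_⟩ <;> simp only [Density.minus] <;> try positivity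
  · nlinarith
  · have : 1 - D.e = D.p + D.m := by linarith
    rw [this]; ring

/-- Processing loses information. -/
lemma Density.Valid.I_step_le (h : D.Valid) : (D.minus.I + D.plus.I) / 2 ≤ D.I := by
  rw [D.I_eq h, D.plus.I_eq h.plus, D.minus.I_eq h.minus, ← add_div]
  have hl : 0 < Real.log 2 := Real.log_pos (by norm_num)
  obtain ⟨hp, he, hm, hs⟩ := h
  have h1 := pairInfo_chain D.p D.m D.p D.m
  have h2 := pairInfo_add_le (p := D.p * D.p) (m := D.m * D.m) (p' := 2 * D.e * D.p)
    (m' := 2 * D.e * D.m) (by positivity) (by positivity) (by positivity) (by positivity)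
  rw [pairInfo_mul] at h2
  have h3 : pairInfo (D.m * D.p) (D.p * D.m) = 0 := by rw [mul_comm, pairInfo_self]
  have e1 : pairInfo D.minus.p D.minus.m =
      pairInfo (D.p * D.p + D.m * D.m) (D.m * D.p + D.p * D.m) := by
    simp only [Density.minus]; ring_nf
  have e2 : pairInfo D.plus.p D.plus.m =
      pairInfo (D.p * D.p + 2 * D.e * D.p) (D.m * D.m + 2 * D.e * D.m) := by
    simp only [Density.plus]; ring_nf
  rw [div_div, div_le_div_iff₀ (by positivity) hl, e1, e2]
  have h4 : D.p + D.m = 1 - D.e := by linarith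
  rw [h4] at h1
  nlinarith

/-- The gain of `F` in one step. -/
lemma Density.Valid.F_step_ge (h : D.Valid) :
    2 * D.F + D.m ^ 2 + 4 / 5 * (D.p * D.m) ≤ D.minus.F + D.plus.F := by
  obtain ⟨hp, he, hm, hs⟩ := h
  simp only [Density.F, Density.minus, Density.plus]
  set p := D.p
  set m := D.m
  set e := D.e
  set s := √(p * m) with hs'
  have s0 : 0 ≤ s := Real.sqrt_nonneg _
  have s2 : s ^ 2 = p * m := Real.sq_sqrt (by positivity)
  have sw : 2 * s ≤ p + m := by
    nlinarith [sq_nonneg (p - m)]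
  have h1 : √((p ^ 2 + m ^ 2) * (2 * p * m)) ≤ s * (3 / 2 * (p + m) - 7 / 10 * s) := by
    apply Real.sqrt_le_iff.2
    have hpos : 0 ≤ 3 / 2 * (p + m) - 7 / 10 * s := by linarith
    refine ⟨by positivity, ?_⟩
    have : 2 * (p ^ 2 + m ^ 2) ≤ (3 / 2 * (p + m) - 7 / 10 * s) ^ 2 := by
      have : p ^ 2 + m ^ 2 = (p + m) ^ 2 - 2 * s ^ 2 := by rw [s2]; ring
      rw [this]
      nlinarith [sq_nonneg (p + m - 4.2 * s), sq_nonneg s]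
    calc (p ^ 2 + m ^ 2) * (2 * p * m) = s ^ 2 * (2 * (p ^ 2 + m ^ 2)) := by rw [s2]; ring
      _ ≤ s ^ 2 * (3 / 2 * (p + m) - 7 / 10 * s) ^ 2 := by gcongr
      _ = _ := by ring
  have h2 : √((p ^ 2 + 2 * p * e) * (m ^ 2 + 2 * e * m)) ≤ s * (1 / 2 + 3 / 2 * e) := by
    apply Real.sqrt_le_iff.2
    refine ⟨by positivity, ?_⟩
    have : (p + 2 * e) * (m + 2 * e) ≤ (1 / 2 + 3 / 2 * e) ^ 2 := by
      have : (p + m) ^ 2 = (1 - e) ^ 2 := by rw [← hs]; ring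
      nlinarith [sq_nonneg (p - m)]
    calc (p ^ 2 + 2 * p * e) * (m ^ 2 + 2 * e * m) = s ^ 2 * ((p + 2 * e) * (m + 2 * e)) := by
          rw [s2]; ring
      _ ≤ s ^ 2 * (1 / 2 + 3 / 2 * e) ^ 2 := by gcongr
      _ = _ := by ring
  have h3 : e = 1 - p - m := by linarith
  rw [h3] at h2 ⊢
  nlinarith

lemma Density.F_le_p (D : Density) : D.F ≤ D.p := by
  unfold Density.F
  linarith [Real.sqrt_nonneg (D.p * D.m)]

lemma Density.Valid.p_sub_F_le (h : D.Valid) : D.p - D.F ≤ 4 * √D.m := by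
  obtain ⟨hp, he, hm, hs⟩ := h
  unfold Density.F
  have : √(D.p * D.m) ≤ √D.m := Real.sqrt_le_sqrt (by nlinarith)
  linarith

lemma Density.Valid.abs_I_sub_p_le (h : D.Valid) : |D.I - D.p| ≤ 4 * √D.m := by
  rw [D.I_eq h]
  obtain ⟨hp, he, hm, hs⟩ := h
  have hl : 1 / 2 ≤ Real.log 2 := by linarith [Real.log_two_gt_d9]
  have h1 := abs_pairInfo_sub_le hp hm (by linarith)
  have : pairInfo D.p D.m / Real.log 2 - D.p =
      (pairInfo D.p D.m - D.p * Real.log 2) / Real.log 2 := by field_simp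
  rw [this, abs_div, abs_of_pos (show 0 < Real.log 2 by linarith), div_le_iff₀ (by linarith)]
  have := Real.sqrt_nonneg D.m
  nlinarith

/-- A potential whose increments control the distance of `p` to `{0, 1}` and that of `m` to `0`. -/
lemma Density.Valid.potential_step_ge (h : D.Valid) :
    D.p ^ 2 + 8 * D.F + ((D.p * (1 - D.p)) ^ 2 + D.m ^ 2) ≤
      ((D.minus.p ^ 2 + 8 * D.minus.F) + (D.plus.p ^ 2 + 8 * D.plus.F)) / 2 := by
  have h1 := h.F_step_ge
  obtain ⟨hp, he, hm, hs⟩ := h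
  have h2 : 2 * D.p ^ 2 + 2 * (D.p * (1 - D.p)) ^ 2 - 6 * (D.p * D.m) - D.m ^ 2 ≤
      D.minus.p ^ 2 + D.plus.p ^ 2 := by
    have he' : D.e = 1 - D.p - D.m := by linarith
    simp only [Density.minus, Density.plus]
    rw [he']
    rw [he'] at he
    generalize D.p = p at *
    generalize D.m = m at *
    set a := p ^ 2 + 2 * p * (1 - p - m)
    set b := p ^ 2 + m ^ 2
    have e1 : a + b = 2 * p * (1 - m) + m ^ 2 := by simp only [a, b]; ring
    have e2 : a - b = 2 * p * (1 - p) - (2 * p * m + m ^ 2) := by simp only [a, b]; ring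
    have e3 : b ^ 2 + a ^ 2 = (a + b) ^ 2 / 2 + (a - b) ^ 2 / 2 := by ring
    have q : 0 ≤ p * m := by positivity
    have r : p * (1 - p) ≤ 1 / 4 := by nlinarith [sq_nonneg (p - 1 / 2)]
    have f1 : 4 * p ^ 2 * (1 - 2 * m) ≤ (a + b) ^ 2 := by
      rw [e1]
      have : 0 ≤ p * (1 - m) * m ^ 2 := by
        have : 0 ≤ 1 - m := by linarith
        positivity
      nlinarith [sq_nonneg (p * m), sq_nonneg (m ^ 2)]
    have f2 : 4 * (p * (1 - p)) ^ 2 - (2 * p * m + m ^ 2) ≤ (a - b) ^ 2 := by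
      rw [e2]
      nlinarith [sq_nonneg (2 * p * m + m ^ 2), mul_le_mul_of_nonneg_right r
        (show 0 ≤ 2 * p * m + m ^ 2 by positivity)]
    have f3 : p ^ 2 * m ≤ p * m := by nlinarith
    rw [e3]
    nlinarith [sq_nonneg m]
  linarith [mul_nonneg hp hm, sq_nonneg D.m]

/-- A Bhattacharyya-like parameter of a density, which dominates its error probability. -/
def Density.Z (D : Density) : ℝ := 1 - D.p + √D.m

lemma Density.Valid.Z_nonneg (h : D.Valid) : 0 ≤ D.Z := by
  obtain ⟨hp, he, hm, hs⟩ := h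
  unfold Density.Z
  linarith [Real.sqrt_nonneg D.m]

lemma Density.Valid.Z_minus_le (h : D.Valid) : D.minus.Z ≤ 5 * D.Z := by
  obtain ⟨hp, he, hm, hs⟩ := h
  simp only [Density.Z, Density.minus]
  have h1 : √(2 * D.p * D.m) ≤ 2 * √D.m := by
    apply Real.sqrt_le_iff.2
    refine ⟨by positivity, ?_⟩
    rw [mul_pow, Real.sq_sqrt hm]
    nlinarith
  nlinarith [Real.sqrt_nonneg D.m, sq_nonneg D.m, sq_nonneg (1 - D.p)]

lemma Density.Valid.Z_plus_le (h : D.Valid) (hz : D.Z ≤ 4⁻¹ ^ 18) :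
    D.plus.Z ≤ 4⁻¹ ^ 8 * D.Z := by
  have hz0 := h.Z_nonneg
  obtain ⟨hp, he, hm, hs⟩ := h
  simp only [Density.Z, Density.plus] at *
  have hsm := Real.sqrt_nonneg D.m
  have hsm2 := Real.sq_sqrt hm
  set z := 1 - D.p + √D.m
  have h0 : √D.m ≤ z := by simp only [z]; linarith
  have h0' : 1 - D.p ≤ z := by simp only [z]; linarith
  have h1 : D.m ≤ z ^ 2 := by nlinarith
  have h2 : √(D.m ^ 2 + 2 * D.e * D.m) ≤ √D.m * (2 * 4⁻¹ ^ 9) := by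
    apply Real.sqrt_le_iff.2
    refine ⟨by positivity, ?_⟩
    rw [mul_pow, hsm2]
    have : D.m + 2 * D.e ≤ (2 * 4⁻¹ ^ 9) ^ 2 := by norm_num at hz ⊢; linarith
    nlinarith
  have h3 : 1 - (D.p ^ 2 + 2 * D.p * D.e) ≤ 3 * z ^ 2 := by
    have : D.e = 1 - D.p - D.m := by linarith
    rw [this]
    nlinarith
  have h4 : z ^ 2 ≤ 4⁻¹ ^ 18 * z := by nlinarith
  norm_num at *
  nlinarith

end Three

/-! ### The three-message decoder -/

section Limits

variable {α : Type*} {st : Bool → α → α}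

/-- The gains of a bounded function along the process are summable, hence tend to zero. -/
lemma pathAvg_gain_tendsto {f h : α → ℝ} {C : ℝ} (hf : ∀ D, f D ≤ C) (h0 : ∀ D, 0 ≤ h D)
    (hstep : ∀ D, f D + h D ≤ (f (st false D) + f (st true D)) / 2) (D : α) :
    Tendsto (fun n => pathAvg st n h D) atTop (𝓝 0) := by
  have h1 : ∀ n, pathAvg st n f D + pathAvg st n h D ≤ pathAvg st (n + 1) f D := fun n => by
    rw [← pathAvg_add, pathAvg_succ]
    exact pathAvg_mono hstep n D
  have hmono : Monotone fun n => pathAvg st n f D :=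
    monotone_nat_of_le_succ fun n => by linarith [h1 n, pathAvg_nonneg (st := st) h0 n D]
  have hbdd : BddAbove (Set.range fun n => pathAvg st n f D) := by
    refine ⟨C, ?_⟩
    rintro _ ⟨n, rfl⟩
    have := pathAvg_mono (st := st) hf n D
    rwa [pathAvg_const] at this
  have hlim := tendsto_atTop_ciSup hmono hbdd
  have hdiff := (hlim.comp (tendsto_add_atTop_nat 1)).sub hlim
  rw [sub_self] at hdiff
  refine squeeze_zero (fun n => pathAvg_nonneg h0 n D) (fun n => ?_) hdiff
  have := h1 n
  simp only [Function.comp]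
  linarith

lemma pathAvg_tendsto_zero {f g : α → ℝ} (hf : ∀ D, 0 ≤ f D)
    (hfg : ∀ η > 0, ∃ C, ∀ D, f D ≤ η + C * g D) (D : α)
    (hg : Tendsto (fun n => pathAvg st n g D) atTop (𝓝 0)) :
    Tendsto (fun n => pathAvg st n f D) atTop (𝓝 0) := by
  rw [tendsto_order]
  refine ⟨fun a ha => Eventually.of_forall fun n => ha.trans_le (pathAvg_nonneg hf n D), ?_⟩
  intro η hη
  obtain ⟨C, hC⟩ := hfg (η / 2) (by positivity)
  have hlim : Tendsto (fun n => η / 2 + C * pathAvg st n g D) atTop (𝓝 (η / 2)) := by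
    simpa using (hg.const_mul C).const_add (η / 2)
  filter_upwards [hlim.eventually (gt_mem_nhds (show η / 2 < η by linarith))] with n hn
  refine lt_of_le_of_lt ?_ hn
  have := pathAvg_mono (st := st) hC n D
  rwa [pathAvg_add, pathAvg_const, pathAvg_mul] at this

end Limits

lemma Density.expect_eq (g : Density → ℝ) (n : ℕ) (D : Density) :
    D.expect g n = pathAvg (fun b D => D.step b) n g D := by
  unfold Density.expect
  induction n generalizing D with
  | zero => simp [pathAvg]
  | succ n ih =>
    have h : ∀ (b : Bool) (s : Fin n → Bool),
        List.ofFn (Fin.consEquiv (fun _ : Fin (n + 1) => Bool) (b, s)) = b :: List.ofFn s :=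
      fun b s => List.ofFn_cons b s
    rw [← Equiv.sum_comp (Fin.consEquiv fun _ : Fin (n + 1) => Bool)]
    rw [Fintype.sum_prod_type, Fintype.sum_bool, pathAvg, ← ih, ← ih, pow_succ]
    simp only [h, List.foldl_cons]
    rw [add_comm, ← add_div, div_div]

lemma Quantizer.map_zero (Q : Quantizer) : Q 0 = 0 := by
  have h := Q.odd 0
  rw [neg_zero] at h
  change Q.toFun 0 = 0
  generalize Q.toFun 0 = x at *
  induction x with
  | bot => exact absurd h (by rw [EReal.neg_bot]; exact bot_ne_top)
  | top => exact absurd h (by rw [EReal.neg_top]; exact top_ne_bot)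
  | coe x =>
    rw [← EReal.coe_neg, EReal.coe_eq_coe_iff] at h
    have : x = 0 := by linarith
    simp [this]

/-- The messages of a quantizer with three values that is positive on positive reals. -/
structure ThreeMsgs (Q : Quantizer) where
  q : Msg Q
  z : Msg Q
  q_pos : 0 < q.1
  z_eq : z.1 = 0
  cases : ∀ x : Msg Q, x = q ∨ x = z ∨ x = -q
  map_pos : ∀ x : EReal, 0 < x → Q x = q.1

lemma Msg.neg_val {Q : Quantizer} (x : Msg Q) : (-x).1 = -x.1 := rfl

lemma EReal.neg_neg_of_pos {x : EReal} (h : 0 < x) : -x < 0 := by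
  rw [← neg_zero]; exact EReal.neg_lt_neg_iff.2 h

lemma exists_threeMsgs (Q : Quantizer) (h3 : Q.card = 3) (hpos : ∀ x : EReal, 0 < x → 0 < Q x) :
    Nonempty (ThreeMsgs Q) := by
  set q : Msg Q := ⟨Q ⊤, Set.mem_range_self _⟩ with hq
  set z : Msg Q := ⟨0, 0, Q.map_zero⟩ with hz
  have q_pos : 0 < q.1 := hpos ⊤ (by simp)
  have neg_q : (-q).1 < 0 := EReal.neg_neg_of_pos q_pos
  have h1 : ({q.1, z.1, (-q).1} : Set EReal) ⊆ Set.range Q := by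
    rintro x (rfl | rfl | rfl)
    exacts [q.2, z.2, (-q).2]
  have h2 : ({q.1, z.1, (-q).1} : Set EReal).ncard = 3 := by
    rw [Set.ncard_eq_three]
    exact ⟨_, _, _, q_pos.ne', (neg_q.trans q_pos).ne', neg_q.ne', rfl⟩
  have h := Set.eq_of_subset_of_ncard_le h1 (by rw [h2]; exact h3.le) Q.finite_range
  have cases : ∀ x : Msg Q, x = q ∨ x = z ∨ x = -q := by
    intro x
    have hx : x.1 ∈ ({q.1, z.1, (-q).1} : Set EReal) := by rw [h]; exact x.2
    simpa [Subtype.ext_iff] using hx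
  refine ⟨⟨q, z, q_pos, rfl, cases, fun x hx => ?_⟩⟩
  have hx' := hpos x hx
  rcases cases ⟨Q x, Set.mem_range_self _⟩ with h | h | h
  · exact congrArg Subtype.val h
  · exact absurd (congrArg Subtype.val h) hx'.ne'
  · exact absurd (congrArg Subtype.val h) (neg_q.trans hx').ne'

lemma twoArtanh_pos {t : ℝ} (ht : 0 < t) : 0 < twoArtanh t := by
  unfold twoArtanh
  split_ifs with h1 h2
  · simp
  · linarith
  · have := Real.artanh_pos (x := t) ⟨ht, not_le.1 h1⟩
    exact_mod_cast (by positivity : 0 < 2 * Real.artanh t)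

lemma twoArtanh_zero : twoArtanh 0 = 0 := by
  rw [twoArtanh, if_neg (by norm_num), if_neg (by norm_num)]
  simp

lemma tanhHalf_pos {x : EReal} (hx : 0 < x) : 0 < tanhHalf x := by
  induction x with
  | bot => simp at hx
  | top => simp [tanhHalf]
  | coe x =>
    have hx' : 0 < x := by exact_mod_cast hx
    simp only [tanhHalf, EReal.coe_ne_top, EReal.coe_ne_bot, if_false, EReal.toReal_coe]
    rw [Real.tanh_eq_sinh_div_cosh]
    exact div_pos (Real.sinh_pos_iff.2 (by positivity)) (Real.cosh_pos _)

lemma Msg.op_true_neg {Q : Quantizer} (x y : Msg Q) : Msg.op true (-x) (-y) = -Msg.op true x y :=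
  Subtype.ext (by
    change varOp Q (-x.1) (-y.1) = -varOp Q x.1 y.1
    simp only [varOp, llrAdd_neg, Q.odd])

lemma Msg.op_false_neg_left {Q : Quantizer} (x y : Msg Q) :
    Msg.op false (-x) y = -Msg.op false x y :=
  Subtype.ext (by
    change checkOp Q (-x.1) y.1 = -checkOp Q x.1 y.1
    simp only [checkOp, tanhHalf_neg, neg_mul, twoArtanh_neg, Q.odd])

lemma Msg.op_comm {Q : Quantizer} (b : Bool) (x y : Msg Q) : Msg.op b x y = Msg.op b y x := by
  unfold Msg.op varOp checkOp llrAdd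
  simp only [mul_comm, add_comm, or_comm, and_comm]

namespace ThreeMsgs

variable {Q : Quantizer}

lemma neg_q_neg (t : ThreeMsgs Q) : (-t.q).1 < 0 := EReal.neg_neg_of_pos t.q_pos

lemma q_ne_z (t : ThreeMsgs Q) : t.q ≠ t.z := fun h => by
  have := t.q_pos; rw [h, t.z_eq] at this; exact lt_irrefl _ this

lemma q_ne_neg (t : ThreeMsgs Q) : t.q ≠ -t.q := fun h => by
  have := t.neg_q_neg; rw [← h] at this; exact this.not_gt t.q_pos

lemma z_ne_neg (t : ThreeMsgs Q) : t.z ≠ -t.q := fun h => by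
  have := t.neg_q_neg; rw [← h, t.z_eq] at this; exact lt_irrefl _ this

lemma neg_z (t : ThreeMsgs Q) : -t.z = t.z := Subtype.ext (by rw [Msg.neg_val, t.z_eq, neg_zero])

lemma sum_eq (t : ThreeMsgs Q) (f : Msg Q → ℝ) : ∑ x, f x = f t.q + f t.z + f (-t.q) := by
  have : (Finset.univ : Finset (Msg Q)) = {t.q, t.z, -t.q} := by
    ext x; simpa using t.cases x
  rw [this, Finset.sum_insert (by simp [t.q_ne_z, t.q_ne_neg]), Finset.sum_pair t.z_ne_neg]
  ring

lemma op_qq (t : ThreeMsgs Q) (b : Bool) : Msg.op b t.q t.q = t.q := by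
  apply Subtype.ext
  cases b
  · exact t.map_pos _ (twoArtanh_pos (mul_pos (tanhHalf_pos t.q_pos) (tanhHalf_pos t.q_pos)))
  · refine t.map_pos _ ?_
    unfold llrAdd
    split_ifs with h
    · rcases h with h | h <;> simp [h.2] at h
    · exact EReal.add_pos t.q_pos t.q_pos

lemma op_true_qz (t : ThreeMsgs Q) : Msg.op true t.q t.z = t.q := by
  apply Subtype.ext
  refine t.map_pos _ ?_
  simp [llrAdd, t.z_eq, t.q_pos]

lemma op_zz (t : ThreeMsgs Q) (b : Bool) : Msg.op b t.z t.z = t.z := by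
  apply Subtype.ext
  cases b <;> simp [Msg.op, checkOp, varOp, t.z_eq, tanhHalf, twoArtanh_zero, llrAdd, Q.map_zero]

lemma op_false_qz (t : ThreeMsgs Q) : Msg.op false t.q t.z = t.z := by
  apply Subtype.ext
  simp [Msg.op, checkOp, t.z_eq, tanhHalf, twoArtanh_zero, Q.map_zero]

lemma op_true_q_neg (t : ThreeMsgs Q) : Msg.op true t.q (-t.q) = t.z := by
  apply Subtype.ext
  have : llrAdd t.q.1 (-t.q.1) = 0 := by
    have := t.q_pos
    generalize t.q.1 = x at *
    induction x with
    | bot => simp at this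
    | top => simp [llrAdd]
    | coe x => simp [llrAdd, ← EReal.coe_neg, ← EReal.coe_add]
  simp [Msg.op, varOp, Msg.neg_val, this, Q.map_zero, t.z_eq]

/-- The density of a law on the three messages. -/
def density (t : ThreeMsgs Q) (a : FinLaw (Msg Q)) : Density := ⟨a.w t.q, a.w t.z, a.w (-t.q)⟩

lemma density_valid (t : ThreeMsgs Q) (a : FinLaw (Msg Q)) : (t.density a).Valid :=
  ⟨a.nonneg _, a.nonneg _, a.nonneg _, by rw [← a.sum_one, t.sum_eq]; rfl⟩

/-- Density evolution for the three messages is the recursion for `Density`. -/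
lemma density_step (t : ThreeMsgs Q) (b : Bool) (a : FinLaw (Msg Q)) :
    t.density (lawStep Q b a) = (t.density a).step b := by
  have zn := t.op_true_qz
  have c1 : Msg.op true t.z t.q = t.q := by rw [Msg.op_comm, t.op_true_qz]
  have c2 : Msg.op true (-t.q) t.q = t.z := by rw [Msg.op_comm, t.op_true_q_neg]
  have c3 : Msg.op true (-t.q) (-t.q) = -t.q := by rw [Msg.op_true_neg, t.op_qq]
  have c4 : Msg.op true (-t.q) t.z = -t.q := by
    rw [← t.neg_z, Msg.op_true_neg, t.op_true_qz]
  have c5 : Msg.op true t.z (-t.q) = -t.q := by rw [Msg.op_comm, c4]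
  have d1 : Msg.op false t.z t.q = t.z := by rw [Msg.op_comm, t.op_false_qz]
  have d2 : Msg.op false (-t.q) t.q = -t.q := by rw [Msg.op_false_neg_left, t.op_qq]
  have d3 : Msg.op false t.q (-t.q) = -t.q := by rw [Msg.op_comm, d2]
  have d4 : Msg.op false (-t.q) (-t.q) = t.q := by rw [Msg.op_false_neg_left, d3, neg_neg]
  have d5 : Msg.op false (-t.q) t.z = t.z := by
    rw [Msg.op_false_neg_left, t.op_false_qz, t.neg_z]
  have d6 : Msg.op false t.z (-t.q) = t.z := by rw [Msg.op_comm, d5]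
  have n1 := t.q_ne_z
  have n2 := t.q_ne_neg
  have n3 := t.z_ne_neg
  have hs := (t.density_valid a).sum_eq
  simp only [density] at hs
  have h : ∀ x, (lawStep Q b a).w x =
      ∑ y, ∑ z, if Msg.op b y z = x then a.w y * a.w z else 0 := fun x => rfl
  simp only [density, h, t.sum_eq]
  cases b
  · simp only [t.op_qq, t.op_zz, t.op_false_qz, d1, d2, d3, d4, d5, d6, n1, n1.symm, n2, n2.symm,
      n3, n3.symm, if_true, if_false, Density.step, Density.minus, Bool.false_eq_true]
    congr 1
    · ring
    · have : a.w t.q + a.w (-t.q) = 1 - a.w t.z := by linarith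
      linear_combination (2 * a.w t.z) * this
    · ring
  · simp only [t.op_qq, t.op_zz, t.op_true_qz, t.op_true_q_neg, c1, c2, c3, c4, c5, n1, n1.symm, n2,
      n2.symm, n3, n3.symm, if_true, if_false, Density.step, Density.plus]
    congr 1 <;> ring

lemma bitErr_eq (t : ThreeMsgs Q) (a : FinLaw (Msg Q)) :
    bitErr a = (t.density a).m + (t.density a).e / 2 := by
  unfold bitErr
  rw [t.sum_eq]
  simp [t.q_pos.not_gt, t.q_pos.ne', t.z_eq, t.neg_q_neg, density]
  ring

variable {Y : Type*} [MeasurableSpace Y]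

lemma density_msgLaw (t : ThreeMsgs Q) (W : BMSChannel Y) : t.density (W.msgLaw Q) = W.signDensity := by
  have hneg : ∀ x : EReal, x < 0 → Q x = (-t.q).1 := by
    intro x hx
    have : 0 < -x := by rw [← neg_zero]; exact EReal.neg_lt_neg_iff.2 hx
    rw [Msg.neg_val, ← t.map_pos _ this, Q.odd, neg_neg]
  have hz : ∀ x : EReal, x = 0 → Q x = t.z.1 := by
    rintro x rfl
    rw [t.z_eq, Q.map_zero]
  have n1 : t.q.1 ≠ t.z.1 := fun h => t.q_ne_z (Subtype.ext h)
  have n2 : t.q.1 ≠ (-t.q).1 := fun h => t.q_ne_neg (Subtype.ext h)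
  have n3 : t.z.1 ≠ (-t.q).1 := fun h => t.z_ne_neg (Subtype.ext h)
  unfold density BMSChannel.msgLaw BMSChannel.signDensity
  simp only
  congr 2 <;>
  · ext y
    simp only [Set.mem_ofPred_eq]
    rcases lt_trichotomy (W.llr y) 0 with h | h | h
    · simp [hneg _ h, h, h.not_gt, h.ne, n2.symm, n3.symm]
    · rw [hz _ h, h]
      simp [n1.symm, n3]
    · simp [t.map_pos _ h, h, h.not_gt, h.ne', n1, n2]

lemma expect_eq (t : ThreeMsgs Q) (W : BMSChannel Y) (g : Density → ℝ) (n : ℕ) :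
    W.signDensity.expect g n =
      pathAvg (lawStep Q) n (fun a => g (t.density a)) (W.msgLaw Q) := by
  rw [Density.expect_eq, ← t.density_msgLaw W]
  exact (pathAvg_comp t.density_step g n _).symm

lemma lowerBound_monotone (t : ThreeMsgs Q) (W : BMSChannel Y) : Monotone (lowerBound W) := by
  refine monotone_nat_of_le_succ fun n => ?_
  simp only [lowerBound, t.expect_eq]
  rw [pathAvg_succ]
  refine pathAvg_mono (fun a => ?_) n _
  have h := (t.density_valid a).F_step_ge
  simp only [t.density_step, Density.step, Bool.false_eq_true, if_true, if_false]
  have := (t.density_valid a)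
  nlinarith [mul_nonneg this.p_nonneg this.m_nonneg, sq_nonneg (t.density a).m]

lemma upperBound_antitone (t : ThreeMsgs Q) (W : BMSChannel Y) : Antitone (upperBound W) := by
  refine antitone_nat_of_succ_le fun n => ?_
  simp only [upperBound, t.expect_eq]
  rw [pathAvg_succ]
  refine pathAvg_mono (fun a => ?_) n _
  simpa only [t.density_step, Density.step, Bool.false_eq_true, if_true, if_false] using
    (t.density_valid a).I_step_le

lemma gain_tendsto (t : ThreeMsgs Q) (a : FinLaw (Msg Q)) :
    Tendsto (fun n => pathAvg (lawStep Q) n (fun a =>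
      ((t.density a).p * (1 - (t.density a).p)) ^ 2 + (t.density a).m ^ 2) a) atTop (𝓝 0) := by
  refine pathAvg_gain_tendsto (f := fun a => (t.density a).p ^ 2 + 8 * (t.density a).F) (C := 9)
    (fun a => ?_) (fun a => by positivity) (fun a => ?_) a
  · have h := t.density_valid a
    have := (t.density a).F_le_p
    have hp : (t.density a).p ≤ 1 := by linarith [h.sum_eq, h.e_nonneg, h.m_nonneg]
    nlinarith [h.p_nonneg]
  · simpa only [t.density_step, Density.step, Bool.false_eq_true, if_true, if_false] using
      (t.density_valid a).potential_step_ge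

lemma sqrt_m_tendsto (t : ThreeMsgs Q) (a : FinLaw (Msg Q)) :
    Tendsto (fun n => pathAvg (lawStep Q) n (fun a => √(t.density a).m) a) atTop (𝓝 0) := by
  refine pathAvg_tendsto_zero (fun a => Real.sqrt_nonneg _) (fun η hη => ⟨(η ^ 4)⁻¹, fun a => ?_⟩)
    a (t.gain_tendsto a)
  have h := t.density_valid a
  have hm := h.m_nonneg
  have hm1 : √(t.density a).m ≤ 1 :=
    Real.sqrt_le_one.2 (by linarith [h.sum_eq, h.e_nonneg, h.p_nonneg])
  have hsq := Real.sq_sqrt hm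
  rcases le_total (√(t.density a).m) η with h1 | h1
  · refine h1.trans (le_add_of_nonneg_right (by positivity))
  · have h2 : η ^ 4 ≤ (t.density a).m ^ 2 := by
      rw [← hsq, ← pow_mul]; exact pow_le_pow_left₀ hη.le h1 4
    have h3 : 1 ≤ (η ^ 4)⁻¹ *
        (((t.density a).p * (1 - (t.density a).p)) ^ 2 + (t.density a).m ^ 2) := by
      rw [inv_mul_eq_div, one_le_div (by positivity)]
      nlinarith [sq_nonneg ((t.density a).p * (1 - (t.density a).p))]
    linarith

lemma p_tendsto (t : ThreeMsgs Q) (a : FinLaw (Msg Q)) :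
    Tendsto (fun n => pathAvg (lawStep Q) n
      (fun a => (t.density a).p * (1 - (t.density a).p)) a) atTop (𝓝 0) := by
  refine pathAvg_tendsto_zero (fun a => ?_) (fun η hη => ⟨η⁻¹, fun a => ?_⟩) a (t.gain_tendsto a)
  · have h := t.density_valid a
    exact mul_nonneg h.p_nonneg (by linarith [h.sum_eq, h.e_nonneg, h.m_nonneg])
  · set x := (t.density a).p * (1 - (t.density a).p)
    have h1 : x ≤ η + η⁻¹ * x ^ 2 := by
      rw [inv_mul_eq_div, ← sub_nonneg]
      have : η + x ^ 2 / η - x = ((η - x) ^ 2 + η * x) / η := by field_simp; ring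
      rcases le_total x 0 with hx | hx
      · have : 0 ≤ x ^ 2 / η := by positivity
        linarith
      · rw [this]; positivity
    have : 0 ≤ η⁻¹ * (t.density a).m ^ 2 := by positivity
    linarith

lemma lowerBound_le (t : ThreeMsgs Q) (W : BMSChannel Y) (N : ℕ) : lowerBound W N ≤ maxRate W Q := by
  refine le_of_forall_pos_le_add fun η hη => ?_
  -- `ε` is chosen such that `(ε / 4⁻¹ ^ 18) ^ (1 / 8) = η`.
  set ε : ℝ := 4⁻¹ ^ 18 * η ^ 8 with hε
  have hε0 : 0 < ε := by positivity
  have hroot : (ε / 4⁻¹ ^ 18) ^ (1 / 8 : ℝ) = η := by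
    rw [hε, mul_div_cancel_left₀ _ (by positivity), ← Real.rpow_natCast, ← Real.rpow_mul hη.le]
    norm_num
  have key : ∀ n ≥ N, lowerBound W N - 2 / ε *
      (pathAvg (lawStep Q) n (fun a => √(t.density a).m) (W.msgLaw Q) +
        pathAvg (lawStep Q) n (fun a => (t.density a).p * (1 - (t.density a).p)) (W.msgLaw Q)) ≤
      maxRate W Q + η := by
    intro n hn
    have h1 := maxRate_ge W Q (Z := fun a => (t.density a).Z)
      (fun a => (t.density_valid a).Z_nonneg) (fun a => ?_) (ζ := 4⁻¹ ^ 18) (by positivity)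
      (fun a => by
        simpa only [t.density_step, Density.step, Bool.false_eq_true, if_false] using
          (t.density_valid a).Z_minus_le)
      (fun a ha => by
        simpa only [t.density_step, Density.step, if_true] using
          (t.density_valid a).Z_plus_le ha) hε0.le n
    · rw [hroot] at h1
      have h2 := t.lowerBound_monotone W hn
      have h3 : lowerBound W n ≤ pathAvg (lawStep Q) n (fun a => (if (t.density a).Z ≤ ε then 1 else 0)
          + 2 / ε * (√(t.density a).m + (t.density a).p * (1 - (t.density a).p))) (W.msgLaw Q) := by
        rw [lowerBound, t.expect_eq]
        refine pathAvg_mono (fun a => (t.density a).F_le_p.trans ?_) n _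
        have h := t.density_valid a
        have hp1 : (t.density a).p ≤ 1 := by linarith [h.sum_eq, h.e_nonneg, h.m_nonneg]
        have hp := h.p_nonneg
        have hs := Real.sqrt_nonneg (t.density a).m
        have hq : 0 ≤ (t.density a).p * (1 - (t.density a).p) := mul_nonneg hp (by linarith)
        split_ifs with hZ
        · have : 0 ≤ 2 / ε * (√(t.density a).m + (t.density a).p * (1 - (t.density a).p)) := by
            positivity
          linarith
        · simp only [Density.Z, not_le] at hZ
          rw [zero_add, div_mul_eq_mul_div, le_div_iff₀ hε0]
          nlinarith
      rw [pathAvg_add, pathAvg_mul, pathAvg_add] at h3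
      linarith
    · have h := t.density_valid a
      rw [t.bitErr_eq]
      simp only [Density.Z]
      linarith [h.sum_eq, h.e_nonneg, h.m_nonneg, Real.sqrt_nonneg (t.density a).m]
  have hlim := ((t.sqrt_m_tendsto (W.msgLaw Q)).add (t.p_tendsto (W.msgLaw Q))).const_mul (2 / ε)
  rw [add_zero, mul_zero] at hlim
  have hlim' := hlim.const_sub (lowerBound W N)
  rw [sub_zero] at hlim'
  exact le_of_tendsto hlim' (eventually_atTop.2 ⟨N, key⟩)

lemma le_upperBound (t : ThreeMsgs Q) (W : BMSChannel Y) (N : ℕ) : maxRate W Q ≤ upperBound W N := by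
  refine maxRate_le W Q (g := fun a => (t.density a).I) (fun a => (t.density_valid a).I_nonneg) ?_
    (Eventually.frequently (eventually_atTop.2 ⟨N, fun n hn => ?_⟩))
  · intro η hη
    refine ⟨min (η / 4) ((η / 8) ^ 2), by positivity, fun a ha => ?_⟩
    rw [t.bitErr_eq] at ha
    have h := t.density_valid a
    have h1 := ha.trans (min_le_left _ _)
    have h2 := ha.trans (min_le_right _ _)
    have h3 : √(t.density a).m ≤ η / 8 :=
      Real.sqrt_le_iff.2 ⟨by positivity, by linarith [h.e_nonneg]⟩
    have h4 := (abs_le.1 h.abs_I_sub_p_le).1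
    linarith [h.sum_eq, h.m_nonneg]
  · have := t.upperBound_antitone W hn
    simpa only [upperBound, t.expect_eq] using this

lemma tendsto_sub (t : ThreeMsgs Q) (W : BMSChannel Y) :
    Tendsto (fun n => upperBound W n - lowerBound W n) atTop (𝓝 0) := by
  have h := (t.sqrt_m_tendsto (W.msgLaw Q)).const_mul 8
  rw [mul_zero] at h
  refine squeeze_zero (fun n => ?_) (fun n => ?_) h
  · linarith [t.lowerBound_le W n, t.le_upperBound W n]
  · simp only [upperBound, lowerBound, t.expect_eq]
    rw [← pathAvg_sub, ← pathAvg_mul]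
    refine pathAvg_mono (fun a => ?_) n _
    have h := t.density_valid a
    linarith [(abs_le.1 h.abs_I_sub_p_le).2, h.p_sub_F_le]

end ThreeMsgs

/-- The bounds for the three-message decoder are monotone and converge to its maximal rate. -/
theorem three_message_bounds {Y : Type*} [MeasurableSpace Y] (W : BMSChannel Y) (Q : Quantizer)
    (h3 : Q.card = 3) (hpos : ∀ x : EReal, 0 < x → 0 < Q x) :
    Monotone (lowerBound W) ∧ Antitone (upperBound W) ∧
      (∀ n, lowerBound W n ≤ maxRate W Q ∧ maxRate W Q ≤ upperBound W n) ∧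
      Tendsto (lowerBound W) atTop (𝓝 (maxRate W Q)) ∧
      Tendsto (upperBound W) atTop (𝓝 (maxRate W Q)) := by
  obtain ⟨t⟩ := exists_threeMsgs Q h3 hpos
  have hsub := t.tendsto_sub W
  refine ⟨t.lowerBound_monotone W, t.upperBound_antitone W,
    fun n => ⟨t.lowerBound_le W n, t.le_upperBound W n⟩, ?_, ?_⟩
  · refine tendsto_of_tendsto_of_tendsto_of_le_of_le
      (by simpa using hsub.const_sub (maxRate W Q)) tendsto_const_nhds
      (fun n => ?_) (fun n => t.lowerBound_le W n)
    simp only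
    linarith [t.le_upperBound W n]
  · refine tendsto_of_tendsto_of_tendsto_of_le_of_le tendsto_const_nhds
      (by simpa using hsub.const_add (maxRate W Q)) (fun n => t.le_upperBound W n) (fun n => ?_)
    simp only
    linarith [t.lowerBound_le W n]

/-! ### A uniform quantizer with saturation -/

/-- Uniform quantization with step `1 / N` towards zero on `|x| < M - 1`, and saturation at `±M`
beyond. The saturation sets in one unit below `M` so that a check node maps two messages `M`, whose
combination is at least `M - log 2`, to `M` again. -/
def gridFun (M N : ℕ) (x : EReal) : ℝ :=
  if ((M - 1 : ℝ) : EReal) ≤ x then M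
  else if x ≤ ((-(M - 1) : ℝ) : EReal) then -M
  else ((if 0 ≤ x.toReal then ⌊N * x.toReal⌋ else ⌈N * x.toReal⌉ : ℤ) : ℝ) / N

section Grid

variable {M N : ℕ}

lemma gridFun_top : gridFun M N ⊤ = M := by simp [gridFun]

lemma gridFun_bot : gridFun M N ⊥ = -M := by
  simp only [gridFun, le_bot_iff, EReal.coe_ne_bot, if_false, bot_le, if_true]

lemma gridFun_of_ge {w : ℝ} (h : M - 1 ≤ w) : gridFun M N w = M := by
  rw [gridFun, if_pos (EReal.coe_le_coe_iff.2 h)]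

lemma gridFun_of_le {w : ℝ} (hM : 2 ≤ M) (h : w ≤ -(M - 1)) : gridFun M N w = -M := by
  have : (2 : ℝ) ≤ M := by exact_mod_cast hM
  rw [gridFun, if_neg, if_pos (EReal.coe_le_coe_iff.2 h)]
  rw [EReal.coe_le_coe_iff]; linarith

lemma gridFun_of_lt {w : ℝ} (h1 : w < M - 1) (h2 : -(M - 1) < w) :
    gridFun M N w = ((if 0 ≤ w then ⌊N * w⌋ else ⌈N * w⌉ : ℤ) : ℝ) / N := by
  rw [gridFun, if_neg, if_neg, EReal.toReal_coe]
  · rw [EReal.coe_le_coe_iff]; linarith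
  · rw [EReal.coe_le_coe_iff]; linarith

lemma abs_gridFun_sub_le {w : ℝ} (hN : 0 < N) (h1 : w < M - 1) (h2 : -(M - 1) < w) :
    |gridFun M N w - w| ≤ 1 / N := by
  have hN' : (0 : ℝ) < N := by exact_mod_cast hN
  rw [gridFun_of_lt h1 h2]
  have : ∀ k : ℤ, |(k : ℝ) - N * w| ≤ 1 → |(k : ℝ) / N - w| ≤ 1 / N := by
    intro k hk
    rw [show (k : ℝ) / N - w = (k - N * w) / N by field_simp, abs_div, abs_of_pos hN']
    gcongr
  apply this
  rw [abs_le]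
  split_ifs
  · constructor <;> linarith [Int.floor_le (N * w), Int.lt_floor_add_one (N * w)]
  · constructor <;> linarith [Int.le_ceil (N * w), Int.ceil_lt_add_one (N * w)]

lemma gridFun_neg (hM : 2 ≤ M) (x : EReal) : gridFun M N (-x) = -gridFun M N x := by
  induction x with
  | bot => rw [EReal.neg_bot, gridFun_top, gridFun_bot, neg_neg]
  | top => rw [EReal.neg_top, gridFun_top, gridFun_bot]
  | coe w =>
    rw [← EReal.coe_neg]
    rcases le_or_gt ((M : ℝ) - 1) w with h | h
    · rw [gridFun_of_ge h, gridFun_of_le hM (by linarith)]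
    rcases le_or_gt w (-((M : ℝ) - 1)) with h' | h'
    · rw [gridFun_of_le hM h', gridFun_of_ge (by linarith), neg_neg]
    rw [gridFun_of_lt h h', gridFun_of_lt (by linarith) (by linarith), ← neg_div, ← Int.cast_neg]
    congr 2
    rw [mul_neg, Int.floor_neg, Int.ceil_neg]
    rcases lt_trichotomy w 0 with hw | rfl | hw
    · rw [if_pos (by linarith), if_neg (by linarith)]
    · simp
    · rw [if_neg (by linarith), if_pos (by linarith)]

lemma measurable_gridFun : Measurable (gridFun M N) := by
  refine Measurable.ite measurableSet_Ici measurable_const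
    (Measurable.ite measurableSet_Iic measurable_const ?_)
  have h : Measurable fun x : EReal => (N : ℝ) * x.toReal :=
    measurable_ereal_toReal.const_mul (N : ℝ)
  have h' : Measurable fun x : EReal =>
      (if 0 ≤ x.toReal then ⌊N * x.toReal⌋ else ⌈N * x.toReal⌉ : ℤ) :=
    Measurable.ite (measurableSet_le measurable_const measurable_ereal_toReal)
      h.floor h.ceil
  exact (measurable_from_top.comp h').div_const _

lemma abs_gridFun_le (hM : 2 ≤ M) (hN : 0 < N) (x : EReal) : |gridFun M N x| ≤ M := by
  have hM' : (2 : ℝ) ≤ M := by exact_mod_cast hM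
  have hN' : (1 : ℝ) ≤ N := by exact_mod_cast hN
  induction x with
  | bot => rw [gridFun_bot, abs_neg, Nat.abs_cast]
  | top => rw [gridFun_top, Nat.abs_cast]
  | coe w =>
    rcases le_or_gt ((M : ℝ) - 1) w with h | h
    · rw [gridFun_of_ge h, Nat.abs_cast]
    rcases le_or_gt w (-((M : ℝ) - 1)) with h' | h'
    · rw [gridFun_of_le hM h', abs_neg, Nat.abs_cast]
    have := abs_le.1 (abs_gridFun_sub_le hN h h')
    have h1 : (1 : ℝ) / N ≤ 1 := by rw [div_le_one (by linarith)]; exact hN'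
    rw [abs_le]; constructor <;> linarith

lemma exists_gridFun_eq (hM : 2 ≤ M) (hN : 0 < N) (x : EReal) :
    ∃ k : ℤ, gridFun M N x = k / N ∧ k ∈ Finset.Icc (-(M * N : ℤ)) (M * N) := by
  have hN' : (0 : ℝ) < N := by exact_mod_cast hN
  have key : ∃ k : ℤ, gridFun M N x = k / N := by
    unfold gridFun
    split_ifs
    · exact ⟨M * N, by push_cast; field_simp⟩
    · exact ⟨-(M * N), by push_cast; field_simp⟩
    · exact ⟨_, rfl⟩
    · exact ⟨_, rfl⟩
  obtain ⟨k, hk⟩ := key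
  refine ⟨k, hk, ?_⟩
  have h := abs_gridFun_le hM hN x
  rw [hk, abs_div, abs_of_pos hN', div_le_iff₀ hN', abs_le] at h
  rw [Finset.mem_Icc]
  constructor
  · exact_mod_cast h.1
  · exact_mod_cast h.2

/-- The uniform quantizer with saturation. -/
def gridQuantizer (M N : ℕ) (hM : 2 ≤ M) (hN : 0 < N) : Quantizer where
  toFun x := (gridFun M N x : EReal)
  odd x := by rw [gridFun_neg hM, EReal.coe_neg]
  finite_range := by
    refine ((Finset.Icc (-(M * N : ℤ)) (M * N)).finite_toSet.image
      (fun k : ℤ => (((k : ℝ) / N : ℝ) : EReal))).subset ?_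
    rintro _ ⟨x, rfl⟩
    obtain ⟨k, hk, hk'⟩ := exists_gridFun_eq hM hN x
    exact ⟨k, hk', by change _ = ((gridFun M N x : ℝ) : EReal); rw [hk]⟩
  measurable := measurable_coe_real_ereal.comp measurable_gridFun

lemma gridQuantizer_card_le (hM : 2 ≤ M) (hN : 0 < N) :
    (gridQuantizer M N hM hN).card ≤ 2 * (M * N) + 1 := by
  have hsub : Set.range (gridQuantizer M N hM hN).toFun ⊆
      (fun k : ℤ => (((k : ℝ) / N : ℝ) : EReal)) '' ↑(Finset.Icc (-(M * N : ℤ)) (M * N)) := by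
    rintro _ ⟨x, rfl⟩
    obtain ⟨k, hk, hk'⟩ := exists_gridFun_eq hM hN x
    exact ⟨k, hk', by change _ = ((gridFun M N x : ℝ) : EReal); rw [hk]⟩
  refine (Set.ncard_le_ncard hsub ((Finset.finite_toSet _).image _)).trans ?_
  refine (Set.ncard_image_le (Finset.finite_toSet _)).trans ?_
  rw [Set.ncard_coe_finset, Int.card_Icc]
  omega

end Grid

/-! ### Logarithmic loss and node operations on real messages -/

/-- The logarithmic loss `-log (1 / (1 + e⁻ˣ))`, in nats, of a message `x` about a bit `0`. -/
def logLoss (x : ℝ) : ℝ := Real.log (1 + Real.exp (-x))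

lemma logLoss_nonneg (x : ℝ) : 0 ≤ logLoss x :=
  Real.log_nonneg (by linarith [Real.exp_pos (-x)])

lemma logLoss_le_exp (x : ℝ) : logLoss x ≤ Real.exp (-x) := by
  have := Real.log_le_sub_one_of_pos (show 0 < 1 + Real.exp (-x) by positivity)
  unfold logLoss; linarith

lemma logLoss_anti {x y : ℝ} (h : x ≤ y) : logLoss y ≤ logLoss x := by
  unfold logLoss; gcongr

lemma logLoss_sub_le {x d : ℝ} (hd : 0 ≤ d) : logLoss (x - d) ≤ logLoss x + d := by
  unfold logLoss
  have h : 1 + Real.exp (-(x - d)) ≤ (1 + Real.exp (-x)) * Real.exp d := by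
    rw [show -(x - d) = -x + d by ring, Real.exp_add, add_mul, one_mul]
    linarith [Real.one_le_exp hd]
  calc _ ≤ Real.log ((1 + Real.exp (-x)) * Real.exp d) := Real.log_le_log (by positivity) h
    _ = _ := by rw [Real.log_mul (by positivity) (by positivity), Real.log_exp]

/-- The loss caused by quantization: the step, the saturation of large positive values, and the
sharpening of strongly negative values. -/
lemma logLoss_gridFun_le {M N : ℕ} (hM : 2 ≤ M) (hN : 0 < N) (w : ℝ) :
    logLoss (gridFun M N w) ≤ logLoss w + 1 / N + Real.exp (-(M - 1)) +
      if w ≤ -(M - 1) then 1 else 0 := by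
  have hN' : (0 : ℝ) ≤ 1 / N := by positivity
  have he := Real.exp_pos (-((M : ℝ) - 1))
  have hM' : (2 : ℝ) ≤ M := by exact_mod_cast hM
  rcases le_or_gt ((M : ℝ) - 1) w with h | h
  · rw [gridFun_of_ge h, if_neg (by linarith)]
    have h1 := logLoss_le_exp M
    have h2 : Real.exp (-(M : ℝ)) ≤ Real.exp (-(M - 1)) := by gcongr; linarith
    linarith [logLoss_nonneg w]
  rcases le_or_gt w (-((M : ℝ) - 1)) with h' | h'
  · rw [gridFun_of_le hM h', if_pos h']
    have h1 : logLoss (-M) ≤ logLoss (w - 1) := logLoss_anti (by linarith)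
    have h2 := logLoss_sub_le (x := w) zero_le_one
    linarith
  · rw [if_neg (by linarith)]
    have h1 := (abs_le.1 (abs_gridFun_sub_le hN h h')).1
    have h2 : logLoss (gridFun M N w) ≤ logLoss (w - 1 / N) := logLoss_anti (by linarith)
    have h3 := logLoss_sub_le (x := w) hN'
    linarith

/-- The check node operation on real log-likelihood ratios. -/
def checkReal (x y : ℝ) : ℝ :=
  -Real.log ((Real.exp (-x) + Real.exp (-y)) / (1 + Real.exp (-x) * Real.exp (-y)))

lemma exp_neg_checkReal (x y : ℝ) : Real.exp (-checkReal x y) =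
    (Real.exp (-x) + Real.exp (-y)) / (1 + Real.exp (-x) * Real.exp (-y)) := by
  rw [checkReal, neg_neg, Real.exp_log (by positivity)]

/-- The two messages produced by a polar transform have the same total loss as its inputs. -/
lemma logLoss_check_add_var (x y : ℝ) :
    logLoss (checkReal x y) + logLoss (x + y) = logLoss x + logLoss y := by
  unfold logLoss
  rw [exp_neg_checkReal, neg_add, Real.exp_add,
    ← Real.log_mul (by positivity) (by positivity), ← Real.log_mul (by positivity) (by positivity)]
  congr 1
  field_simp
  ring

lemma exp_neg_checkReal_le (x y : ℝ) :
    Real.exp (-checkReal x y) ≤ Real.exp (-x) + Real.exp (-y) := by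
  rw [exp_neg_checkReal]
  refine div_le_self (by positivity) ?_
  linarith [mul_pos (Real.exp_pos (-x)) (Real.exp_pos (-y))]

lemma tanhHalf_coe (x : ℝ) : tanhHalf x = (1 - Real.exp (-x)) / (1 + Real.exp (-x)) := by
  simp only [tanhHalf, EReal.coe_ne_top, EReal.coe_ne_bot, if_false, EReal.toReal_coe]
  rw [Real.tanh_eq_sinh_div_cosh, Real.sinh_eq, Real.cosh_eq,
    show -x = -(x / 2) + -(x / 2) by ring, Real.exp_add]
  have h : Real.exp (x / 2) * Real.exp (-(x / 2)) = 1 := by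
    rw [← Real.exp_add]; simp
  field_simp
  generalize Real.exp (x / 2) = a at *
  generalize Real.exp (-(x / 2)) = b at *
  linear_combination (2 * b) * h

lemma twoArtanh_tanhHalf (x y : ℝ) :
    twoArtanh (tanhHalf x * tanhHalf y) = (checkReal x y : EReal) := by
  rw [tanhHalf_coe, tanhHalf_coe]
  have hu := Real.exp_pos (-x)
  have hv := Real.exp_pos (-y)
  unfold checkReal
  set u := Real.exp (-x)
  set v := Real.exp (-y)
  set t := (1 - u) / (1 + u) * ((1 - v) / (1 + v)) with ht
  have h1 : 1 + t = 2 * (1 + u * v) / ((1 + u) * (1 + v)) := by rw [ht]; field_simp; ring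
  have h2 : 1 - t = 2 * (u + v) / ((1 + u) * (1 + v)) := by rw [ht]; field_simp; ring
  have h1' : 0 < 1 + t := by rw [h1]; positivity
  have h2' : 0 < 1 - t := by rw [h2]; positivity
  rw [twoArtanh, if_neg (by linarith), if_neg (by linarith),
    Real.artanh_eq_half_log ⟨by linarith, by linarith⟩, ← Real.log_inv, h1, h2]
  congr 1
  rw [← mul_assoc]
  norm_num
  congr 1
  field_simp

/-! ### The messages of the uniform quantizer -/

section GridMsg

variable {M N : ℕ} {hM : 2 ≤ M} {hN : 0 < N}

/-- The real value of a message. -/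
def Msg.val (x : Msg (gridQuantizer M N hM hN)) : ℝ := x.1.toReal

lemma Msg.coe_val (x : Msg (gridQuantizer M N hM hN)) : ((x.val : ℝ) : EReal) = x.1 := by
  obtain ⟨_, y, rfl⟩ := x
  rfl

lemma Msg.val_neg (x : Msg (gridQuantizer M N hM hN)) : (-x).val = -x.val := by
  rw [Msg.val, Msg.neg_val, EReal.toReal_neg_eq]
  rfl

lemma Msg.val_eq_gridFun (x : Msg (gridQuantizer M N hM hN)) : ∃ y, x.val = gridFun M N y := by
  obtain ⟨_, y, rfl⟩ := x
  exact ⟨y, rfl⟩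

lemma Msg.abs_val_le (x : Msg (gridQuantizer M N hM hN)) : |x.val| ≤ M := by
  obtain ⟨y, hy⟩ := x.val_eq_gridFun
  rw [hy]; exact abs_gridFun_le hM hN y

/-- The node operations before quantization. -/
def nodeReal (b : Bool) (x y : ℝ) : ℝ := if b then x + y else checkReal x y

lemma Msg.val_op (b : Bool) (x y : Msg (gridQuantizer M N hM hN)) :
    (Msg.op b x y).val = gridFun M N (nodeReal b x.val y.val : ℝ) := by
  cases b
  · change ((gridFun M N (twoArtanh (tanhHalf x.1 * tanhHalf y.1)) : ℝ) : EReal).toReal = _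
    rw [EReal.toReal_coe, ← x.coe_val, ← y.coe_val, twoArtanh_tanhHalf]
    rfl
  · change ((gridFun M N (llrAdd x.1 y.1) : ℝ) : EReal).toReal = _
    rw [EReal.toReal_coe, ← x.coe_val, ← y.coe_val]
    simp [llrAdd, nodeReal]

/-- The Bhattacharyya weight `e^{-x/2}` of a message, with the weight of the message `M` set to zero:
two messages `M` combine to `M` again, so a variable node could not decrease a positive weight. -/
def Msg.weight (x : Msg (gridQuantizer M N hM hN)) : ℝ :=
  if x.val = M then 0 else Real.exp (-x.val / 2)

lemma Msg.weight_nonneg (x : Msg (gridQuantizer M N hM hN)) : 0 ≤ x.weight := by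
  unfold Msg.weight; split_ifs <;> positivity

lemma Msg.weight_le (x : Msg (gridQuantizer M N hM hN)) : x.weight ≤ Real.exp (-x.val / 2) := by
  unfold Msg.weight
  split_ifs
  · positivity
  · exact le_rfl

lemma Msg.one_le_weight {x : Msg (gridQuantizer M N hM hN)} (h : x.val ≤ 0) : 1 ≤ x.weight := by
  have : (2 : ℝ) ≤ M := by exact_mod_cast hM
  rw [Msg.weight, if_neg (by linarith)]
  exact Real.one_le_exp (by linarith)

/-- Quantization increases the weight of a message at most by the factor `e^{1/2}`. -/
lemma Msg.weight_op_le (b : Bool) (x y : Msg (gridQuantizer M N hM hN)) :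
    (Msg.op b x y).weight ≤ Real.exp (1 / 2) * Real.exp (-nodeReal b x.val y.val / 2) := by
  have hN' : (1 : ℝ) ≤ N := by exact_mod_cast hN
  unfold Msg.weight
  rw [Msg.val_op]
  generalize nodeReal b x.val y.val = w
  split_ifs with h
  · positivity
  rw [← Real.exp_add]
  gcongr
  rcases le_or_gt ((M : ℝ) - 1) w with h1 | h1
  · exact absurd (gridFun_of_ge h1) h
  rcases le_or_gt w (-((M : ℝ) - 1)) with h2 | h2
  · rw [gridFun_of_le hM h2]; linarith
  · have h3 := (abs_le.1 (abs_gridFun_sub_le hN h1 h2)).1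
    have h1 : (1 : ℝ) / N ≤ 1 := by rw [div_le_one (by linarith)]; exact hN'
    linarith

lemma Msg.weight_var_le (x y : Msg (gridQuantizer M N hM hN)) :
    (Msg.op true x y).weight ≤ Real.exp (1 / 2) *
      (x.weight * y.weight + Real.exp (-M / 2) * (x.weight + y.weight)) := by
  have hM' : (2 : ℝ) ≤ M := by exact_mod_cast hM
  by_cases hxy : x.val = M ∧ y.val = M
  · have : (Msg.op true x y).weight = 0 := by
      rw [Msg.weight, if_pos]
      rw [Msg.val_op, gridFun_of_ge]
      simp only [nodeReal, if_true, hxy]; linarith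
    rw [this]
    have := x.weight_nonneg
    have := y.weight_nonneg
    positivity
  refine (Msg.weight_op_le true x y).trans ?_
  gcongr
  have hsplit : Real.exp (-nodeReal true x.val y.val / 2) =
      Real.exp (-x.val / 2) * Real.exp (-y.val / 2) := by
    rw [← Real.exp_add]; simp only [nodeReal, if_true]; ring_nf
  rw [hsplit]
  unfold Msg.weight
  split_ifs with h1 h2 h2
  · exact absurd ⟨h1, h2⟩ hxy
  · rw [h1]; simp
  · rw [h2]; simp [mul_comm]
  · have := Real.exp_pos (-x.val / 2)
    have := Real.exp_pos (-y.val / 2)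
    have := Real.exp_pos (-(M : ℝ) / 2)
    nlinarith [mul_pos this (add_pos ‹0 < Real.exp (-x.val / 2)› ‹0 < Real.exp (-y.val / 2)›)]

lemma exp_half_le : Real.exp (1 / 2) ≤ 33 / 20 := by
  rw [show (33 / 20 : ℝ) = √((33 / 20) ^ 2) by rw [Real.sqrt_sq (by norm_num)], Real.exp_half]
  exact Real.sqrt_le_sqrt (by linarith [Real.exp_one_lt_d9])

lemma Msg.weight_check_le (x y : Msg (gridQuantizer M N hM hN)) :
    (Msg.op false x y).weight ≤ 5 / 2 * (x.weight + y.weight) := by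
  have hx0 := x.weight_nonneg
  have hy0 := y.weight_nonneg
  have hlog := Real.log_two_lt_d9
  by_cases hxy : x.val = M ∧ y.val = M
  · have : (Msg.op false x y).weight = 0 := by
      rw [Msg.weight, if_pos]
      rw [Msg.val_op, gridFun_of_ge]
      have h := exp_neg_checkReal_le x.val y.val
      rw [hxy.1, hxy.2, ← two_mul, ← Real.exp_log (show (0 : ℝ) < 2 by norm_num), ← Real.exp_add,
        Real.exp_le_exp] at h
      simp only [nodeReal, Bool.false_eq_true, if_false, hxy]
      linarith
    rw [this]; positivity
  -- at most one of the two messages is saturated; then it has the smaller true weight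
  have hs : ∀ z : Msg (gridQuantizer M N hM hN),
      Real.exp (-z.val / 2) ^ 2 = Real.exp (-z.val) := fun z => by
    rw [← Real.exp_nat_mul]; ring_nf
  have hroot : Real.exp (-nodeReal false x.val y.val / 2) ≤
      √(Real.exp (-x.val / 2) ^ 2 + Real.exp (-y.val / 2) ^ 2) := by
    rw [hs, hs]
    apply Real.le_sqrt_of_sq_le
    refine le_trans (le_of_eq ?_) (exp_neg_checkReal_le x.val y.val)
    rw [← Real.exp_nat_mul]
    simp only [nodeReal, Bool.false_eq_true, if_false]
    ring_nf
  have key : √(Real.exp (-x.val / 2) ^ 2 + Real.exp (-y.val / 2) ^ 2) ≤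
      3 / 2 * (x.weight + y.weight) := by
    apply Real.sqrt_le_iff.2
    refine ⟨by positivity, ?_⟩
    have hle : ∀ z w : Msg (gridQuantizer M N hM hN), z.val = M →
        Real.exp (-z.val / 2) ≤ Real.exp (-w.val / 2) := fun z w hz => by
      gcongr; rw [hz]; exact (abs_le.1 w.abs_val_le).2
    unfold Msg.weight
    have px := Real.exp_pos (-x.val / 2)
    have py := Real.exp_pos (-y.val / 2)
    split_ifs with h1 h2 h2
    · exact absurd ⟨h1, h2⟩ hxy
    · have := hle x y h1
      nlinarith
    · have := hle y x h2
      nlinarith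
    · nlinarith [mul_pos px py]
  have h1 := Msg.weight_op_le false x y
  have h2 : Real.exp (1 / 2) * Real.exp (-nodeReal false x.val y.val / 2) ≤
      33 / 20 * (3 / 2 * (x.weight + y.weight)) :=
    mul_le_mul exp_half_le (hroot.trans key) (by positivity) (by norm_num)
  linarith

end GridMsg

/-! ### Mismatch of the labels of messages -/

/-- The amount by which the score of a pair `±x` of messages falls short of its information, because
its label `x` differs from its true log-likelihood ratio `log (p / m)`. -/
def pairExcess (p m x : ℝ) : ℝ :=
  pairInfo p m - p * (Real.log 2 - logLoss x) - m * (Real.log 2 - logLoss (-x))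

/-- The excess is a Kullback-Leibler divergence, which dominates the squared Hellinger distance. -/
lemma hellinger_le_pairExcess {p m : ℝ} (hp : 0 ≤ p) (hm : 0 ≤ m) (x : ℝ) :
    (√p - √(p + m) * √((1 + Real.exp (-x))⁻¹)) ^ 2 +
      (√m - √(p + m) * √((1 + Real.exp x)⁻¹)) ^ 2 ≤ pairExcess p m x := by
  have key : ∀ q α : ℝ, 0 ≤ q → q ≤ p + m → 0 < α →
      2 * q - 2 * (√q * (√(p + m) * √α)) ≤
        -Real.negMulLog q - q * Real.log (p + m) - q * Real.log α := by
    intro q α hq hqs hα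
    rcases hq.eq_or_lt with rfl | hq
    · simp
    have hs : 0 < p + m := by linarith
    have h1 : Real.log (√(p + m) * √α / √q) =
        (Real.log (p + m) + Real.log α - Real.log q) / 2 := by
      rw [Real.log_div (by positivity) (by positivity), Real.log_mul (by positivity) (by positivity),
        Real.log_sqrt hs.le, Real.log_sqrt hα.le, Real.log_sqrt hq.le]
      ring
    have h2 := Real.log_le_sub_one_of_pos (show 0 < √(p + m) * √α / √q by positivity)
    have h3 := mul_le_mul_of_nonneg_left h2 hq.le
    have h4 : q * (√(p + m) * √α / √q) = √q * (√(p + m) * √α) := by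
      rw [mul_div_assoc', div_eq_iff (by positivity)]
      linear_combination (-(√(p + m) * √α)) * Real.mul_self_sqrt hq.le
    rw [h1, mul_sub, h4] at h3
    unfold Real.negMulLog
    linarith
  have h1 := key p (1 + Real.exp (-x))⁻¹ hp (by linarith) (by positivity)
  have h2 := key m (1 + Real.exp x)⁻¹ hm (by linarith) (by positivity)
  have hαβ : (1 + Real.exp (-x))⁻¹ + (1 + Real.exp x)⁻¹ = 1 := by
    rw [Real.exp_neg]; field_simp; ring
  have e1 : (√p - √(p + m) * √((1 + Real.exp (-x))⁻¹)) ^ 2 +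
      (√m - √(p + m) * √((1 + Real.exp x)⁻¹)) ^ 2 =
      2 * p - 2 * (√p * (√(p + m) * √(1 + Real.exp (-x))⁻¹)) +
        (2 * m - 2 * (√m * (√(p + m) * √(1 + Real.exp x)⁻¹))) := by
    have a1 := Real.sq_sqrt hp
    have a2 := Real.sq_sqrt hm
    have a3 := Real.sq_sqrt (show 0 ≤ p + m by linarith)
    have a4 := Real.sq_sqrt (show 0 ≤ (1 + Real.exp (-x))⁻¹ by positivity)
    have a5 := Real.sq_sqrt (show 0 ≤ (1 + Real.exp x)⁻¹ by positivity)
    rw [sub_sq, sub_sq, mul_pow, mul_pow, a1, a2, a3, a4, a5]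
    linear_combination (p + m) * hαβ
  rw [e1]
  refine (add_le_add h1 h2).trans (le_of_eq ?_)
  unfold pairExcess pairInfo logLoss
  rw [neg_neg, Real.log_inv, Real.log_inv]
  simp only [Real.negMulLog]
  ring

lemma pairExcess_nonneg {p m : ℝ} (hp : 0 ≤ p) (hm : 0 ≤ m) (x : ℝ) : 0 ≤ pairExcess p m x :=
  le_trans (by positivity) (hellinger_le_pairExcess hp hm x)

lemma le_exp_add_pairExcess {p m : ℝ} (hp : 0 ≤ p) (hm : 0 ≤ m) (x : ℝ) :
    m ≤ 2 * (p + m) * Real.exp (-x) + 2 * pairExcess p m x := by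
  have h := hellinger_le_pairExcess hp hm x
  have hq : (√(p + m) * √((1 + Real.exp x)⁻¹)) ^ 2 ≤ (p + m) * Real.exp (-x) := by
    rw [mul_pow, Real.sq_sqrt (by linarith), Real.sq_sqrt (by positivity), Real.exp_neg]
    gcongr
    linarith
  have := Real.sq_sqrt hm
  nlinarith [sq_nonneg (√p - √(p + m) * √((1 + Real.exp (-x))⁻¹)),
    sq_nonneg (√m - 2 * (√(p + m) * √((1 + Real.exp x)⁻¹)))]

/-- The Bhattacharyya weight computed from the label is close to the true one. -/
lemma weight_le_pairExcess {p m : ℝ} (hp : 0 ≤ p) (hm : 0 ≤ m) (x : ℝ) :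
    p * Real.exp (-x / 2) + m * Real.exp (x / 2) ≤
      2 * √(p * m) + (Real.exp (-x / 2) + Real.exp (x / 2)) * pairExcess p m x := by
  have h := hellinger_le_pairExcess hp hm x
  set r := Real.exp (-x / 2) with hr
  have hr0 : 0 < r := Real.exp_pos _
  have hr1 : Real.exp (x / 2) = r⁻¹ := by rw [hr, ← Real.exp_neg]; ring_nf
  have hβ : √((1 + Real.exp x)⁻¹) = r * √((1 + Real.exp (-x))⁻¹) := by
    have : (1 + Real.exp x)⁻¹ = r ^ 2 * (1 + Real.exp (-x))⁻¹ := by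
      have h2 : r ^ 2 = Real.exp (-x) := by rw [hr, ← Real.exp_nat_mul]; ring_nf
      rw [h2, Real.exp_neg]; field_simp; ring
    rw [this, Real.sqrt_mul (by positivity), Real.sqrt_sq hr0.le]
  rw [hβ] at h
  rw [hr1, Real.sqrt_mul hp]
  have a1 := Real.sq_sqrt hp
  have a2 := Real.sq_sqrt hm
  set t := √(p + m) * √((1 + Real.exp (-x))⁻¹)
  have e : √(p + m) * (r * √((1 + Real.exp (-x))⁻¹)) = r * t := by ring
  rw [e] at h
  have h1 : (r * √p - √m) ^ 2 ≤ (r ^ 2 + 1) * pairExcess p m x :=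
    le_trans (by nlinarith [sq_nonneg (r * (√m - r * t) + (√p - t))])
      (mul_le_mul_of_nonneg_left h (by positivity))
  have h2 := mul_le_mul_of_nonneg_left h1 (inv_nonneg.2 hr0.le)
  have e1 : r⁻¹ * (r * √p - √m) ^ 2 = p * r + m * r⁻¹ - 2 * (√p * √m) := by
    rw [← a1, ← a2, Real.sqrt_sq (Real.sqrt_nonneg _), Real.sqrt_sq (Real.sqrt_nonneg _)]
    field_simp; ring
  have e2 : r⁻¹ * ((r ^ 2 + 1) * pairExcess p m x) = (r + r⁻¹) * pairExcess p m x := by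
    field_simp
  linarith

/-! ### Information, score and gap of a labelled law -/

section Labelled

variable {κ : Type*} [Fintype κ]

/-- The information, in nats, about a uniform input bit carried by an observation in `κ` of law `A`
under input `0`, and of the law reflected by `σ` under input `1`. -/
def FinLaw.infoOf (A : FinLaw κ) (σ : κ → κ) : ℝ := (∑ k, pairInfo (A.w k) (A.w (σ k))) / 2

/-- The information, in nats, that remains if the observation `k` is interpreted as the
log-likelihood ratio `v k`. -/
def FinLaw.scoreOf (A : FinLaw κ) (v : κ → ℝ) : ℝ := ∑ k, A.w k * (Real.log 2 - logLoss (v k))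

/-- The loss of information due to the mismatch of the labels `v`. -/
def FinLaw.gapOf (A : FinLaw κ) (σ : κ → κ) (v : κ → ℝ) : ℝ := A.infoOf σ - A.scoreOf v

variable (A : FinLaw κ) {σ : κ → κ} {v : κ → ℝ}

lemma sum_involutive (hσ : Function.Involutive σ) (f : κ → ℝ) : ∑ k, f (σ k) = ∑ k, f k :=
  Equiv.sum_comp (hσ.toPerm σ) f

lemma FinLaw.gapOf_eq (hσ : Function.Involutive σ) (hv : ∀ k, v (σ k) = -v k) :
    A.gapOf σ v = (∑ k, pairExcess (A.w k) (A.w (σ k)) (v k)) / 2 := by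
  have h := sum_involutive hσ fun k => A.w k * (Real.log 2 - logLoss (v k))
  simp only [hv] at h
  simp only [FinLaw.gapOf, FinLaw.infoOf, FinLaw.scoreOf, pairExcess, Finset.sum_sub_distrib] at h ⊢
  rw [h]; ring

lemma FinLaw.gapOf_nonneg (hσ : Function.Involutive σ) (hv : ∀ k, v (σ k) = -v k) :
    0 ≤ A.gapOf σ v := by
  rw [A.gapOf_eq hσ hv]
  have := Finset.sum_nonneg fun k (_ : k ∈ Finset.univ) =>
    pairExcess_nonneg (A.nonneg k) (A.nonneg (σ k)) (v k)
  linarith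

lemma FinLaw.sum_pair (hσ : Function.Involutive σ) : ∑ k, (A.w k + A.w (σ k)) = 2 := by
  rw [Finset.sum_add_distrib, sum_involutive hσ A.w, A.sum_one]; norm_num

lemma FinLaw.infoOf_nonneg : 0 ≤ A.infoOf σ :=
  div_nonneg (Finset.sum_nonneg fun k _ => pairInfo_nonneg (A.nonneg k) (A.nonneg (σ k)))
    (by norm_num)

lemma FinLaw.infoOf_le (hσ : Function.Involutive σ) : A.infoOf σ ≤ Real.log 2 := by
  have h := Finset.sum_le_sum fun k (_ : k ∈ Finset.univ) =>
    pairInfo_le (A.nonneg k) (A.nonneg (σ k))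
  rw [← Finset.sum_mul, A.sum_pair hσ] at h
  unfold FinLaw.infoOf
  linarith

/-- Strongly negative labels are rare unless the labels are misleading. -/
lemma FinLaw.tail_le (hσ : Function.Involutive σ) (hv : ∀ k, v (σ k) = -v k) (B : ℝ) :
    ∑ k, A.w k * (if v k ≤ -B then 1 else 0) ≤ 4 * Real.exp (-B) + 4 * A.gapOf σ v := by
  rw [← sum_involutive hσ, A.gapOf_eq hσ hv]
  have h : ∀ k, A.w (σ k) * (if v (σ k) ≤ -B then 1 else 0) ≤
      2 * Real.exp (-B) * (A.w k + A.w (σ k)) +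
        2 * pairExcess (A.w k) (A.w (σ k)) (v k) := by
    intro k
    have h0 := A.nonneg k
    have h1 := A.nonneg (σ k)
    have h2 := pairExcess_nonneg h0 h1 (v k)
    split_ifs with hB
    · rw [hv, neg_le_neg_iff] at hB
      have h3 := le_exp_add_pairExcess h0 h1 (v k)
      have h4 : Real.exp (-v k) ≤ Real.exp (-B) := by gcongr
      nlinarith
    · rw [mul_zero]; positivity
  refine (Finset.sum_le_sum fun k _ => h k).trans (le_of_eq ?_)
  rw [Finset.sum_add_distrib, ← Finset.mul_sum, ← Finset.mul_sum, A.sum_pair hσ]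
  ring

end Labelled

/-! ### Quantization of a labelled law -/

section GridLaw

variable {M N : ℕ} {hM : 2 ≤ M} {hN : 0 < N}

/-- The information carried by a message, in nats. -/
abbrev msgInfo {Q : Quantizer} (a : FinLaw (Msg Q)) : ℝ := a.infoOf Neg.neg

/-- The score of a message, in nats. -/
abbrev msgScore (a : FinLaw (Msg (gridQuantizer M N hM hN))) : ℝ := a.scoreOf Msg.val

/-- The gap between the information and the score of a message. -/
abbrev msgGap (a : FinLaw (Msg (gridQuantizer M N hM hN))) : ℝ := a.gapOf Neg.neg Msg.val

lemma msgGap_nonneg (a : FinLaw (Msg (gridQuantizer M N hM hN))) : 0 ≤ msgGap a :=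
  a.gapOf_nonneg neg_involutive Msg.val_neg

variable {κ : Type*} [Fintype κ]

/-- Data processing: merging observations loses information. -/
lemma msgInfo_le_of_push {Q : Quantizer} {a : FinLaw (Msg Q)} {A : FinLaw κ} {σ : κ → κ}
    (hσ : Function.Involutive σ) {o : κ → Msg Q} (ho : ∀ k, o (σ k) = -o k)
    (hpush : ∀ f : Msg Q → ℝ, ∑ x, a.w x * f x = ∑ k, A.w k * f (o k)) :
    msgInfo a ≤ A.infoOf σ := by
  classical
  have hw : ∀ x, a.w x = ∑ k with o k = x, A.w k := fun x => by
    have := hpush fun y => if y = x then 1 else 0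
    simp only [mul_ite, mul_one, mul_zero, Finset.sum_ite_eq', Finset.mem_univ, if_true] at this
    rw [this, Finset.sum_filter]
  have hw' : ∀ x, a.w (-x) = ∑ k with o k = x, A.w (σ k) := fun x => by
    rw [hw, Finset.sum_filter, Finset.sum_filter,
      ← sum_involutive hσ fun k => if o k = -x then A.w k else 0]
    simp only [ho, neg_inj]
  unfold msgInfo FinLaw.infoOf
  gcongr
  calc ∑ x, pairInfo (a.w x) (a.w (-x))
      ≤ ∑ x, ∑ k with o k = x, pairInfo (A.w k) (A.w (σ k)) := by
        gcongr with x
        rw [hw, hw']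
        exact pairInfo_sum_le _ A.nonneg fun k => A.nonneg (σ k)
    _ = ∑ k, pairInfo (A.w k) (A.w (σ k)) :=
        Finset.sum_fiberwise Finset.univ o _

/-- The error of a single quantization step, apart from misleading labels: the step, the saturation
of positive values, and the four terms `e^{-(M - 1)}` of `FinLaw.tail_le`. -/
def gridLoss (M N : ℕ) : ℝ := 1 / N + 5 * Real.exp (-(M - 1))

lemma gridLoss_nonneg (M N : ℕ) : 0 ≤ gridLoss M N := by unfold gridLoss; positivity

lemma msgScore_ge_of_push {a : FinLaw (Msg (gridQuantizer M N hM hN))} {A : FinLaw κ} {σ : κ → κ}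
    (hσ : Function.Involutive σ) {v : κ → ℝ} (hv : ∀ k, v (σ k) = -v k)
    {o : κ → Msg (gridQuantizer M N hM hN)} (hval : ∀ k, (o k).val = gridFun M N (v k : ℝ))
    (hpush : ∀ f : Msg (gridQuantizer M N hM hN) → ℝ, ∑ x, a.w x * f x = ∑ k, A.w k * f (o k)) :
    A.scoreOf v - gridLoss M N - 4 * A.gapOf σ v ≤ msgScore a := by
  have h1 := A.tail_le hσ hv (M - 1)
  have h2 : ∀ k, A.w k * (Real.log 2 - logLoss (v k)) -
      A.w k * (1 / N + Real.exp (-(M - 1))) - A.w k * (if v k ≤ -(M - 1) then 1 else 0) ≤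
      A.w k * (Real.log 2 - logLoss (o k).val) := fun k => by
    rw [← mul_sub, ← mul_sub]
    refine mul_le_mul_of_nonneg_left ?_ (A.nonneg k)
    rw [hval]
    linarith [logLoss_gridFun_le hM hN (v k)]
  have h3 := Finset.sum_le_sum fun k (_ : k ∈ Finset.univ) => h2 k
  rw [Finset.sum_sub_distrib, Finset.sum_sub_distrib, ← Finset.sum_mul, A.sum_one, one_mul] at h3
  have h4 : msgScore a = ∑ k, A.w k * (Real.log 2 - logLoss (o k).val) :=
    hpush fun x => Real.log 2 - logLoss x.val
  rw [h4]
  unfold gridLoss FinLaw.scoreOf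
  linarith

end GridLaw

/-! ### The polar transform of a labelled law -/

section Transform

variable {ι : Type*} [Fintype ι]

/-- The law of two independent messages. -/
def FinLaw.prodLaw (a : FinLaw ι) : FinLaw (ι × ι) where
  w k := a.w k.1 * a.w k.2
  nonneg k := mul_nonneg (a.nonneg _) (a.nonneg _)
  sum_one := by
    rw [Fintype.sum_prod_type]
    simp only [← Finset.mul_sum, a.sum_one, mul_one]

variable [InvolutiveNeg ι]

/-- The law of two independent messages about bits whose sum is `0` but which are otherwise
uniform. -/
def FinLaw.checkLaw (a : FinLaw ι) : FinLaw (ι × ι) where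
  w k := (a.w k.1 * a.w k.2 + a.w (-k.1) * a.w (-k.2)) / 2
  nonneg k := div_nonneg (add_nonneg (mul_nonneg (a.nonneg _) (a.nonneg _))
    (mul_nonneg (a.nonneg _) (a.nonneg _))) (by norm_num)
  sum_one := by
    have h1 := a.prodLaw.sum_one
    have h2 := sum_involutive (κ := ι × ι) (σ := Neg.neg) neg_involutive a.prodLaw.w
    simp only [FinLaw.prodLaw, Prod.fst_neg, Prod.snd_neg] at h1 h2
    rw [← Finset.sum_div, Finset.sum_add_distrib, h2, h1]; norm_num

/-- The reflection of the observation of a check node. -/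
def negFst {ι : Type*} [Neg ι] (k : ι × ι) : ι × ι := (-k.1, k.2)

lemma negFst_involutive {ι : Type*} [InvolutiveNeg ι] :
    Function.Involutive (negFst : ι × ι → ι × ι) := fun k => by
  simp [negFst]

lemma sum_negFst (f : ι × ι → ℝ) : ∑ k, f (negFst k) = ∑ k, f k :=
  sum_involutive negFst_involutive f

variable (a : FinLaw ι)

lemma FinLaw.sum_checkLaw (f : ι × ι → ℝ) (hf : ∀ k, f (-k) = f k) :
    ∑ k, a.checkLaw.w k * f k = ∑ k, a.prodLaw.w k * f k := by
  have h := sum_involutive (κ := ι × ι) (σ := Neg.neg) neg_involutive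
    fun k => a.prodLaw.w k * f k
  have e : ∀ k, a.checkLaw.w k * f k =
      (a.prodLaw.w k * f k + a.prodLaw.w (-k) * f (-k)) / 2 := fun k => by
    rw [hf]; simp only [FinLaw.checkLaw, FinLaw.prodLaw, Prod.fst_neg, Prod.snd_neg]; ring
  simp only [e]
  rw [← Finset.sum_div, Finset.sum_add_distrib, h]; ring

lemma FinLaw.infoOf_checkLaw : a.checkLaw.infoOf negFst =
    (∑ k : ι × ι, pairInfo (a.w k.1 * a.w k.2 + a.w (-k.1) * a.w (-k.2))
      (a.w (-k.1) * a.w k.2 + a.w k.1 * a.w (-k.2))) / 4 := by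
  unfold FinLaw.infoOf
  have : ∀ k : ι × ι, pairInfo (a.checkLaw.w k) (a.checkLaw.w (negFst k)) =
      2⁻¹ * pairInfo (a.w k.1 * a.w k.2 + a.w (-k.1) * a.w (-k.2))
        (a.w (-k.1) * a.w k.2 + a.w k.1 * a.w (-k.2)) := fun k => by
    rw [← pairInfo_mul]
    simp only [FinLaw.checkLaw, negFst, neg_neg]
    congr 1 <;> ring
  simp only [this, ← Finset.mul_sum]
  ring

/-- The polar transform preserves information. -/
lemma FinLaw.infoOf_check_add_var :
    a.checkLaw.infoOf negFst + a.prodLaw.infoOf Neg.neg = 2 * a.infoOf Neg.neg := by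
  rw [FinLaw.infoOf_checkLaw]
  have h := Finset.sum_congr rfl fun (k : ι × ι) (_ : k ∈ Finset.univ) =>
    pairInfo_chain (a.w k.1) (a.w (-k.1)) (a.w k.2) (a.w (-k.2))
  rw [Finset.sum_add_distrib, Finset.sum_add_distrib, Finset.sum_add_distrib] at h
  have h1 := sum_negFst fun k : ι × ι => pairInfo (a.w k.1 * a.w k.2) (a.w (-k.1) * a.w (-k.2))
  simp only [negFst, neg_neg] at h1
  rw [h1] at h
  have hp : ∑ x, (a.w x + a.w (-x)) = 2 := a.sum_pair neg_involutive
  have h2 : ∑ k : ι × ι, (a.w k.2 + a.w (-k.2)) * pairInfo (a.w k.1) (a.w (-k.1)) =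
      2 * ∑ x, pairInfo (a.w x) (a.w (-x)) := by
    rw [Fintype.sum_prod_type_right, ← hp, Finset.sum_mul]
    simp only [Finset.mul_sum]
  have h3 : ∑ k : ι × ι, (a.w k.1 + a.w (-k.1)) * pairInfo (a.w k.2) (a.w (-k.2)) =
      2 * ∑ x, pairInfo (a.w x) (a.w (-x)) := by
    rw [Fintype.sum_prod_type, ← hp, Finset.sum_mul]
    simp only [Finset.mul_sum]
  rw [h2, h3] at h
  simp only [FinLaw.infoOf, FinLaw.prodLaw, Prod.fst_neg, Prod.snd_neg] at h ⊢
  linarith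

/-- The reliability of the hard decisions based on a message: the total variation distance of its
laws under the two inputs. -/
def FinLaw.tv : ℝ := (∑ x, |a.w x - a.w (-x)|) / 2

/-- A check node loses a fraction of the information unless hard decisions are reliable. -/
lemma FinLaw.infoOf_checkLaw_le : a.checkLaw.infoOf negFst ≤ a.tv * a.infoOf Neg.neg := by
  rw [FinLaw.infoOf_checkLaw]
  have h := Finset.sum_le_sum fun (k : ι × ι) (_ : k ∈ Finset.univ) =>
    pairInfo_check_le (a.nonneg k.1) (a.nonneg (-k.1)) (a.nonneg k.2) (a.nonneg (-k.2))
  have e : ∑ k : ι × ι, |a.w k.2 - a.w (-k.2)| * pairInfo (a.w k.1) (a.w (-k.1)) =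
      (∑ x, |a.w x - a.w (-x)|) * ∑ x, pairInfo (a.w x) (a.w (-x)) := by
    rw [Fintype.sum_prod_type_right, Finset.sum_mul_sum]
  rw [e] at h
  unfold FinLaw.tv FinLaw.infoOf
  linarith

/-- The Bhattacharyya parameter is small if hard decisions are reliable. -/
lemma FinLaw.sum_sqrt_le {l : ℝ} (hl : 0 < l) :
    ∑ x, √(a.w x * a.w (-x)) ≤ l + (1 - a.tv) / (2 * l) := by
  have h : ∀ x, √(a.w x * a.w (-x)) ≤ l / 2 * (a.w x + a.w (-x)) +
      (a.w x + a.w (-x)) / (4 * l) - |a.w x - a.w (-x)| / (4 * l) := fun x => by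
    have hp := a.nonneg x
    have hm := a.nonneg (-x)
    generalize a.w x = p at *
    generalize a.w (-x) = m at *
    set d := |p - m| with hd
    have hd0 : 0 ≤ d := abs_nonneg _
    have hds : d ≤ p + m := by rw [hd, abs_le]; constructor <;> linarith
    have hd2 : d ^ 2 = (p - m) ^ 2 := sq_abs _
    have e : l / 2 * (p + m) + (p + m) / (4 * l) - d / (4 * l) =
        (2 * l ^ 2 * (p + m) + (p + m - d)) / (4 * l) := by field_simp; ring
    rw [e]
    apply Real.sqrt_le_iff.2
    have h1 : 0 ≤ 2 * l ^ 2 * (p + m) + (p + m - d) := by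
      have : 0 ≤ 2 * l ^ 2 * (p + m) := by positivity
      linarith
    refine ⟨by positivity, ?_⟩
    rw [div_pow, le_div_iff₀ (by positivity)]
    have h2 : 4 * (p * m) ≤ 2 * (p + m) * (p + m - d) := by nlinarith
    have h3 := mul_le_mul_of_nonneg_left h2 (show 0 ≤ 4 * l ^ 2 by positivity)
    nlinarith [sq_nonneg (2 * l ^ 2 * (p + m) - (p + m - d))]
  refine (Finset.sum_le_sum fun x _ => h x).trans (le_of_eq ?_)
  have hp : ∑ x, (a.w x + a.w (-x)) = 2 := a.sum_pair neg_involutive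
  rw [Finset.sum_sub_distrib, Finset.sum_add_distrib, ← Finset.mul_sum, ← Finset.sum_div,
    ← Finset.sum_div, hp]
  unfold FinLaw.tv
  field_simp
  ring

/-- Reliable hard decisions carry information: Gibbs' inequality with the posteriors `15 / 16` and
`1 / 16`. -/
lemma FinLaw.half_le_infoOf (h : 1 - (4⁻¹ ^ 12) ^ 2 ≤ a.tv) : 1 / 2 ≤ a.infoOf Neg.neg := by
  have hlog : Real.log (15 / 8) ≥ 31 / 50 := by
    have h1 := Real.log_le_sub_one_of_pos (show (0 : ℝ) < 16 / 15 by norm_num)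
    have h2 : Real.log (15 / 8) = Real.log 2 - Real.log (16 / 15) := by
      rw [← Real.log_div (by norm_num) (by norm_num)]; norm_num
    linarith [Real.log_two_gt_d9]
  have hlog' : Real.log (1 / 8) ≥ -3 := by
    have h1 : Real.log (1 / 8) = -(3 * Real.log 2) := by
      rw [one_div, Real.log_inv, show (8 : ℝ) = 2 ^ 3 by norm_num, Real.log_pow]; norm_num
    linarith [Real.log_two_lt_d9]
  have hlog1 : Real.log (15 / 8) ≤ 1 := by
    linarith [Real.log_le_sub_one_of_pos (show (0 : ℝ) < 15 / 8 by norm_num)]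
  have key : ∀ x, (a.w x + a.w (-x) + |a.w x - a.w (-x)|) / 2 * (31 / 50) -
      (a.w x + a.w (-x) - |a.w x - a.w (-x)|) / 2 * 3 ≤ pairInfo (a.w x) (a.w (-x)) := fun x => by
    have hp := a.nonneg x
    have hm := a.nonneg (-x)
    generalize a.w x = p at *
    generalize a.w (-x) = m at *
    rcases le_total m p with hpm | hpm
    · rw [abs_of_nonneg (by linarith)]
      have := le_pairInfo hp hm (α := 15 / 8) (β := 1 / 8) (by norm_num) (by norm_num) (by norm_num)
      nlinarith
    · rw [abs_of_nonpos (by linarith)]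
      have := le_pairInfo hp hm (α := 1 / 8) (β := 15 / 8) (by norm_num) (by norm_num) (by norm_num)
      nlinarith
  have hsum := Finset.sum_le_sum fun x (_ : x ∈ Finset.univ) => key x
  have hp : ∑ x, (a.w x + a.w (-x)) = 2 := a.sum_pair neg_involutive
  rw [Finset.sum_sub_distrib, ← Finset.sum_mul, ← Finset.sum_mul, ← Finset.sum_div,
    ← Finset.sum_div, Finset.sum_add_distrib, Finset.sum_sub_distrib, hp] at hsum
  unfold FinLaw.tv at h
  unfold FinLaw.infoOf
  norm_num at h
  linarith

end Transform

/-! ### One decoding step with the uniform quantizer -/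

lemma checkReal_neg_left (x y : ℝ) : checkReal (-x) y = -checkReal x y := by
  unfold checkReal
  rw [neg_neg, neg_neg, ← Real.log_inv]
  congr 1
  rw [Real.exp_neg x]
  field_simp

lemma checkReal_comm (x y : ℝ) : checkReal x y = checkReal y x := by
  unfold checkReal; rw [add_comm, mul_comm]

lemma checkReal_neg_neg (x y : ℝ) : checkReal (-x) (-y) = checkReal x y := by
  rw [checkReal_neg_left, checkReal_comm, checkReal_neg_left, neg_neg, checkReal_comm]

lemma Msg.op_false_neg_neg {Q : Quantizer} (x y : Msg Q) :
    Msg.op false (-x) (-y) = Msg.op false x y := by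
  rw [Msg.op_false_neg_left, Msg.op_comm, Msg.op_false_neg_left, neg_neg, Msg.op_comm]

lemma sum_lawStep {Q : Quantizer} (b : Bool) (a : FinLaw (Msg Q)) (f : Msg Q → ℝ) :
    ∑ x, (lawStep Q b a).w x * f x = ∑ k, a.prodLaw.w k * f (Msg.op b k.1 k.2) := by
  rw [lawStep, FinLaw.sum_comb, Fintype.sum_prod_type]
  rfl

lemma sum_lawStep_false {Q : Quantizer} (a : FinLaw (Msg Q)) (f : Msg Q → ℝ) :
    ∑ x, (lawStep Q false a).w x * f x = ∑ k, a.checkLaw.w k * f (Msg.op false k.1 k.2) := by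
  rw [sum_lawStep, a.sum_checkLaw fun k => f (Msg.op false k.1 k.2)]
  intro k
  rw [Prod.fst_neg, Prod.snd_neg, Msg.op_false_neg_neg]

lemma msgInfo_check_le {Q : Quantizer} (a : FinLaw (Msg Q)) :
    msgInfo (lawStep Q false a) ≤ a.checkLaw.infoOf negFst :=
  msgInfo_le_of_push negFst_involutive (fun k => Msg.op_false_neg_left k.1 k.2)
    (sum_lawStep_false a)

lemma msgInfo_var_le {Q : Quantizer} (a : FinLaw (Msg Q)) :
    msgInfo (lawStep Q true a) ≤ a.prodLaw.infoOf Neg.neg :=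
  msgInfo_le_of_push neg_involutive (fun k => Msg.op_true_neg k.1 k.2) (sum_lawStep true a)

lemma msgInfo_step_le {Q : Quantizer} (a : FinLaw (Msg Q)) :
    msgInfo (lawStep Q false a) + msgInfo (lawStep Q true a) ≤ 2 * msgInfo a := by
  rw [← a.infoOf_check_add_var]
  exact add_le_add (msgInfo_check_le a) (msgInfo_var_le a)

section GridStep

variable {M N : ℕ} {hM : 2 ≤ M} {hN : 0 < N}

variable (a : FinLaw (Msg (gridQuantizer M N hM hN)))

lemma scoreOf_check_add_var :
    (a.checkLaw.scoreOf fun k => checkReal k.1.val k.2.val) +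
      (a.prodLaw.scoreOf fun k => k.1.val + k.2.val) = 2 * msgScore a := by
  unfold FinLaw.scoreOf
  rw [a.sum_checkLaw fun k => Real.log 2 - logLoss (checkReal k.1.val k.2.val),
    ← Finset.sum_add_distrib]
  · have e : ∀ k : Msg (gridQuantizer M N hM hN) × Msg (gridQuantizer M N hM hN),
        a.prodLaw.w k * (Real.log 2 - logLoss (checkReal k.1.val k.2.val)) +
          a.prodLaw.w k * (Real.log 2 - logLoss (k.1.val + k.2.val)) =
        a.w k.1 * (Real.log 2 - logLoss k.1.val) * a.w k.2 +
          a.w k.1 * (a.w k.2 * (Real.log 2 - logLoss k.2.val)) := fun k => by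
      simp only [FinLaw.prodLaw]
      linear_combination (-(a.w k.1 * a.w k.2)) * logLoss_check_add_var k.1.val k.2.val
    simp only [e]
    rw [Finset.sum_add_distrib, Fintype.sum_prod_type, Fintype.sum_prod_type]
    simp only [← Finset.mul_sum, a.sum_one, mul_one, ← Finset.sum_mul]
    unfold msgScore FinLaw.scoreOf
    ring
  · intro k
    simp only [Prod.fst_neg, Prod.snd_neg, Msg.val_neg, checkReal_neg_neg]

lemma gapOf_check_add_var :
    (a.checkLaw.gapOf negFst fun k => checkReal k.1.val k.2.val) +
      (a.prodLaw.gapOf Neg.neg fun k => k.1.val + k.2.val) = 2 * msgGap a := by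
  have h1 := a.infoOf_check_add_var
  have h2 := scoreOf_check_add_var a
  unfold msgGap FinLaw.gapOf
  linarith

lemma msgScore_check_ge :
    (a.checkLaw.scoreOf fun k => checkReal k.1.val k.2.val) - gridLoss M N -
      4 * (a.checkLaw.gapOf negFst fun k => checkReal k.1.val k.2.val) ≤
      msgScore (lawStep _ false a) :=
  msgScore_ge_of_push negFst_involutive
    (fun k => by simp only [negFst, Msg.val_neg, checkReal_neg_left])
    (fun k => Msg.val_op false k.1 k.2) (sum_lawStep_false a)

lemma msgScore_var_ge :
    (a.prodLaw.scoreOf fun k => k.1.val + k.2.val) - gridLoss M N -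
      4 * (a.prodLaw.gapOf Neg.neg fun k => k.1.val + k.2.val) ≤
      msgScore (lawStep _ true a) :=
  msgScore_ge_of_push neg_involutive
    (fun k => by simp only [Prod.fst_neg, Prod.snd_neg, Msg.val_neg]; ring)
    (fun k => Msg.val_op true k.1 k.2) (sum_lawStep true a)

lemma msgScore_step_ge : msgScore a - gridLoss M N - 4 * msgGap a ≤
    (msgScore (lawStep _ false a) + msgScore (lawStep _ true a)) / 2 := by
  linarith [msgScore_check_ge a, msgScore_var_ge a, scoreOf_check_add_var a, gapOf_check_add_var a]

lemma msgGap_step_le : (msgGap (lawStep _ false a) + msgGap (lawStep _ true a)) / 2 ≤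
    5 * msgGap a + gridLoss M N := by
  have h1 := msgScore_step_ge a
  have h2 := msgInfo_step_le a
  unfold msgGap FinLaw.gapOf at *
  linarith

/-! ### The Bhattacharyya weight of the uniform quantizer -/

/-- The mean Bhattacharyya weight of a message. -/
def msgWeight : ℝ := ∑ x, a.w x * x.weight

lemma msgWeight_nonneg : 0 ≤ msgWeight a :=
  Finset.sum_nonneg fun x _ => mul_nonneg (a.nonneg x) x.weight_nonneg

lemma bitErr_le_msgWeight : bitErr a ≤ msgWeight a := by
  unfold bitErr msgWeight
  gcongr with x
  · exact a.nonneg x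
  have h0 := x.weight_nonneg
  rw [← x.coe_val]
  split_ifs with h1 h2
  · exact Msg.one_le_weight (EReal.coe_neg'.1 h1).le
  · linarith [Msg.one_le_weight (EReal.coe_eq_zero.1 h2).le]
  · exact h0

lemma sum_prodLaw_left {ι : Type*} [Fintype ι] (a : FinLaw ι) (f : ι → ℝ) :
    ∑ k, a.prodLaw.w k * f k.1 = ∑ x, a.w x * f x := by
  rw [Fintype.sum_prod_type]
  refine Finset.sum_congr rfl fun x _ => ?_
  simp only [FinLaw.prodLaw]
  rw [← Finset.sum_mul, ← Finset.mul_sum, a.sum_one, mul_one]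

lemma sum_prodLaw_right {ι : Type*} [Fintype ι] (a : FinLaw ι) (f : ι → ℝ) :
    ∑ k, a.prodLaw.w k * f k.2 = ∑ x, a.w x * f x := by
  rw [Fintype.sum_prod_type_right]
  refine Finset.sum_congr rfl fun x _ => ?_
  simp only [FinLaw.prodLaw]
  rw [← Finset.sum_mul, ← Finset.sum_mul, a.sum_one, one_mul]

lemma msgWeight_check_le : msgWeight (lawStep _ false a) ≤ 5 * msgWeight a := by
  unfold msgWeight
  rw [sum_lawStep]
  calc _ ≤ ∑ k, (5 / 2 * (a.prodLaw.w k * k.1.weight) + 5 / 2 * (a.prodLaw.w k * k.2.weight)) := by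
        refine Finset.sum_le_sum fun k _ => ?_
        have := mul_le_mul_of_nonneg_left (Msg.weight_check_le k.1 k.2) (a.prodLaw.nonneg k)
        linarith
    _ = _ := by
        rw [Finset.sum_add_distrib, ← Finset.mul_sum, ← Finset.mul_sum,
          sum_prodLaw_left a Msg.weight, sum_prodLaw_right a Msg.weight]
        ring

lemma msgWeight_var_le : msgWeight (lawStep _ true a) ≤
    Real.exp (1 / 2) * (msgWeight a ^ 2 + 2 * Real.exp (-M / 2) * msgWeight a) := by
  have hsq : ∑ k, a.prodLaw.w k * (k.1.weight * k.2.weight) = msgWeight a ^ 2 := by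
    rw [sq]
    unfold msgWeight
    rw [Finset.sum_mul_sum, Fintype.sum_prod_type]
    refine Finset.sum_congr rfl fun x _ => Finset.sum_congr rfl fun y _ => ?_
    simp only [FinLaw.prodLaw]; ring
  rw [← hsq]
  unfold msgWeight
  rw [sum_lawStep]
  calc _ ≤ ∑ k, Real.exp (1 / 2) * (a.prodLaw.w k * (k.1.weight * k.2.weight) +
        (Real.exp (-M / 2) * (a.prodLaw.w k * k.1.weight) +
          Real.exp (-M / 2) * (a.prodLaw.w k * k.2.weight))) := by
        refine Finset.sum_le_sum fun k _ => ?_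
        have := mul_le_mul_of_nonneg_left (Msg.weight_var_le k.1 k.2) (a.prodLaw.nonneg k)
        linarith
    _ = _ := by
        rw [← Finset.mul_sum, Finset.sum_add_distrib, Finset.sum_add_distrib, ← Finset.mul_sum,
          ← Finset.mul_sum, sum_prodLaw_left a Msg.weight, sum_prodLaw_right a Msg.weight]
        ring

lemma exp_neg_half_le (h : 28 ≤ M) : Real.exp (-M / 2) ≤ 4⁻¹ ^ 10 := by
  have h' : (28 : ℝ) ≤ M := by exact_mod_cast h
  have h1 : (4 : ℝ) ^ 10 ≤ Real.exp 14 := by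
    calc (4 : ℝ) ^ 10 ≤ 2.7182818283 ^ 14 := by norm_num
      _ ≤ Real.exp 1 ^ 14 := by gcongr; exact Real.exp_one_gt_d9.le
      _ = Real.exp 14 := by rw [← Real.exp_nat_mul]; norm_num
  calc Real.exp (-M / 2) ≤ Real.exp (-14) := by gcongr; linarith
    _ = (Real.exp 14)⁻¹ := Real.exp_neg _
    _ ≤ (4 ^ 10)⁻¹ := by gcongr
    _ = _ := by norm_num

/-- A variable node multiplies small weights by a small factor. -/
lemma msgWeight_var_le_mul (h : 28 ≤ M) (hz : msgWeight a ≤ 4⁻¹ ^ 9) :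
    msgWeight (lawStep _ true a) ≤ 4⁻¹ ^ 8 * msgWeight a := by
  have h0 := msgWeight_nonneg a
  have h1 := exp_neg_half_le h
  refine (msgWeight_var_le a).trans ?_
  calc _ ≤ 33 / 20 * (4⁻¹ ^ 9 * msgWeight a + 2 * 4⁻¹ ^ 10 * msgWeight a) := by
        gcongr
        · exact exp_half_le
        · rw [sq]; gcongr
    _ ≤ _ := by norm_num; linarith

/-- The weight is small if hard decisions are reliable and the labels are accurate. -/
lemma msgWeight_le (l : ℝ) (hl : 0 < l) : msgWeight a ≤
    l + (1 - a.tv) / (2 * l) + 2 * Real.exp (M / 2) * msgGap a := by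
  have h1 : msgWeight a ≤ ∑ x, a.w x * Real.exp (-x.val / 2) := by
    unfold msgWeight
    gcongr with x
    · exact a.nonneg x
    · exact x.weight_le
  have h2 : ∑ x, a.w x * Real.exp (-x.val / 2) = (∑ x, (a.w x * Real.exp (-x.val / 2) +
      a.w (-x) * Real.exp (x.val / 2))) / 2 := by
    have := sum_involutive (κ := Msg (gridQuantizer M N hM hN)) (σ := Neg.neg) neg_involutive
      fun x => a.w x * Real.exp (-x.val / 2)
    simp only [Msg.val_neg, neg_neg] at this
    rw [Finset.sum_add_distrib, this]; ring
  have h3 : ∀ x, a.w x * Real.exp (-x.val / 2) + a.w (-x) * Real.exp (x.val / 2) ≤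
      2 * √(a.w x * a.w (-x)) +
        2 * Real.exp (M / 2) * pairExcess (a.w x) (a.w (-x)) x.val := fun x => by
    refine (weight_le_pairExcess (a.nonneg x) (a.nonneg (-x)) x.val).trans ?_
    have := abs_le.1 x.abs_val_le
    have e1 : Real.exp (-x.val / 2) ≤ Real.exp (M / 2) := by gcongr; linarith
    have e2 : Real.exp (x.val / 2) ≤ Real.exp (M / 2) := by gcongr; linarith
    gcongr
    · exact pairExcess_nonneg (a.nonneg x) (a.nonneg (-x)) _
    · linarith
  have h4 := Finset.sum_le_sum fun x (_ : x ∈ Finset.univ) => h3 x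
  rw [Finset.sum_add_distrib (f := fun x => 2 * √(a.w x * a.w (-x))), ← Finset.mul_sum,
    ← Finset.mul_sum] at h4
  have h5 := a.sum_sqrt_le hl
  have h6 : msgGap a = _ := a.gapOf_eq neg_involutive Msg.val_neg
  rw [h6]
  linarith

/-! ### Polarization with the uniform quantizer -/

/-- The potential that contracts: it is small if the information is small or if the weight is. The
weight is normalized by the threshold of `msgWeight_var_le_mul`. -/
def msgPotential : ℝ := min √(msgInfo a) ((msgWeight a / 4⁻¹ ^ 9) ^ (1 / 8 : ℝ))

lemma msgInfo_nonneg {Q : Quantizer} (a : FinLaw (Msg Q)) : 0 ≤ msgInfo a := a.infoOf_nonneg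

lemma msgInfo_le_one {Q : Quantizer} (a : FinLaw (Msg Q)) : msgInfo a ≤ 1 :=
  (a.infoOf_le neg_involutive).trans (by linarith [Real.log_two_lt_d9])

lemma msgPotential_nonneg : 0 ≤ msgPotential a :=
  le_min (Real.sqrt_nonneg _) (Real.rpow_nonneg (div_nonneg (msgWeight_nonneg a) (by norm_num)) _)

lemma msgPotential_le_one : msgPotential a ≤ 1 :=
  (min_le_left _ _).trans (Real.sqrt_le_one.2 (msgInfo_le_one a))

/-- The factor by which the potential contracts, from `sqrt_average_le` for a fraction
`(4⁻¹ ^ 12) ^ 2` of the information lost by a check node. -/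
def contraction : ℝ := 1 - ((4⁻¹ ^ 12) ^ 2) ^ 2 / 8

/-- The root of a quantity that is preserved on average, but changes by a fixed fraction, contracts
on average. -/
lemma sqrt_average_le {c x y z : ℝ} (hc : 0 ≤ c) (hc1 : c ≤ 1) (hx : 0 ≤ x) (hy : 0 ≤ y)
    (hxz : x ≤ (1 - c) * z) (hxy : x + y ≤ 2 * z) :
    (√x + √y) / 2 ≤ (1 - c ^ 2 / 8) * √z := by
  have hz : 0 ≤ z := by linarith
  have h1 : √x * √y ≤ (1 - c ^ 2 / 2) * z := by
    rw [← Real.sqrt_mul hx]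
    apply Real.sqrt_le_iff.2
    refine ⟨mul_nonneg (by nlinarith) hz, ?_⟩
    have : c ^ 2 * z ^ 2 ≤ (z - x) ^ 2 := by
      rw [← mul_pow]
      exact pow_le_pow_left₀ (by positivity) (by linarith) 2
    nlinarith [mul_nonneg hx hy, sq_nonneg (c ^ 2 * z), mul_le_mul_of_nonneg_left hxy hx]
  have h2 : (√x + √y) / 2 ≤ √(((1 - c ^ 2 / 8) * √z) ^ 2) := by
    apply Real.le_sqrt_of_sq_le
    have a1 := Real.sq_sqrt hx
    have a2 := Real.sq_sqrt hy
    have a3 := Real.sq_sqrt hz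
    rw [mul_pow, a3]
    nlinarith [mul_nonneg (sq_nonneg (c ^ 2)) hz]
  rwa [Real.sqrt_sq (mul_nonneg (by nlinarith) (Real.sqrt_nonneg _))] at h2

/-- The potential contracts on average, up to the gap. If hard decisions are unreliable, the root of
the information contracts at least as well; otherwise the weight is small and contracts. -/
lemma msgPotential_step_le (h28 : 28 ≤ M) :
    (msgPotential (lawStep _ false a) + msgPotential (lawStep _ true a)) / 2 ≤
      contraction * msgPotential a +
        4 * 4 ^ 12 * Real.exp (M / 2) * msgGap a := by
  have hgap := msgGap_nonneg a
  have herr : 0 ≤ 4 * 4 ^ 12 * Real.exp (M / 2) * msgGap a := by positivity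
  have hI0 := msgInfo_nonneg a
  have hI1 := msgInfo_le_one a
  have hZ0 := msgWeight_nonneg a
  -- small weights contract
  have hsmall : msgWeight a ≤ 4⁻¹ ^ 9 →
      (msgPotential (lawStep _ false a) + msgPotential (lawStep _ true a)) / 2 ≤
        contraction * (msgWeight a / 4⁻¹ ^ 9) ^ (1 / 8 : ℝ) := by
    intro hz
    have h1 := rpow_average_le (z := msgWeight a / 4⁻¹ ^ 9)
      (z₀ := msgWeight (lawStep _ false a) / 4⁻¹ ^ 9)
      (z₁ := msgWeight (lawStep _ true a) / 4⁻¹ ^ 9) (by positivity)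
      (div_nonneg (msgWeight_nonneg _) (by norm_num))
      (div_nonneg (msgWeight_nonneg _) (by norm_num))
      (by rw [mul_div_assoc']; gcongr; exact msgWeight_check_le a)
      (by rw [mul_div_assoc']; gcongr; exact msgWeight_var_le_mul a h28 hz)
    have h2 : 3 / 4 * (msgWeight a / 4⁻¹ ^ 9) ^ (1 / 8 : ℝ) ≤
        contraction * (msgWeight a / 4⁻¹ ^ 9) ^ (1 / 8 : ℝ) := by
      gcongr
      norm_num [contraction]
    refine le_trans ?_ (h1.trans h2)
    gcongr
    · exact min_le_right _ _
    · exact min_le_right _ _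
  rcases le_or_gt a.tv (1 - (4⁻¹ ^ 12) ^ 2) with htv | htv
  · have h1 : (msgPotential (lawStep _ false a) + msgPotential (lawStep _ true a)) / 2 ≤
        contraction * √(msgInfo a) := by
      refine le_trans ?_ (sqrt_average_le (c := (4⁻¹ ^ 12) ^ 2) (by norm_num) (by norm_num)
        (msgInfo_nonneg (lawStep _ false a)) (msgInfo_nonneg (lawStep _ true a)) ?_
        (msgInfo_step_le a))
      · gcongr
        · exact min_le_left _ _
        · exact min_le_left _ _
      · exact ((msgInfo_check_le a).trans a.infoOf_checkLaw_le).trans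
          (mul_le_mul_of_nonneg_right htv hI0)
    rcases le_or_gt (msgWeight a) (4⁻¹ ^ 9) with hz | hz
    · rcases min_choice √(msgInfo a) ((msgWeight a / 4⁻¹ ^ 9) ^ (1 / 8 : ℝ)) with h | h
      · have h' : msgPotential a = _ := h
        rw [h']; linarith
      · have h' : msgPotential a = _ := h
        rw [h']; linarith [hsmall hz]
    · have : msgPotential a = √(msgInfo a) := by
        refine min_eq_left ((Real.sqrt_le_one.2 hI1).trans ?_)
        refine Real.one_le_rpow ?_ (by norm_num)
        rw [one_le_div (by norm_num)]
        exact hz.le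
      rw [this]; linarith
  · rcases le_or_gt (4 * 4 ^ 12 * Real.exp (M / 2) * msgGap a) 1 with hK | hK
    · -- reliable hard decisions and accurate labels make the weight small
      have hz : msgWeight a ≤ 2 * 4⁻¹ ^ 12 := by
        have h1 := msgWeight_le a (4⁻¹ ^ 12) (by norm_num)
        have h2 : (1 - a.tv) / (2 * 4⁻¹ ^ 12) ≤ (4⁻¹ ^ 12) ^ 2 / (2 * 4⁻¹ ^ 12) := by
          gcongr; linarith
        have h3 : (4⁻¹ ^ 12) ^ 2 / (2 * 4⁻¹ ^ 12) = (4⁻¹ ^ 12 / 2 : ℝ) := by norm_num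
        have h4 : 2 * Real.exp (M / 2) * msgGap a ≤ 4⁻¹ ^ 12 / 2 := by
          norm_num at hK ⊢; linarith
        linarith
      have hI := a.half_le_infoOf htv.le
      have : msgPotential a = (msgWeight a / 4⁻¹ ^ 9) ^ (1 / 8 : ℝ) := by
        refine min_eq_right ?_
        calc (msgWeight a / 4⁻¹ ^ 9) ^ (1 / 8 : ℝ) ≤ ((1 / 2) ^ (4 : ℝ)) ^ (1 / 8 : ℝ) := by
              gcongr
              rw [div_le_iff₀ (by norm_num)]
              refine hz.trans ?_
              norm_num
          _ = √(1 / 2) := by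
              rw [← Real.rpow_mul (by norm_num), Real.sqrt_eq_rpow]; norm_num
          _ ≤ √(msgInfo a) := Real.sqrt_le_sqrt hI
      rw [this]
      linarith [hsmall (hz.trans (by norm_num))]
    · have h1 := msgPotential_le_one (lawStep _ false a)
      have h2 := msgPotential_le_one (lawStep _ true a)
      have h3 : 0 ≤ contraction * msgPotential a :=
        mul_nonneg (by norm_num [contraction]) (msgPotential_nonneg a)
      linarith

end GridStep

/-! ### The capacity of a symmetric channel -/

lemma klDiv_eq_lintegral_density {Y : Type*} [MeasurableSpace Y] {ν₁ ν₂ μ : Measure Y}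
    [IsFiniteMeasure ν₁] [IsFiniteMeasure ν₂] [IsFiniteMeasure μ] (h₁ : ν₁ ≪ ν₂) (h₂ : ν₂ ≪ μ) :
    InformationTheory.klDiv ν₁ ν₂ = ∫⁻ y, ENNReal.ofReal ((ν₂.rnDeriv μ y).toReal *
      InformationTheory.klFun ((ν₁.rnDeriv μ y).toReal / (ν₂.rnDeriv μ y).toReal)) ∂μ := by
  rw [InformationTheory.klDiv_eq_lintegral_klFun_of_ac h₁, ← lintegral_rnDeriv_mul h₂]
  · refine lintegral_congr_ae ?_
    filter_upwards [Measure.rnDeriv_mul_rnDeriv (κ := μ) h₁, Measure.rnDeriv_lt_top ν₂ μ]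
      with y hy hlt
    rw [← hy, Pi.mul_apply, ENNReal.toReal_mul, ENNReal.ofReal_mul ENNReal.toReal_nonneg,
      ENNReal.ofReal_toReal hlt.ne]
    rcases eq_or_ne (ν₂.rnDeriv μ y) 0 with h0 | h0
    · rw [h0, zero_mul, zero_mul]
    · rw [mul_div_cancel_right₀ _ (ENNReal.toReal_pos h0 hlt.ne).ne']
  · exact (InformationTheory.measurable_klFun.comp
      (Measure.measurable_rnDeriv _ _).ennreal_toReal).ennreal_ofReal.aemeasurable

section Channel

variable {Y : Type*} [MeasurableSpace Y] (W : BMSChannel Y)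

/-- The density of the output under input `x` with respect to the sum of both output laws. -/
def BMSChannel.dens (x : ZMod 2) (y : Y) : ℝ :=
  ((W.law x).rnDeriv (W.law 0 + W.law 1) y).toReal

lemma BMSChannel.measurable_dens (x : ZMod 2) : Measurable (W.dens x) :=
  (Measure.measurable_rnDeriv _ _).ennreal_toReal

lemma BMSChannel.dens_nonneg (x : ZMod 2) (y : Y) : 0 ≤ W.dens x y := ENNReal.toReal_nonneg

lemma BMSChannel.law_ac (x : ZMod 2) : W.law x ≪ W.law 0 + W.law 1 := by
  rcases zmod_two_cases x with rfl | rfl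
  · exact Measure.absolutelyContinuous_of_le (Measure.le_add_right le_rfl)
  · exact Measure.absolutelyContinuous_of_le (Measure.le_add_left le_rfl)

lemma BMSChannel.dens_add : ∀ᵐ y ∂(W.law 0 + W.law 1), W.dens 0 y + W.dens 1 y = 1 := by
  filter_upwards [W.density_sum] with y hy
  unfold BMSChannel.dens
  rw [← ENNReal.toReal_add, hy, ENNReal.toReal_one]
  · intro h; simp [h] at hy
  · intro h; simp [h] at hy

lemma BMSChannel.integral_dens_mul (x : ZMod 2) (f : Y → ℝ) :
    ∫ y, W.dens x y * f y ∂(W.law 0 + W.law 1) = ∫ y, f y ∂(W.law x) :=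
  integral_toReal_rnDeriv_mul (W.law_ac x)

/-- The posterior probability of the bit `0`, as a function of the log-likelihood ratio. -/
def posterior (x : EReal) : ℝ :=
  if x = ⊤ then 1 else if x = ⊥ then 0 else (1 + Real.exp (-x.toReal))⁻¹

lemma posterior_log_div {f g : ℝ≥0∞} (h : f + g = 1) :
    posterior (ENNReal.log (f / g)) = f.toReal := by
  have hf : f ≠ ⊤ := by rintro rfl; simp at h
  have hg : g ≠ ⊤ := by rintro rfl; simp at h
  have hs : f.toReal + g.toReal = 1 := by
    rw [← ENNReal.toReal_add hf hg, h, ENNReal.toReal_one]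
  rcases eq_or_ne g 0 with rfl | hg0
  · rw [add_zero] at h
    simp [posterior, h]
  rcases eq_or_ne f 0 with rfl | hf0
  · simp [posterior]
  have hfp := ENNReal.toReal_pos hf0 hf
  have hgp := ENNReal.toReal_pos hg0 hg
  rw [ENNReal.log_pos_real (ENNReal.div_ne_zero.2 ⟨hf0, hg⟩) (ENNReal.div_ne_top hf hg0)]
  simp only [posterior, EReal.coe_ne_top, EReal.coe_ne_bot, if_false, EReal.toReal_coe]
  rw [ENNReal.toReal_div, Real.exp_neg, Real.exp_log (by positivity)]
  field_simp
  linarith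

lemma BMSChannel.posterior_llr :
    ∀ᵐ y ∂(W.law 0 + W.law 1), posterior (W.llr y) = W.dens 0 y := by
  filter_upwards [W.density_sum] with y hy using posterior_log_div hy

lemma BMSChannel.posterior_neg_llr :
    ∀ᵐ y ∂(W.law 0 + W.law 1), posterior (-W.llr y) = W.dens 1 y := by
  filter_upwards [W.density_sum] with y hy
  have h1 : (W.law 1).rnDeriv (W.law 0 + W.law 1) y ≠ ⊤ := fun h => by simp [h] at hy
  rw [BMSChannel.llr, ← ENNReal.log_inv, ENNReal.inv_div (Or.inl h1)
    (by by_contra! h; simp [h] at hy)]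
  exact posterior_log_div (by rw [add_comm]; exact hy)

/-- The mutual information, in nats, between a uniform input and the output. -/
def BMSChannel.symInfo : ℝ := ∫ y, W.dens 0 y * Real.log (2 * W.dens 0 y) ∂(W.law 0 + W.law 1)

lemma BMSChannel.symInfo_eq :
    W.symInfo = ∫ y, W.dens 1 y * Real.log (2 * W.dens 1 y) ∂(W.law 0 + W.law 1) := by
  obtain ⟨π, hm, h01, h⟩ := W.exists_symm
  have hlog : Measurable fun y => Real.log (2 * W.dens 1 y) :=
    Real.measurable_log.comp ((W.measurable_dens 1).const_mul 2)
  rw [BMSChannel.symInfo, W.integral_dens_mul, W.integral_dens_mul, ← h01,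
    integral_map hm.aemeasurable hlog.aestronglyMeasurable]
  refine integral_congr_ae ?_
  have h1 : ∀ᵐ y ∂(W.law 0), posterior (-W.llr (π y)) = W.dens 1 (π y) :=
    ae_of_ae_map hm.aemeasurable (by rw [h01]; exact (ae_add_measure_iff.1 W.posterior_neg_llr).2)
  filter_upwards [h1, (ae_add_measure_iff.1 h).1, (ae_add_measure_iff.1 W.posterior_llr).1]
    with y h1 h2 h3
  rw [← h1, h2, neg_neg, h3]

lemma abs_mul_log_two_le {f : ℝ} (h0 : 0 ≤ f) (h1 : f ≤ 1) : |f * Real.log (2 * f)| ≤ 1 := by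
  rcases h0.eq_or_lt with rfl | h0
  · simp
  have h2 := Real.log_le_sub_one_of_pos (show 0 < 2 * f by linarith)
  have h3 := Real.log_le_sub_one_of_pos (show 0 < (2 * f)⁻¹ by positivity)
  rw [Real.log_inv] at h3
  have h4 : f * (2 * f)⁻¹ = 1 / 2 := by field_simp
  rw [abs_le]
  constructor <;> nlinarith

lemma BMSChannel.integrable_dens (x : ZMod 2) : Integrable (W.dens x) (W.law 0 + W.law 1) :=
  Measure.integrable_toReal_rnDeriv

lemma BMSChannel.dens_le_one (x : ZMod 2) : ∀ᵐ y ∂(W.law 0 + W.law 1), W.dens x y ≤ 1 := by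
  filter_upwards [W.dens_add] with y hy
  rcases zmod_two_cases x with rfl | rfl
  · linarith [W.dens_nonneg 1 y]
  · linarith [W.dens_nonneg 0 y]

lemma BMSChannel.integrable_dens_mul_log (x : ZMod 2) :
    Integrable (fun y => W.dens x y * Real.log (2 * W.dens x y)) (W.law 0 + W.law 1) := by
  refine Integrable.of_bound (C := 1) ?_ ?_
  · exact ((W.measurable_dens x).mul
      (Real.measurable_log.comp ((W.measurable_dens x).const_mul 2))).aestronglyMeasurable
  · filter_upwards [W.dens_le_one x] with y hy
    exact abs_mul_log_two_le (W.dens_nonneg x y) hy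

lemma BMSChannel.integral_dens (x : ZMod 2) : ∫ y, W.dens x y ∂(W.law 0 + W.law 1) = 1 := by
  have := W.integral_dens_mul x 1
  simpa using this

/-- Gibbs' inequality for the output law, compared with the output law under a uniform input. -/
lemma klFun_sum_le {t f g : ℝ} (ht : 0 < t) (ht1 : t < 1) (hf : 0 ≤ f) (hg : 0 ≤ g)
    (h : f + g = 1) :
    t * ((t * f + (1 - t) * g) * InformationTheory.klFun (f / (t * f + (1 - t) * g))) +
      (1 - t) * ((t * f + (1 - t) * g) * InformationTheory.klFun (g / (t * f + (1 - t) * g))) ≤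
      t * (f * Real.log (2 * f)) + (1 - t) * (g * Real.log (2 * g)) +
        (1 / 2 - (t * f + (1 - t) * g)) := by
  have hq : 0 < t * f + (1 - t) * g := by
    rcases hf.eq_or_lt with rfl | hf
    · have : g = 1 := by linarith
      subst this; linarith
    · have := mul_pos ht hf
      have := mul_nonneg (show 0 ≤ 1 - t by linarith) hg
      linarith
  set q := t * f + (1 - t) * g with hqdef
  have key : ∀ z : ℝ, 0 ≤ z → q * InformationTheory.klFun (z / q) =
      z * Real.log (2 * z) - z * Real.log (2 * q) + q - z := by
    intro z hz
    unfold InformationTheory.klFun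
    rcases hz.eq_or_lt with rfl | hz
    · simp
    rw [Real.log_div hz.ne' hq.ne', Real.log_mul two_ne_zero hz.ne',
      Real.log_mul two_ne_zero hq.ne']
    field_simp
    ring
  rw [key f hf, key g hg]
  have h1 := Real.log_le_sub_one_of_pos (show 0 < (2 * q)⁻¹ by positivity)
  rw [Real.log_inv] at h1
  have h2 : q * (2 * q)⁻¹ = 1 / 2 := by field_simp
  have h3 := mul_le_mul_of_nonneg_left h1 hq.le
  rw [mul_sub, h2] at h3
  have e : t * (f * Real.log (2 * q)) + (1 - t) * (g * Real.log (2 * q)) =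
    q * Real.log (2 * q) := by rw [hqdef]; ring
  nlinarith

lemma BMSChannel.mutualInfo_le (t : unitInterval) :
    W.mutualInfo t ≤ ENNReal.ofReal W.symInfo := by
  obtain ⟨t, ht⟩ := t
  unfold BMSChannel.mutualInfo
  simp only
  rcases ht.1.eq_or_lt with rfl | ht0
  · simp
  rcases ht.2.eq_or_lt with rfl | ht1
  · simp
  set μ := W.law 0 + W.law 1 with hμ
  have hc0 : ENNReal.ofReal t ≠ 0 := by simpa using ht0
  have hc1 : ENNReal.ofReal (1 - t) ≠ 0 := by simpa using ht1
  set out : Measure Y := ENNReal.ofReal t • W.law 0 + ENNReal.ofReal (1 - t) • W.law 1 with hout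
  have hfin0 : IsFiniteMeasure (ENNReal.ofReal t • W.law 0) := Measure.smul_finite _ (by simp)
  have hfin1 : IsFiniteMeasure (ENNReal.ofReal (1 - t) • W.law 1) := Measure.smul_finite _ (by simp)
  have hac0 : W.law 0 ≪ out :=
    (Measure.absolutelyContinuous_smul hc0).trans
      (Measure.absolutelyContinuous_of_le (Measure.le_add_right le_rfl))
  have hac1 : W.law 1 ≪ out :=
    (Measure.absolutelyContinuous_smul hc1).trans
      (Measure.absolutelyContinuous_of_le (Measure.le_add_left le_rfl))
  have hacμ : out ≪ μ :=
    Measure.AbsolutelyContinuous.add_left ((W.law_ac 0).smul_left _) ((W.law_ac 1).smul_left _)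
  have hd : ∀ᵐ y ∂μ, (out.rnDeriv μ y).toReal = t * W.dens 0 y + (1 - t) * W.dens 1 y := by
    filter_upwards [Measure.rnDeriv_add (ENNReal.ofReal t • W.law 0)
      (ENNReal.ofReal (1 - t) • W.law 1) μ,
      Measure.rnDeriv_smul_left_of_ne_top (W.law 0) μ (r := ENNReal.ofReal t) (by simp),
      Measure.rnDeriv_smul_left_of_ne_top (W.law 1) μ (r := ENNReal.ofReal (1 - t)) (by simp),
      Measure.rnDeriv_lt_top (W.law 0) μ, Measure.rnDeriv_lt_top (W.law 1) μ] with y h1 h2 h3 h4 h5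
    rw [hout, h1, Pi.add_apply, h2, h3, Pi.smul_apply, Pi.smul_apply, smul_eq_mul, smul_eq_mul,
      ENNReal.toReal_add (ENNReal.mul_ne_top (by simp) h4.ne) (ENNReal.mul_ne_top (by simp) h5.ne),
      ENNReal.toReal_mul, ENNReal.toReal_mul, ENNReal.toReal_ofReal ht0.le,
      ENNReal.toReal_ofReal (by linarith)]
    rfl
  have hmeas : ∀ x, Measurable fun y => (out.rnDeriv μ y).toReal *
      InformationTheory.klFun (W.dens x y / (out.rnDeriv μ y).toReal) := fun x =>
    (Measure.measurable_rnDeriv _ _).ennreal_toReal.mul (InformationTheory.measurable_klFun.comp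
      ((W.measurable_dens x).div (Measure.measurable_rnDeriv _ _).ennreal_toReal))
  have hkl0 : InformationTheory.klDiv (W.law 0) out = ∫⁻ y, ENNReal.ofReal
      ((out.rnDeriv μ y).toReal * InformationTheory.klFun
        (W.dens 0 y / (out.rnDeriv μ y).toReal)) ∂μ := klDiv_eq_lintegral_density hac0 hacμ
  have hkl1 : InformationTheory.klDiv (W.law 1) out = ∫⁻ y, ENNReal.ofReal
      ((out.rnDeriv μ y).toReal * InformationTheory.klFun
        (W.dens 1 y / (out.rnDeriv μ y).toReal)) ∂μ := klDiv_eq_lintegral_density hac1 hacμ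
  rw [hkl0, hkl1,
    ← lintegral_const_mul _ (hmeas 0).ennreal_ofReal,
    ← lintegral_const_mul _ (hmeas 1).ennreal_ofReal,
    ← lintegral_add_left ((hmeas 0).ennreal_ofReal.const_mul _)]
  set Θ : Y → ℝ := fun y => t * (W.dens 0 y * Real.log (2 * W.dens 0 y)) +
    (1 - t) * (W.dens 1 y * Real.log (2 * W.dens 1 y)) +
      (1 / 2 - (t * W.dens 0 y + (1 - t) * W.dens 1 y)) with hΘ
  have hpt : ∀ᵐ y ∂μ, 0 ≤ Θ y ∧
      ENNReal.ofReal t * ENNReal.ofReal ((out.rnDeriv μ y).toReal *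
        InformationTheory.klFun (W.dens 0 y / (out.rnDeriv μ y).toReal)) +
      ENNReal.ofReal (1 - t) * ENNReal.ofReal ((out.rnDeriv μ y).toReal *
        InformationTheory.klFun (W.dens 1 y / (out.rnDeriv μ y).toReal)) ≤
      ENNReal.ofReal (Θ y) := by
    filter_upwards [hd, W.dens_add] with y h1 h2
    have hb := klFun_sum_le ht0 ht1 (W.dens_nonneg 0 y) (W.dens_nonneg 1 y) h2
    have hq : 0 ≤ t * W.dens 0 y + (1 - t) * W.dens 1 y :=
      add_nonneg (mul_nonneg ht0.le (W.dens_nonneg 0 y))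
        (mul_nonneg (by linarith) (W.dens_nonneg 1 y))
    have hk : ∀ x, 0 ≤ (t * W.dens 0 y + (1 - t) * W.dens 1 y) *
        InformationTheory.klFun (W.dens x y / (t * W.dens 0 y + (1 - t) * W.dens 1 y)) := fun x =>
      mul_nonneg hq (InformationTheory.klFun_nonneg (div_nonneg (W.dens_nonneg x y) hq))
    have a0 := mul_nonneg ht0.le (hk 0)
    have a1 := mul_nonneg (show 0 ≤ 1 - t by linarith) (hk 1)
    refine ⟨by rw [hΘ]; linarith, ?_⟩
    rw [h1, ← ENNReal.ofReal_mul ht0.le, ← ENNReal.ofReal_mul (by linarith),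
      ← ENNReal.ofReal_add a0 a1]
    exact ENNReal.ofReal_le_ofReal hb
  have i0 := W.integrable_dens_mul_log 0
  have i1 := W.integrable_dens_mul_log 1
  have j0 := W.integrable_dens 0
  have j1 := W.integrable_dens 1
  have iA := (i0.const_mul t).add (i1.const_mul (1 - t))
  have iB := (j0.const_mul t).add (j1.const_mul (1 - t))
  have iC := (integrable_const (1 / 2 : ℝ)).sub iB
  have hint : Integrable Θ μ := iA.add iC
  have hval : ∫ y, Θ y ∂μ = W.symInfo := by
    have e1 : ∫ y, Θ y ∂μ = (∫ y, (t * (W.dens 0 y * Real.log (2 * W.dens 0 y)) +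
        (1 - t) * (W.dens 1 y * Real.log (2 * W.dens 1 y))) ∂μ) +
        ∫ y, (1 / 2 - (t * W.dens 0 y + (1 - t) * W.dens 1 y)) ∂μ := integral_add iA iC
    have e2 : ∫ y, (t * (W.dens 0 y * Real.log (2 * W.dens 0 y)) +
        (1 - t) * (W.dens 1 y * Real.log (2 * W.dens 1 y))) ∂μ = W.symInfo := by
      rw [integral_add (i0.const_mul t) (i1.const_mul (1 - t)), integral_const_mul,
        integral_const_mul, ← W.symInfo_eq]
      change t * W.symInfo + _ = _
      ring
    have e3 : ∫ y, (1 / 2 - (t * W.dens 0 y + (1 - t) * W.dens 1 y)) ∂μ = 0 := by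
      have huniv : μ.real Set.univ = 2 := by
        rw [hμ, measureReal_add_apply, probReal_univ, probReal_univ]; norm_num
      have e4 : ∫ y, (1 / 2 - (t * W.dens 0 y + (1 - t) * W.dens 1 y)) ∂μ =
          ∫ _, (1 / 2 : ℝ) ∂μ - ∫ y, (t * W.dens 0 y + (1 - t) * W.dens 1 y) ∂μ :=
        integral_sub (integrable_const _) iB
      rw [e4, integral_const, huniv, integral_add (j0.const_mul t) (j1.const_mul (1 - t)),
        integral_const_mul, integral_const_mul, W.integral_dens, W.integral_dens]
      norm_num
    rw [e1, e2, e3, add_zero]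
  calc _ ≤ ∫⁻ y, ENNReal.ofReal (Θ y) ∂μ := lintegral_mono_ae (hpt.mono fun y h => h.2)
    _ = ENNReal.ofReal (∫ y, Θ y ∂μ) :=
        (ofReal_integral_eq_lintegral_ofReal hint (hpt.mono fun y h => h.1)).symm
    _ = _ := by rw [hval]

lemma BMSChannel.symInfo_nonneg : 0 ≤ W.symInfo := by
  have h : ∫ y, (W.dens 0 y - 1 / 2) ∂(W.law 0 + W.law 1) ≤ W.symInfo := by
    refine integral_mono ((W.integrable_dens 0).sub (integrable_const _))
      (W.integrable_dens_mul_log 0) fun y => ?_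
    rcases (W.dens_nonneg 0 y).eq_or_lt with h0 | h0
    · simp only [← h0]; norm_num
    have h3 := Real.log_le_sub_one_of_pos (show 0 < (2 * W.dens 0 y)⁻¹ by positivity)
    rw [Real.log_inv] at h3
    have h4 : W.dens 0 y * (2 * W.dens 0 y)⁻¹ = 1 / 2 := by field_simp
    nlinarith
  refine le_trans (le_of_eq ?_) h
  rw [integral_sub (W.integrable_dens 0) (integrable_const _), W.integral_dens, integral_const,
    measureReal_add_apply, probReal_univ, probReal_univ]
  norm_num

/-- A uniform input achieves the capacity of a symmetric channel. -/
lemma BMSChannel.capacity_le : W.capacity ≤ W.symInfo / Real.log 2 := by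
  unfold BMSChannel.capacity
  gcongr
  exact ENNReal.toReal_le_of_le_ofReal W.symInfo_nonneg (iSup_le W.mutualInfo_le)

end Channel

/-! ### The law of the quantized channel output -/

section Channel

variable {Y : Type*} [MeasurableSpace Y] (W : BMSChannel Y)

lemma BMSChannel.law_real_eq (x : ZMod 2) (S : Set Y) :
    (W.law x).real S = ∫ y in S, W.dens x y ∂(W.law 0 + W.law 1) :=
  (Measure.setIntegral_toReal_rnDeriv (W.law_ac x) S).symm

lemma BMSChannel.sum_setIntegral_msg (Q : Quantizer) {f : Y → ℝ}
    (hf : Integrable f (W.law 0 + W.law 1)) :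
    ∑ x : Msg Q, ∫ y in {y | Q (W.llr y) = x.1}, f y ∂(W.law 0 + W.law 1) =
      ∫ y, f y ∂(W.law 0 + W.law 1) := by
  rw [← integral_iUnion_fintype (s := fun x : Msg Q => {y | Q (W.llr y) = x.1}) (fun x => W.measurableSet_msg Q x.1)]
  · have : (⋃ x : Msg Q, {y | Q (W.llr y) = x.1}) = Set.univ :=
      Set.eq_univ_of_forall fun y =>
        Set.mem_iUnion.2 ⟨⟨Q (W.llr y), Set.mem_range_self _⟩, rfl⟩
    rw [this, setIntegral_univ]
  · intro x z hxz
    refine Set.disjoint_left.2 fun y hx hz => hxz (Subtype.ext ?_)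
    exact (show Q (W.llr y) = x.1 from hx).symm.trans hz
  · exact fun x => hf.integrableOn

lemma pairInfo_le_of_forall {p m R : ℝ} (hp : 0 ≤ p) (hm : 0 ≤ m)
    (h : ∀ α β : ℝ, 0 < α → 0 < β → α + β ≤ 2 → p * Real.log α + m * Real.log β ≤ R) :
    pairInfo p m ≤ R := by
  have hlim : ∀ z : ℝ, Tendsto (fun β => z * Real.log β) (𝓝[<] 2) (𝓝 (z * Real.log 2)) := fun z =>
    ((Real.continuousAt_log two_ne_zero).tendsto.const_mul z).mono_left nhdsWithin_le_nhds
  have hev : ∀ᶠ β : ℝ in 𝓝[<] 2, 0 < β ∧ β < 2 :=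
    eventually_of_mem (Ioo_mem_nhdsLT (show (0 : ℝ) < 2 by norm_num)) fun β hβ => hβ
  rcases hp.eq_or_lt with rfl | hp
  · rw [pairInfo_zero_left]
    refine le_of_tendsto (hlim m) (hev.mono fun β hβ => ?_)
    simpa using h (2 - β) β (by linarith) hβ.1 (by linarith)
  rcases hm.eq_or_lt with rfl | hm
  · rw [pairInfo_zero_right]
    refine le_of_tendsto (hlim p) (hev.mono fun β hβ => ?_)
    simpa using h β (2 - β) hβ.1 (by linarith) (by linarith)
  rw [pairInfo_eq hp hm]
  refine h _ _ (by positivity) (by positivity) (le_of_eq ?_)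
  field_simp

lemma pairInfo_of_add_eq_one {f g : ℝ} (hf : 0 ≤ f) (hg : 0 ≤ g) (h : f + g = 1) :
    pairInfo f g = f * Real.log (2 * f) + g * Real.log (2 * g) := by
  rcases hf.eq_or_lt with rfl | hf
  · rw [pairInfo_zero_left]
    obtain rfl : g = 1 := by linarith
    simp
  rcases hg.eq_or_lt with rfl | hg
  · rw [pairInfo_zero_right]
    obtain rfl : f = 1 := by linarith
    simp
  rw [pairInfo_eq hf hg, h, div_one, div_one]

/-- Data processing: quantization of the channel output loses information. -/
lemma BMSChannel.msgInfo_msgLaw_le (Q : Quantizer) : msgInfo (W.msgLaw Q) ≤ W.symInfo := by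
  set h : Y → ℝ := fun y => W.dens 0 y * Real.log (2 * W.dens 0 y) +
    W.dens 1 y * Real.log (2 * W.dens 1 y) with hh
  have hint : Integrable h (W.law 0 + W.law 1) :=
    (W.integrable_dens_mul_log 0).add (W.integrable_dens_mul_log 1)
  have hval : ∫ y, h y ∂(W.law 0 + W.law 1) = 2 * W.symInfo := by
    have e : ∫ y, h y ∂(W.law 0 + W.law 1) = _ :=
      integral_add (W.integrable_dens_mul_log 0) (W.integrable_dens_mul_log 1)
    rw [e, ← W.symInfo_eq]
    change W.symInfo + W.symInfo = _
    ring
  have key : ∀ x : Msg Q, pairInfo ((W.msgLaw Q).w x) ((W.msgLaw Q).w (-x)) ≤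
      ∫ y in {y | Q (W.llr y) = x.1}, h y ∂(W.law 0 + W.law 1) := by
    intro x
    refine pairInfo_le_of_forall ((W.msgLaw Q).nonneg x) ((W.msgLaw Q).nonneg (-x)) ?_
    intro α β hα hβ hαβ
    rw [← W.msgLaw_one Q x]
    change (W.law 0).real _ * _ + _ ≤ _
    rw [W.law_real_eq, W.law_real_eq, ← integral_mul_const, ← integral_mul_const,
      ← integral_add ((W.integrable_dens 0).integrableOn.mul_const _)
        ((W.integrable_dens 1).integrableOn.mul_const _)]
    refine setIntegral_mono_ae (((W.integrable_dens 0).integrableOn.mul_const _).add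
        ((W.integrable_dens 1).integrableOn.mul_const _)) hint.integrableOn ?_
    filter_upwards [W.dens_add] with y hy
    rw [hh]
    simp only
    rw [← pairInfo_of_add_eq_one (W.dens_nonneg 0 y) (W.dens_nonneg 1 y) hy]
    exact le_pairInfo (W.dens_nonneg 0 y) (W.dens_nonneg 1 y) hα hβ hαβ
  have := (Finset.sum_le_sum fun x (_ : x ∈ Finset.univ) => key x).trans
    (le_of_eq ((W.sum_setIntegral_msg Q hint).trans hval))
  unfold msgInfo FinLaw.infoOf
  linarith

lemma posterior_le_exp {ℓ : EReal} {B : ℝ} (h : ℓ ≤ ((-B : ℝ) : EReal)) :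
    posterior ℓ ≤ Real.exp (-B) := by
  unfold posterior
  induction ℓ with
  | bot => simp [Real.exp_nonneg]
  | top => simp at h
  | coe w =>
    rw [EReal.coe_le_coe_iff] at h
    simp only [EReal.coe_ne_top, EReal.coe_ne_bot, if_false, EReal.toReal_coe]
    calc (1 + Real.exp (-w))⁻¹ ≤ (Real.exp (-w))⁻¹ := by
          gcongr; linarith
      _ = Real.exp w := by rw [Real.exp_neg, inv_inv]
      _ ≤ _ := by gcongr

lemma logLoss_gridFun_le_posterior {M N : ℕ} (hM : 2 ≤ M) (hN : 0 < N) {ℓ : EReal}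
    (h : 0 < posterior ℓ) : logLoss (gridFun M N ℓ) ≤ -Real.log (posterior ℓ) + 1 / N +
      Real.exp (-(M - 1)) + if ℓ ≤ ((-(M - 1) : ℝ) : EReal) then 1 else 0 := by
  induction ℓ with
  | bot => simp [posterior] at h
  | top =>
    rw [gridFun_top]
    have h1 := logLoss_le_exp M
    have h2 : Real.exp (-(M : ℝ)) ≤ Real.exp (-(M - 1)) := by gcongr; linarith
    have h3 : (0 : ℝ) ≤ 1 / N := by positivity
    have h4 : ¬ (⊤ : EReal) ≤ ((-(M - 1) : ℝ) : EReal) := by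
      rw [top_le_iff]; exact EReal.coe_ne_top _
    rw [if_neg h4]
    simp only [posterior, if_true, Real.log_one]
    linarith
  | coe w =>
    have h1 := logLoss_gridFun_le hM hN w
    have h2 : -Real.log (posterior w) = logLoss w := by
      simp only [posterior, EReal.coe_ne_top, EReal.coe_ne_bot, if_false, EReal.toReal_coe]
      rw [Real.log_inv, neg_neg]; rfl
    rw [h2]
    simpa only [EReal.coe_le_coe_iff] using h1

lemma BMSChannel.msgScore_msgLaw_ge {M N : ℕ} (hM : 2 ≤ M) (hN : 0 < N) :
    W.symInfo - gridLoss M N ≤ msgScore (W.msgLaw (gridQuantizer M N hM hN)) := by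
  set c : ℝ := 1 / N + Real.exp (-(M - 1)) with hc
  set S : Set Y := {y | W.llr y ≤ ((-(M - 1) : ℝ) : EReal)} with hS
  have hSm : MeasurableSet S := W.measurable_llr measurableSet_Iic
  set φ : Y → ℝ := fun y => W.dens 0 y * Real.log (2 * W.dens 0 y) - W.dens 0 y * c -
    S.indicator (W.dens 0) y with hφ
  have i1 := W.integrable_dens_mul_log 0
  have i2 := (W.integrable_dens 0).mul_const c
  have i3 := (W.integrable_dens 0).indicator hSm
  have hint : Integrable φ (W.law 0 + W.law 1) := (i1.sub i2).sub i3
  have htail : ∫ y, S.indicator (W.dens 0) y ∂(W.law 0 + W.law 1) ≤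
      4 * Real.exp (-(M - 1)) := by
    rw [integral_indicator hSm]
    have h1 := norm_setIntegral_le_of_norm_le_const_ae' (μ := W.law 0 + W.law 1) (s := S)
      (f := W.dens 0) (C := Real.exp (-(M - 1))) (measure_lt_top _ _) (by
        filter_upwards [W.posterior_llr] with y hy hyS
        rw [Real.norm_of_nonneg (W.dens_nonneg 0 y), ← hy]
        exact posterior_le_exp hyS)
    have h2 : (W.law 0 + W.law 1).real S ≤ 2 := by
      rw [measureReal_add_apply]
      linarith [measureReal_le_one (μ := W.law 0) (s := S),
        measureReal_le_one (μ := W.law 1) (s := S)]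
    have h3 := mul_le_mul_of_nonneg_left h2 (Real.exp_pos (-((M : ℝ) - 1))).le
    linarith [Real.le_norm_self (∫ y in S, W.dens 0 y ∂(W.law 0 + W.law 1)),
      Real.exp_pos (-((M : ℝ) - 1))]
  have hval : W.symInfo - gridLoss M N ≤ ∫ y, φ y ∂(W.law 0 + W.law 1) := by
    have e : ∫ y, φ y ∂(W.law 0 + W.law 1) = W.symInfo - c -
        ∫ y, S.indicator (W.dens 0) y ∂(W.law 0 + W.law 1) := by
      have e1 : ∫ y, φ y ∂(W.law 0 + W.law 1) = _ := integral_sub (i1.sub i2) i3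
      have e2 : ∫ y, (W.dens 0 y * Real.log (2 * W.dens 0 y) - W.dens 0 y * c)
          ∂(W.law 0 + W.law 1) = W.symInfo - c := by
        rw [integral_sub i1 i2, integral_mul_const, W.integral_dens, one_mul]; rfl
      rw [e1, ← e2]
    rw [e]
    unfold gridLoss
    linarith
  have key : ∀ x : Msg (gridQuantizer M N hM hN),
      ∫ y in {y | gridQuantizer M N hM hN (W.llr y) = x.1}, φ y ∂(W.law 0 + W.law 1) ≤
        (W.msgLaw (gridQuantizer M N hM hN)).w x * (Real.log 2 - logLoss x.val) := by
    intro x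
    change _ ≤ (W.law 0).real _ * _
    rw [W.law_real_eq, ← integral_mul_const]
    refine setIntegral_mono_on_ae hint.integrableOn
      ((W.integrable_dens 0).integrableOn.mul_const _) (W.measurableSet_msg _ _) ?_
    filter_upwards [W.posterior_llr] with y hy hyx
    have hx : x.val = gridFun M N (W.llr y) := by
      unfold Msg.val
      rw [← (show gridQuantizer M N hM hN (W.llr y) = x.1 from hyx)]
      rfl
    rw [hx]
    rcases (W.dens_nonneg 0 y).eq_or_lt with h0 | h0
    · simp [hφ, Set.indicator, ← h0]
    have h1 := logLoss_gridFun_le_posterior hM hN (ℓ := W.llr y) (by rw [hy]; exact h0)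
    rw [hy] at h1
    have h2 : S.indicator (W.dens 0) y =
        W.dens 0 y * (if W.llr y ≤ ((-(M - 1) : ℝ) : EReal) then 1 else 0) := by
      simp [Set.indicator, hS]
    simp only [hφ, h2]
    rw [← mul_sub, ← mul_sub]
    refine mul_le_mul_of_nonneg_left ?_ h0.le
    rw [Real.log_mul two_ne_zero h0.ne']
    linarith
  rw [← W.sum_setIntegral_msg (gridQuantizer M N hM hN) hint] at hval
  exact hval.trans (Finset.sum_le_sum fun x _ => key x)

lemma BMSChannel.msgGap_msgLaw_le {M N : ℕ} (hM : 2 ≤ M) (hN : 0 < N) :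
    msgGap (W.msgLaw (gridQuantizer M N hM hN)) ≤ gridLoss M N := by
  have h1 := W.msgScore_msgLaw_ge hM hN
  have h2 := W.msgInfo_msgLaw_le (gridQuantizer M N hM hN)
  unfold msgGap FinLaw.gapOf
  linarith

end Channel

/-! ### The rate achieved with the uniform quantizer -/

section GridRate

variable {M N : ℕ} {hM : 2 ≤ M} {hN : 0 < N}

lemma pathAvg_msgGap_le (a : FinLaw (Msg (gridQuantizer M N hM hN)))
    (ha : msgGap a ≤ gridLoss M N) (n : ℕ) :
    pathAvg (lawStep (gridQuantizer M N hM hN)) n msgGap a ≤ 2 * 5 ^ n * gridLoss M N := by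
  have h := pathAvg_le_geometric (st := lawStep (gridQuantizer M N hM hN)) (f := msgGap)
    (e := fun _ => gridLoss M N) (by norm_num : (0 : ℝ) ≤ 5) msgGap_step_le (B := gridLoss M N) a n
    (fun j _ => (pathAvg_const _ _ _).le) n le_rfl
  have h1 : ∑ j ∈ Finset.range n, (5 : ℝ) ^ j ≤ 5 ^ n := by
    rw [geom_sum_eq (by norm_num)]
    have : (0 : ℝ) < 5 ^ n := by positivity
    linarith
  have h2 := mul_le_mul_of_nonneg_left h1 (gridLoss_nonneg M N)
  have h3 := mul_le_mul_of_nonneg_left ha (show (0 : ℝ) ≤ 5 ^ n by positivity)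
  linarith

lemma pathAvg_msgInfo_ge (a : FinLaw (Msg (gridQuantizer M N hM hN)))
    (ha : msgGap a ≤ gridLoss M N) (n : ℕ) :
    msgScore a - n * (9 * 5 ^ n) * gridLoss M N ≤
      pathAvg (lawStep (gridQuantizer M N hM hN)) n msgInfo a := by
  have h := pathAvg_le_geometric (st := lawStep (gridQuantizer M N hM hN))
    (f := fun a => -msgScore a) (e := fun a => gridLoss M N + 4 * msgGap a)
    (zero_le_one' ℝ) (fun D => by linarith [msgScore_step_ge D])
    (B := 9 * 5 ^ n * gridLoss M N) a n (by
      intro j hj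
      rw [pathAvg_add, pathAvg_const, pathAvg_mul]
      have h1 := pathAvg_msgGap_le a ha j
      have h2 : (5 : ℝ) ^ j ≤ 5 ^ n := pow_le_pow_right₀ (by norm_num) hj.le
      have h3 : (1 : ℝ) ≤ 5 ^ n := one_le_pow₀ (by norm_num)
      have h4 := gridLoss_nonneg M N
      have h5 := mul_le_mul_of_nonneg_right h2 h4
      have h6 := mul_le_mul_of_nonneg_right h3 h4
      linarith) n le_rfl
  simp only [one_pow, one_mul, Finset.sum_const, Finset.card_range, nsmul_eq_mul, mul_one] at h
  have h1 : pathAvg (lawStep (gridQuantizer M N hM hN)) n (fun a => -1 * msgInfo a) a ≤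
      pathAvg (lawStep (gridQuantizer M N hM hN)) n (fun a => -msgScore a) a := by
    refine pathAvg_mono (fun b => ?_) _ _
    have := msgGap_nonneg b
    unfold msgGap FinLaw.gapOf at this
    linarith
  rw [pathAvg_mul] at h1
  linarith

lemma contraction_nonneg : 0 ≤ contraction := by norm_num [contraction]

lemma contraction_lt_one : contraction < 1 := by norm_num [contraction]

lemma pathAvg_msgPotential_le (h28 : 28 ≤ M) (a : FinLaw (Msg (gridQuantizer M N hM hN)))
    (ha : msgGap a ≤ gridLoss M N) (n : ℕ) :
    pathAvg (lawStep (gridQuantizer M N hM hN)) n msgPotential a ≤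
      contraction ^ n + n * (8 * 4 ^ 12 * Real.exp (M / 2) * 5 ^ n * gridLoss M N) := by
  set B := 8 * 4 ^ 12 * Real.exp (M / 2) * 5 ^ n * gridLoss M N with hB
  have hη := gridLoss_nonneg M N
  have hB0 : 0 ≤ B := by positivity
  have h := pathAvg_le_geometric (st := lawStep (gridQuantizer M N hM hN)) (f := msgPotential)
    (e := fun a => 4 * 4 ^ 12 * Real.exp (M / 2) * msgGap a) contraction_nonneg
    (fun D => msgPotential_step_le D h28) (B := B) a n (by
      intro j hj
      rw [pathAvg_mul]
      have h1 := pathAvg_msgGap_le a ha j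
      have h2 : (5 : ℝ) ^ j ≤ 5 ^ n := pow_le_pow_right₀ (by norm_num) hj.le
      calc 4 * 4 ^ 12 * Real.exp (M / 2) * _ ≤
            4 * 4 ^ 12 * Real.exp (M / 2) * (2 * 5 ^ n * gridLoss M N) := by
            refine mul_le_mul_of_nonneg_left (h1.trans ?_) (by positivity)
            gcongr
        _ = B := by rw [hB]; ring) n le_rfl
  have h1 : ∑ j ∈ Finset.range n, contraction ^ j ≤ n := by
    calc _ ≤ ∑ _j ∈ Finset.range n, (1 : ℝ) :=
          Finset.sum_le_sum fun j _ => pow_le_one₀ contraction_nonneg contraction_lt_one.le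
      _ = n := by simp
  have h2 := mul_le_mul_of_nonneg_left h1 hB0
  have h3 := mul_le_mul_of_nonneg_left (msgPotential_le_one a) (pow_nonneg contraction_nonneg n)
  linarith

/-- Messages with a small potential have little information or a small weight. -/
lemma msgInfo_le_indicator_add {θ : ℝ} (hθ : 0 < θ) (hθ1 : θ ≤ 1)
    (a : FinLaw (Msg (gridQuantizer M N hM hN))) :
    msgInfo a / Real.log 2 ≤
      (if msgWeight a ≤ 4⁻¹ ^ 9 * θ ^ 8 then 1 else 0) + 2 / θ * msgPotential a := by
  have hlog : 0 < Real.log 2 := Real.log_pos one_lt_two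
  have hI : msgInfo a / Real.log 2 ≤ 1 := by
    rw [div_le_one hlog]; exact a.infoOf_le neg_involutive
  have hΨ := msgPotential_nonneg a
  split_ifs with h
  · have : 0 ≤ 2 / θ * msgPotential a := by positivity
    linarith
  push Not at h
  rw [zero_add, div_mul_eq_mul_div, le_div_iff₀ hθ]
  have hθ' : θ ≤ (msgWeight a / 4⁻¹ ^ 9) ^ (1 / 8 : ℝ) := by
    calc θ = (θ ^ 8) ^ (1 / 8 : ℝ) := by
          rw [← Real.rpow_natCast, ← Real.rpow_mul hθ.le]; norm_num
      _ ≤ _ := by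
          gcongr
          rw [le_div_iff₀ (by norm_num)]
          linarith
  rcases le_total √(msgInfo a) ((msgWeight a / 4⁻¹ ^ 9) ^ (1 / 8 : ℝ)) with hmin | hmin
  · have e : msgPotential a = √(msgInfo a) := min_eq_left hmin
    rw [e]
    have h0 := msgInfo_nonneg a
    have h1 : √(msgInfo a) ≤ 1 := Real.sqrt_le_one.2 (msgInfo_le_one a)
    have h2 : msgInfo a ≤ √(msgInfo a) := by
      nlinarith [Real.sq_sqrt h0, Real.sqrt_nonneg (msgInfo a)]
    have h3 : msgInfo a / Real.log 2 ≤ 2 * msgInfo a := by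
      rw [div_le_iff₀ hlog]; nlinarith [Real.log_two_gt_d9]
    have h4 : 0 ≤ msgInfo a / Real.log 2 := by positivity
    nlinarith
  · have e : msgPotential a = _ := min_eq_right hmin
    rw [e]
    nlinarith

/-- After `n` steps, all but few of the informative messages have a weight small enough for
`maxRate_ge`; `θ` is the resulting loss in rate. -/
theorem maxRate_gridQuantizer_ge {Y : Type*} [MeasurableSpace Y] (W : BMSChannel Y) (h28 : 28 ≤ M)
    (n : ℕ) {θ : ℝ} (hθ : 0 < θ) (hθ1 : θ ≤ 1) :
    W.capacity - (2 * (1 + n * (9 * 5 ^ n)) * gridLoss M N + 2 / θ * (contraction ^ n +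
      n * (8 * 4 ^ 12 * Real.exp (M / 2) * 5 ^ n * gridLoss M N)) + θ) ≤
      maxRate W (gridQuantizer M N hM hN) := by
  set a := W.msgLaw (gridQuantizer M N hM hN) with ha
  have hη := gridLoss_nonneg M N
  have hgap : msgGap a ≤ gridLoss M N := W.msgGap_msgLaw_le hM hN
  have hrate := maxRate_ge W (gridQuantizer M N hM hN) (Z := msgWeight) msgWeight_nonneg
    bitErr_le_msgWeight (ζ := 4⁻¹ ^ 9) (by norm_num) msgWeight_check_le
    (fun a hz => msgWeight_var_le_mul a h28 hz) (ε := 4⁻¹ ^ 9 * θ ^ 8) (by positivity) n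
  have hθ8 : (4⁻¹ ^ 9 * θ ^ 8 / 4⁻¹ ^ 9) ^ (1 / 8 : ℝ) = θ := by
    rw [mul_div_cancel_left₀ _ (by norm_num), ← Real.rpow_natCast, ← Real.rpow_mul hθ.le]
    norm_num
  rw [hθ8, ← ha] at hrate
  have hlog : 0 < Real.log 2 := Real.log_pos one_lt_two
  have h1 : pathAvg (lawStep (gridQuantizer M N hM hN)) n
      (fun a => (Real.log 2)⁻¹ * msgInfo a) a ≤
      pathAvg (lawStep (gridQuantizer M N hM hN)) n
        (fun a => (if msgWeight a ≤ 4⁻¹ ^ 9 * θ ^ 8 then 1 else 0) + 2 / θ * msgPotential a) a := by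
    refine pathAvg_mono (fun b => ?_) _ _
    rw [inv_mul_eq_div]
    exact msgInfo_le_indicator_add hθ hθ1 b
  rw [pathAvg_mul, pathAvg_add, pathAvg_mul, inv_mul_eq_div] at h1
  have h2 := mul_le_mul_of_nonneg_left (pathAvg_msgPotential_le h28 a hgap n)
    (show 0 ≤ 2 / θ by positivity)
  have h3 := pathAvg_msgInfo_ge a hgap n
  have h4 : W.symInfo - gridLoss M N ≤ msgScore a := W.msgScore_msgLaw_ge hM hN
  have h5 := W.capacity_le
  have h6 : (W.symInfo - (1 + n * (9 * 5 ^ n)) * gridLoss M N) / Real.log 2 ≤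
      pathAvg (lawStep (gridQuantizer M N hM hN)) n msgInfo a / Real.log 2 := by
    gcongr
    linarith
  have h7 : (1 + n * (9 * 5 ^ n)) * gridLoss M N / Real.log 2 ≤
      2 * (1 + n * (9 * 5 ^ n)) * gridLoss M N := by
    rw [div_le_iff₀ hlog]
    have : 0 ≤ (1 + n * (9 * 5 ^ n)) * gridLoss M N := by positivity
    nlinarith [Real.log_two_gt_d9]
  rw [sub_div] at h6
  linarith

end GridRate

/-! ### The choice of the quantizer -/

/-- The loss in `maxRate_gridQuantizer_ge` is at most `2 ^ -L` after `k * L` steps, if both `e ^ M` and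
`N` are suitable powers of `2 ^ L`: with `u = 2 ^ L` and `m = 4 * k + 40`, the growth `5 ^ (k * L)` of
the gap costs `u ^ (4 * k)`, the constants at most `u ^ 38`, and `e ^ (M / 2) * gridLoss M N` is of the
order `u ^ -m`. -/
lemma total_loss_le {k L : ℕ} (hk : contraction ^ k ≤ 1 / 512) (hL : 1 ≤ L) :
    2 * (1 + ((k * L : ℕ) : ℝ) * (9 * 5 ^ (k * L))) *
        gridLoss (2 * ((4 * k + 40) * L)) (2 ^ (3 * ((4 * k + 40) * L))) +
      2 / (1 / (8 * 2 ^ L)) * (contraction ^ (k * L) + ((k * L : ℕ) : ℝ) *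
        (8 * 4 ^ 12 * Real.exp (((2 * ((4 * k + 40) * L) : ℕ) : ℝ) / 2) * 5 ^ (k * L) *
          gridLoss (2 * ((4 * k + 40) * L)) (2 ^ (3 * ((4 * k + 40) * L))))) + 1 / (8 * 2 ^ L) ≤
      1 / 2 ^ L := by
  set m := 4 * k + 40 with hm
  set u : ℝ := 2 ^ L with hu
  have hu2 : 2 ≤ u := by
    calc (2 : ℝ) = 2 ^ 1 := (pow_one _).symm
      _ ≤ 2 ^ L := pow_le_pow_right₀ (by norm_num) hL
  have hu0 : 0 < u := by linarith
  set E := Real.exp ((m * L : ℕ) : ℝ) with hE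
  have hEexp : Real.exp (((2 * (m * L) : ℕ) : ℝ) / 2) = E := by
    rw [hE]; congr 1; push_cast; ring
  have hE1 : 1 ≤ E := Real.one_le_exp (Nat.cast_nonneg _)
  have hElow : u ^ m ≤ E := by
    rw [hE, hu, ← pow_mul, mul_comm L, ← mul_one ((m * L : ℕ) : ℝ), Real.exp_nat_mul]
    gcongr
    linarith [Real.exp_one_gt_d9]
  have hEup : E ≤ u ^ (2 * m) := by
    calc E ≤ 4 ^ (m * L) := by
          rw [hE, ← mul_one ((m * L : ℕ) : ℝ), Real.exp_nat_mul]
          gcongr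
          linarith [Real.exp_one_lt_d9]
      _ = u ^ (2 * m) := by
          rw [hu, show (4 : ℝ) = 2 ^ 2 by norm_num, ← pow_mul, ← pow_mul]; congr 1; ring
  set η := gridLoss (2 * (m * L)) (2 ^ (3 * (m * L))) with hη
  have hη0 : 0 ≤ η := gridLoss_nonneg _ _
  have hEη : E * η ≤ 17 / u ^ m := by
    have e1 : η ≤ 1 / u ^ (3 * m) + 16 / E ^ 2 := by
      rw [hη, gridLoss]
      have a1 : (((2 ^ (3 * (m * L)) : ℕ)) : ℝ) = u ^ (3 * m) := by
        push_cast; rw [hu, ← pow_mul]; congr 1; ring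
      have a2 : Real.exp (-(((2 * (m * L) : ℕ) : ℝ) - 1)) = Real.exp 1 / E ^ 2 := by
        rw [hE, ← Real.exp_nat_mul, ← Real.exp_sub]; congr 1; push_cast; ring
      rw [a1, a2, mul_div_assoc']
      gcongr
      linarith [Real.exp_one_lt_d9]
    calc E * η ≤ E * (1 / u ^ (3 * m) + 16 / E ^ 2) := by gcongr
      _ = E / u ^ (3 * m) + 16 / E := by field_simp
      _ ≤ u ^ (2 * m) / u ^ (3 * m) + 16 / u ^ m := by gcongr
      _ = 17 / u ^ m := by
          rw [show 3 * m = 2 * m + m by ring, pow_add]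
          field_simp
          norm_num
  have hn : ((k * L : ℕ) : ℝ) * 5 ^ (k * L) ≤ u ^ (4 * k) := by
    have a1 : ((k * L : ℕ) : ℝ) ≤ 2 ^ (k * L) := by
      exact_mod_cast (Nat.lt_two_pow_self (n := k * L)).le
    calc ((k * L : ℕ) : ℝ) * 5 ^ (k * L) ≤ 2 ^ (k * L) * 8 ^ (k * L) := by
          gcongr; norm_num
      _ = u ^ (4 * k) := by
          rw [hu, ← mul_pow, show (2 : ℝ) * 8 = 2 ^ 4 by norm_num, ← pow_mul, ← pow_mul]
          congr 1; ring
  have hc : contraction ^ (k * L) ≤ 1 / u ^ 9 := by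
    rw [pow_mul]
    calc (contraction ^ k) ^ L ≤ (1 / 512) ^ L :=
          pow_le_pow_left₀ (pow_nonneg contraction_nonneg _) hk L
      _ = 1 / u ^ 9 := by
          rw [hu, one_div_pow, show (512 : ℝ) = 2 ^ 9 by norm_num, ← pow_mul, ← pow_mul, mul_comm]
  rw [hEexp]
  generalize ((k * L : ℕ) : ℝ) = n at hn ⊢
  generalize (5 : ℝ) ^ (k * L) = v at hn ⊢
  have hw1 : 1 ≤ u ^ (4 * k) := one_le_pow₀ (by linarith)
  have hηE : η ≤ E * η := le_mul_of_one_le_left hη0 hE1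
  -- all errors caused by quantization together
  have hquant : 2 * (1 + n * (9 * v)) * η + 16 * u * (n * (8 * 4 ^ 12 * E * v * η)) ≤
      1 / (2 * u) := by
    have b1 : 2 * (1 + n * (9 * v)) * η ≤ 20 * (u * (u ^ (4 * k) * (E * η))) := by
      have c1 : 2 * (1 + n * (9 * v)) ≤ 20 * u ^ (4 * k) := by linarith
      calc 2 * (1 + n * (9 * v)) * η ≤ 20 * u ^ (4 * k) * (E * η) :=
            mul_le_mul c1 hηE hη0 (by positivity)
        _ ≤ u * (20 * u ^ (4 * k) * (E * η)) :=
            le_mul_of_one_le_left (by positivity) (by linarith)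
        _ = _ := by ring
    have b2 : 16 * u * (n * (8 * 4 ^ 12 * E * v * η)) ≤
        128 * 4 ^ 12 * (u * (u ^ (4 * k) * (E * η))) := by
      calc 16 * u * (n * (8 * 4 ^ 12 * E * v * η)) =
            128 * 4 ^ 12 * (u * (n * v * (E * η))) := by ring
        _ ≤ _ := by gcongr
    have b3 : u * (u ^ (4 * k) * (E * η)) ≤ 17 / u ^ 39 := by
      calc u * (u ^ (4 * k) * (E * η)) ≤ u * (u ^ (4 * k) * (17 / u ^ m)) := by gcongr
        _ = 17 / u ^ 39 := by
            rw [hm, show 4 * k + 40 = 4 * k + 1 + 39 by ring, pow_add, pow_add]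
            field_simp
    have b4 : (2 : ℝ) ^ 38 ≤ u ^ 38 := by gcongr
    have b5 : 17 / u ^ 39 ≤ 17 / (2 ^ 38 * u) := by
      rw [pow_succ]; gcongr
    have b6 : (20 + 128 * 4 ^ 12) * (17 / (2 ^ 38 * u)) ≤ 1 / (2 * u) := by
      rw [mul_div_assoc', div_le_div_iff₀ (by positivity) (by positivity)]
      nlinarith
    have b7 := mul_le_mul_of_nonneg_left (b3.trans b5) (show (0 : ℝ) ≤ 20 + 128 * 4 ^ 12 by norm_num)
    linarith
  have hpol : 16 * u * contraction ^ (k * L) ≤ 1 / (8 * u) := by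
    have d1 : (128 : ℝ) ≤ u ^ 7 := by
      calc (128 : ℝ) = 2 ^ 7 := by norm_num
        _ ≤ u ^ 7 := by gcongr
    calc 16 * u * contraction ^ (k * L) ≤ 16 * u * (1 / u ^ 9) := by gcongr
      _ = 16 / (u ^ 7 * u) := by field_simp
      _ ≤ 16 / (128 * u) := by gcongr
      _ = 1 / (8 * u) := by field_simp; norm_num
  have e2 : 2 / (1 / (8 * u)) = 16 * u := by field_simp; norm_num
  rw [e2]
  have e3 : 1 / (2 * u) + 1 / (8 * u) + 1 / (8 * u) ≤ 1 / u := by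
    have : 1 / (2 * u) + 1 / (8 * u) + 1 / (8 * u) = 3 / 4 * (1 / u) := by field_simp; norm_num
    rw [this]
    have : 0 < 1 / u := by positivity
    linarith
  linarith

/-- A number of bits per message of the order of `log (1 / δ)` suffices for a gap `δ` to
capacity. -/
theorem exists_quantizer_gap_to_capacity :
    ∃ c : ℝ, 0 < c ∧ ∀ δ : ℝ, 0 < δ → δ ≤ 1 / 2 →
      ∃ Q : Quantizer, Real.logb 2 Q.card ≤ c * Real.logb 2 (1 / δ) ∧
        ∀ (Y : Type*) [MeasurableSpace Y] (W : BMSChannel Y),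
          W.capacity - δ ≤ maxRate W Q := by
  obtain ⟨k, hk⟩ := exists_pow_lt_of_lt_one (show (0 : ℝ) < 1 / 512 by norm_num) contraction_lt_one
  refine ⟨2 * (4 * (4 * k + 40 : ℕ) + 3), by positivity, fun δ hδ hδ2 => ?_⟩
  set t := Real.logb 2 (1 / δ) with ht
  have ht1 : 1 ≤ t := by
    rw [ht, Real.le_logb_iff_rpow_le one_lt_two (by positivity), Real.rpow_one,
      le_div_iff₀ hδ]
    linarith
  set L := ⌈t⌉₊ with hL
  have hLt : t ≤ L := Nat.le_ceil t
  have hL1 : 1 ≤ L := by exact_mod_cast ht1.trans hLt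
  have hL2 : (L : ℝ) ≤ 2 * t := by linarith [Nat.ceil_lt_add_one (show 0 ≤ t by linarith)]
  have hδu : 1 / 2 ^ L ≤ δ := by
    have : 1 / δ ≤ 2 ^ L := by
      rw [← Real.rpow_natCast, ← Real.logb_le_iff_le_rpow one_lt_two (by positivity)]
      exact hLt
    rw [div_le_iff₀ (by positivity)]
    rw [div_le_iff₀ hδ] at this
    linarith
  set m := 4 * k + 40 with hm
  have hmL : 40 ≤ m * L := (show 40 ≤ m by omega).trans (Nat.le_mul_of_pos_right m hL1)
  refine ⟨gridQuantizer (2 * (m * L)) (2 ^ (3 * (m * L))) (by omega) (by positivity), ?_, ?_⟩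
  · have hcard : ((gridQuantizer (2 * (m * L)) (2 ^ (3 * (m * L))) (by omega)
        (by positivity)).card : ℝ) ≤ 2 ^ ((4 * m + 3) * L) := by
      have h1 := gridQuantizer_card_le (M := 2 * (m * L)) (N := 2 ^ (3 * (m * L))) (by omega)
        (by positivity)
      have h2 : 2 * (2 * (m * L) * 2 ^ (3 * (m * L))) + 1 ≤ 2 ^ ((4 * m + 3) * L) := by
        have h3 : m * L ≤ 2 ^ (m * L) := Nat.lt_two_pow_self.le
        have h4 : 0 < 2 ^ (m * L) * 2 ^ (3 * (m * L)) := by positivity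
        have h5 : m * L * 2 ^ (3 * (m * L)) ≤ 2 ^ (m * L) * 2 ^ (3 * (m * L)) :=
          Nat.mul_le_mul_right _ h3
        calc 2 * (2 * (m * L) * 2 ^ (3 * (m * L))) + 1 =
              4 * (m * L * 2 ^ (3 * (m * L))) + 1 := by ring
          _ ≤ 8 * (2 ^ (m * L) * 2 ^ (3 * (m * L))) := by omega
          _ = 2 ^ (3 + (m * L + 3 * (m * L))) := by rw [pow_add, pow_add]; norm_num
          _ ≤ 2 ^ ((4 * m + 3) * L) := by
              refine Nat.pow_le_pow_right (by norm_num) ?_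
              nlinarith
      exact_mod_cast h1.trans h2
    have hq0 : (0 : ℝ) ≤ ((gridQuantizer (2 * (m * L)) (2 ^ (3 * (m * L))) (by omega)
      (by positivity)).card : ℝ) := Nat.cast_nonneg _
    generalize ((gridQuantizer (2 * (m * L)) (2 ^ (3 * (m * L))) (by omega)
      (by positivity)).card : ℝ) = q at hcard hq0 ⊢
    have hb : Real.logb 2 (2 ^ ((4 * m + 3) * L)) = (4 * m + 3) * L := by
      rw [← Real.rpow_natCast, Real.logb_rpow (by norm_num) (by norm_num)]
      push_cast; ring
    have hm0 : (0 : ℝ) ≤ m := Nat.cast_nonneg m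
    have hgoal : (4 * m + 3) * L ≤ 2 * (4 * (m : ℝ) + 3) * t := by nlinarith
    rcases hq0.eq_or_lt with rfl | hq
    · rw [Real.logb_zero]; positivity
    · exact ((Real.logb_le_logb_of_le one_lt_two hq hcard).trans (le_of_eq hb)).trans hgoal
  · intro Y _ W
    have h := maxRate_gridQuantizer_ge (hM := by omega) (hN := by positivity) W
      (show 28 ≤ 2 * (m * L) by omega) (k * L) (N := 2 ^ (3 * (m * L)))
      (θ := 1 / (8 * 2 ^ L)) (by positivity) (by
        rw [div_le_one (by positivity)]
        have : (1 : ℝ) ≤ 2 ^ L := one_le_pow₀ (by norm_num)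
        linarith)
    have h2 := total_loss_le hk.le hL1
    linarith

end PolarSCD

end

theorem theorem1 :
    -- (i) three messages: the decoder with erasures
    (∀ (Y : Type*) [MeasurableSpace Y] (W : PolarSCD.BMSChannel Y) (Q : PolarSCD.Quantizer),
      Q.card = 3 → (∀ x : EReal, 0 < x → 0 < Q x) →
        Monotone (PolarSCD.lowerBound W) ∧ Antitone (PolarSCD.upperBound W) ∧
        (∀ n, PolarSCD.lowerBound W n ≤ PolarSCD.maxRate W Q ∧
          PolarSCD.maxRate W Q ≤ PolarSCD.upperBound W n) ∧
        Tendsto (PolarSCD.lowerBound W) atTop (𝓝 (PolarSCD.maxRate W Q)) ∧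
        Tendsto (PolarSCD.upperBound W) atTop (𝓝 (PolarSCD.maxRate W Q))) ∧
    -- (ii) a universal number of bits per message for a gap `δ` to capacity
    (∃ c : ℝ, 0 < c ∧ ∀ δ : ℝ, 0 < δ → δ ≤ 1 / 2 →
      ∃ Q : PolarSCD.Quantizer, Real.logb 2 Q.card ≤ c * Real.logb 2 (1 / δ) ∧
        ∀ (Y : Type*) [MeasurableSpace Y] (W : PolarSCD.BMSChannel Y),
          W.capacity - δ ≤ PolarSCD.maxRate W Q) := by
  exact ⟨fun Y _ W Q h3 hpos => PolarSCD.three_message_bounds W Q h3 hpos,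
    PolarSCD.exists_quantizer_gap_to_capacity⟩
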